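/- Let $n,d\ge 1$. A $d$-dimensional range over $U=\{0,1,\dots,2^n-1\}$ is a product $R=[a_1,b_1]\times\cdots\times[a_d,b_d]$ with $a_i,b_i\in U$; it represents the set of integer points $\{x\in U^d : a_i\le x_i\le b_i \text{ for all } i\}$ and is presented to an algorithm as the tuple $\langle a_1,b_1,\dots,a_d,b_d\rangle$. (If $a_i>b_i$ for some $i$, the set is empty.) For a finite stream $R_1,\dots,R_M$ of such ranges let $F_0=|R_1\cup\cdots\cup R_M|$. **Theorem.** There is a single randomized streaming algorithm which, given $n,d\ge 1$, an accuracy $\varepsilon>0$ and a confidence $\delta\in(0,1]$ (presented to it through the integers $\lceil 1/\varepsilon\rceil$ and $\lceil\log_2(1/\delta)\rceil$), computes an $(\varepsilon,\delta)$-approximation of $F_0$ over $d$-dimensional ranges: for every finite stream, of any length, the value $c$ which it returns at the end of the stream satisfies $$\Pr\left[\frac{F_0}{1+\varepsilon}\le c\le(1+\varepsilon)F_0\right]\ge 1-\delta .$$ The algorithm takes space $$O\left(\frac{nd}{\varepsilon^2}\cdot\log\frac1\delta\right)$$ and processing time $$O\left((nd)^4\cdot n^d\cdot\frac1{\varepsilon^2}\cdot\log\frac1\delta\right)$$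 per item, for every stream and every outcome of its random choices. Here space is the number of bits of memory that the algorithm keeps between consecutive items of the stream (its sketch together with its random hash functions), and time is measured on a random access machine with logarithmic cost, on which every instruction is charged for the binary lengths of the numbers and addresses it handles (multiplication and division for the product of the two lengths). The constants in $O(\cdot)$ do not depend on $n$, $d$, $\varepsilon$, $\delta$, the stream or the random choices, as long as $\varepsilon\le\varepsilon_0$ and $\delta\le\delta_0$ for some fixed $\varepsilon_0>0$ and $\delta_0<1$, on which they may depend. -/

import Mathlib

/-! ### Multidimensional ranges and the number of distinct elements -/

/-- A `d`-dimensional range `[lo 0, hi 0] × ⋯ × [lo (d-1), hi (d-1)]` over the universe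
`{0, …, 2 ^ n - 1} ^ d`. If `lo i > hi i` for some `i`, the range is empty. -/
structure DRange (n d : ℕ) where
  lo : Fin d → Fin (2 ^ n)
  hi : Fin d → Fin (2 ^ n)

/-- The set of integer points represented by a range. -/
def DRange.points {n d : ℕ} (b : DRange n d) : Set (Fin d → Fin (2 ^ n)) :=
  {x | ∀ i, b.lo i ≤ x i ∧ x i ≤ b.hi i}

/-- The tuple `⟨a₁, b₁, …, a_d, b_d⟩` by which a range is presented to an algorithm: entry `2 * i`
is the lower end and entry `2 * i + 1` the upper end in dimension `i`; all further entries are `0`. -/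
def DRange.encode {n d : ℕ} (b : DRange n d) (j : ℕ) : ℕ :=
  if h : j / 2 < d then
    if j % 2 = 0 then (b.lo ⟨j / 2, h⟩ : ℕ) else (b.hi ⟨j / 2, h⟩ : ℕ)
  else 0

/-- `F₀` of a stream of ranges: the number of points in the union of its items. -/
noncomputable def F0 {n d : ℕ} (s : List (DRange n d)) : ℕ :=
  Set.ncard {x : Fin d → Fin (2 ^ n) | ∃ b ∈ s, x ∈ b.points}

/-! ### The machine: a probabilistic random access machine with logarithmic (bit) cost

A program uses finitely many registers and finitely many dynamic arrays, all of whose cells hold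
natural numbers. Every elementary instruction is charged for the binary lengths `Nat.size` of all
numbers and addresses it handles (multiplication and division for the product of the two lengths).
All loops are counting loops whose number of rounds is fixed on entry. This only restricts the
programs, so that the existence of a program is a stronger claim than with unbounded loops. -/

/-- The read-only parameters of a streaming algorithm for ranges. The accuracy `ε` and the
confidence `δ` are presented through `⌈1 / ε⌉` and `⌈log₂ (1 / δ)⌉`. -/
inductive Param
  | bits
  | dim
  | invEps
  | logInvDelta

/-- What a program may read but not write: the parameters, the current stream item, and a
one-way tape of random bits. -/
structure Env where
  param : Param → ℕ
  item : ℕ → ℕ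
  coins : ℕ → Bool

/-- Operands of instructions, in a program with `R` registers. -/
inductive Operand (R : ℕ)
  | const (c : ℕ)
  | reg (r : Fin R)
  | param (p : Param)

/-- The binary operations of the machine. -/
inductive BinOp
  | add | sub | mul | div | mod | and | or | xor | shl | shr | lt | eq

/-- The value of a binary operation; subtraction is truncated, `a / 0 = 0`, and `a % 0 = a`. -/
def BinOp.eval : BinOp → ℕ → ℕ → ℕ
  | .add, a, b => a + b
  | .sub, a, b => a - b
  | .mul, a, b => a * b
  | .div, a, b => a / b
  | .mod, a, b => a % b
  | .and, a, b => a &&& b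
  | .or, a, b => a ||| b
  | .xor, a, b => a ^^^ b
  | .shl, a, b => a <<< b
  | .shr, a, b => a >>> b
  | .lt, a, b => if a < b then 1 else 0
  | .eq, a, b => if a = b then 1 else 0

/-- The cost of a binary operation: the product of the lengths of the arguments for multiplication,
division and remainder; otherwise the sum of the lengths of the arguments and of the result. -/
def BinOp.cost (f : BinOp) (a b : ℕ) : ℕ :=
  match f with
  | .mul | .div | .mod => (1 + a.size) * (1 + b.size)
  | f => 1 + a.size + b.size + (f.eval a b).size

/-- Programs with `R` registers and `A` arrays. -/
inductive Prog (R A : ℕ)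
  | skip
  | op (f : BinOp) (dst : Fin R) (x y : Operand R)
  | load (dst : Fin R) (a : Fin A) (i : Operand R)
  | store (a : Fin A) (i v : Operand R)
  | push (a : Fin A) (v : Operand R)
  | pop (a : Fin A)
  | length (dst : Fin R) (a : Fin A)
  | input (dst : Fin R) (i : Operand R)
  | coin (dst : Fin R)
  | seq (p q : Prog R A)
  | ite (x : Operand R) (p q : Prog R A)
  | loop (r : Fin R) (x : Operand R) (p : Prog R A)

/-- A configuration: the contents of the registers and arrays, the number of random bits consumed
so far (not accessible to the program), and the accumulated cost. -/
structure Config (R A : ℕ) where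
  reg : Fin R → ℕ
  arr : Fin A → List ℕ
  coinPos : ℕ
  time : ℕ

namespace Config

variable {R A : ℕ}

/-- All registers `0`, all arrays empty, no random bit consumed. -/
def initial : Config R A := ⟨fun _ => 0, fun _ => [], 0, 0⟩

def setReg (c : Config R A) (r : Fin R) (v : ℕ) : Config R A :=
  { c with reg := Function.update c.reg r v }

def setArr (c : Config R A) (a : Fin A) (l : List ℕ) : Config R A :=
  { c with arr := Function.update c.arr a l }

def tick (c : Config R A) (t : ℕ) : Config R A :=
  { c with time := c.time + t }

/-- The number of bits stored in a configuration. Every register and every array cell takes at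
least one bit. -/
def space (c : Config R A) : ℕ :=
  (∑ r, (1 + (c.reg r).size)) + ∑ a, ((c.arr a).map fun v => 1 + v.size).sum

end Config

/-- The value of an operand. -/
def Operand.val {R A : ℕ} (e : Env) (c : Config R A) : Operand R → ℕ
  | .const k => k
  | .reg r => c.reg r
  | .param p => e.param p

/-- Execution of a program, together with its cost. Reading an array outside of its bounds
gives `0`, and writing there has no effect. -/
def Prog.exec {R A : ℕ} (e : Env) : Prog R A → Config R A → Config R A
  | .skip, c => c
  | .op f dst x y, c =>
      (c.setReg dst (f.eval (x.val e c) (y.val e c))).tick (f.cost (x.val e c) (y.val e c))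
  | .load dst a i, c =>
      (c.setReg dst ((c.arr a).getD (i.val e c) 0)).tick
        (1 + (i.val e c).size + ((c.arr a).getD (i.val e c) 0).size)
  | .store a i v, c =>
      (c.setArr a ((c.arr a).set (i.val e c) (v.val e c))).tick
        (1 + (i.val e c).size + (v.val e c).size)
  | .push a v, c =>
      (c.setArr a (c.arr a ++ [v.val e c])).tick (1 + (c.arr a).length.size + (v.val e c).size)
  | .pop a, c => (c.setArr a (c.arr a).dropLast).tick (1 + (c.arr a).length.size)
  | .length dst a, c => (c.setReg dst (c.arr a).length).tick (1 + (c.arr a).length.size)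
  | .input dst i, c =>
      (c.setReg dst (e.item (i.val e c))).tick
        (1 + (i.val e c).size + (e.item (i.val e c)).size)
  | .coin dst, c =>
      { (c.setReg dst (e.coins c.coinPos).toNat).tick 1 with coinPos := c.coinPos + 1 }
  | .seq p q, c => q.exec e (p.exec e c)
  | .ite x p q, c =>
      if x.val e c ≠ 0 then p.exec e (c.tick (1 + (x.val e c).size))
      else q.exec e (c.tick (1 + (x.val e c).size))
  | .loop r x p, c =>
      (List.range (x.val e c)).foldl
        (fun c' i => p.exec e ((c'.setReg r i).tick (1 + i.size)))
        (c.tick (1 + (x.val e c).size))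

/-! ### Streaming algorithms -/

/-- A streaming algorithm: one program that is run before the stream starts, one that is run on
each item, and one that is run at the end. They share their memory. The estimate is the
quotient of the final contents of two registers. -/
structure StreamAlg where
  R : ℕ
  A : ℕ
  init : Prog R A
  update : Prog R A
  query : Prog R A
  outNum : Fin R
  outDen : Fin R

/-- The parameters given to the algorithm for the universe `{0, …, 2 ^ n - 1} ^ d`, accuracy `ε`
and confidence `δ`. -/
noncomputable def params (n d : ℕ) (ε δ : ℝ) : Param → ℕ
  | .bits => n
  | .dim => d
  | .invEps => ⌈1 / ε⌉₊
  | .logInvDelta => ⌈Real.logb 2 (1 / δ)⌉₊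

namespace StreamAlg

variable {n d : ℕ}

/-- One execution of the update program on the item `b`, with the clock started at `0`. -/
def step (alg : StreamAlg) (P : Param → ℕ) (ω : ℕ → Bool) (c : Config alg.R alg.A)
    (b : DRange n d) : Config alg.R alg.A :=
  alg.update.exec ⟨P, b.encode, ω⟩ { c with time := 0 }

/-- The configuration after initialization and after processing the items of `s` in order. -/
def state (alg : StreamAlg) (P : Param → ℕ) (ω : ℕ → Bool) (s : List (DRange n d)) :
    Config alg.R alg.A :=
  s.foldl (alg.step P ω) (alg.init.exec ⟨P, fun _ => 0, ω⟩ Config.initial)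

/-- The configuration after the query program has been run at the end of the stream `s`. -/
def final (alg : StreamAlg) (P : Param → ℕ) (ω : ℕ → Bool) (s : List (DRange n d)) :
    Config alg.R alg.A :=
  alg.query.exec ⟨P, fun _ => 0, ω⟩ (alg.state P ω s)

/-- On the random bits `ω`, the algorithm returns a number `c` (a quotient with nonzero
denominator) with `F₀ / (1 + ε) ≤ c ≤ (1 + ε) F₀`. -/
def Succeeds (alg : StreamAlg) (P : Param → ℕ) (ω : ℕ → Bool) (s : List (DRange n d))
    (ε : ℝ) : Prop :=
  let num : ℕ := (alg.final P ω s).reg alg.outNum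
  let den : ℕ := (alg.final P ω s).reg alg.outDen
  0 < den ∧ (F0 s : ℝ) / (1 + ε) ≤ (num : ℝ) / den ∧ (num : ℝ) / den ≤ (1 + ε) * F0 s

end StreamAlg

/-- The distribution of an infinite sequence of independent fair coin tosses. -/
noncomputable def coinMeasure : MeasureTheory.Measure (ℕ → Bool) :=
  MeasureTheory.Measure.infinitePi fun _ : ℕ => (PMF.uniformOfFintype Bool).toMeasure

/-!
The union of the ranges is estimated by adaptive sampling. Let `m = n * d`, and identify a point
with its code, the bit vector of length `m` made of its coordinates. A key `H < 2 ^ (3 * m)`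
determines a hash function with values in bit vectors of length `m`, whose linear part is a Hankel
matrix (`hashBit`) and whose constant part is uniform. At level `l`, a point survives if the first
`l` bits of its hash value vanish. A copy of the sketch keeps, for its key, the least level at which
at most `T` points of the union survive, together with these points (`Sample`); its estimate is the
number of stored points times `2 ^ l`. This memory depends only on the union, not on the stream.

*Update.* The stored points inside of the new range are dropped, so that its points can be
inserted as new ones. In every dimension the interval `[a, b]` splits into `n` pieces: the ends `a`
and `b`, and for every `j` the at most two dyadic blocks of length `2 ^ j` in which binary
subdivision from both ends proceeds. A pair of blocks of equal length is an affine subspace over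
`𝔽₂`, no less than a single block, so the range is the disjoint union of `n ^ d` products of pieces,
each an affine subspace (`affinePts_term`, `exists_inTerm`, `InTerm.unique`), and no factor `2 ^ d`
arises. Since the hash function is affine, the points of such a subspace that survive at level `l`
are found by Gaussian elimination (`Eliminated.step`, `Eliminated.filter_eq`); their number is known
before they are listed, and the level is raised until they fit (`raiseLoop_spec`). Everything
stored is augmented by its hash value (`entry`), so that no hash value is computed twice.
`updateProg_spec` says that this maintains the invariant `Inv`.

*Accuracy.* The hash function is pairwise independent: each of the conditions that two distinct
points survive at level `l` halves the number of keys, because flipping a suitable bit of the key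
switches it and none of the conditions before (`card_joint`). Hence the number of survivors has
variance at most its mean, and by Chebyshev's inequality at all relevant levels, all but one in
sixteen keys give an accurate estimate if `T = 512 * ⌈1 / ε⌉ ^ 2` (`exists_bad_keys`). Among
`K = ⌈log₂ (1 / δ)⌉` independent copies, half or more are inaccurate with probability at most
`2 ^ K * 16 ^ (-K / 2) = 2 ^ (-K) ≤ δ` (`card_fail_le`), and otherwise a median is accurate
(`median_mem`).

*Resources.* If `⌈1 / ε⌉ ^ 2 * K` is at least the size `2 ^ m` of the universe, a single copy with
`T = 2 ^ m` is used, which is exact. Therefore `K * T < 2 ^ (m + 10)` always, and not only all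
values but also all addresses have `O(m)` bits, so that an instruction costs `O(m ^ 2)`. The number
of instructions per item is `O(K * n ^ d * m ^ 2 * T)`. Programs are analysed with a predicate
transformer `Prog.wp`, which also checks bounds for values and rounds of loops along an execution;
`Prog.wp_time` turns these bounds into a bound for the cost.
-/

/-! ### A predicate transformer for machine programs -/

/-- The part of a configuration that a program can influence its own behaviour with: everything
but the clock. -/
structure Mem (R A : ℕ) where
  reg : Fin R → ℕ
  arr : Fin A → List ℕ
  pos : ℕ

namespace Mem

variable {R A : ℕ}

/-- Writing a register. -/
def setReg (s : Mem R A) (r : Fin R) (v : ℕ) : Mem R A :=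
  { s with reg := Function.update s.reg r v }

/-- Replacing an array. -/
def setArr (s : Mem R A) (a : Fin A) (l : List ℕ) : Mem R A :=
  { s with arr := Function.update s.arr a l }

@[simp] theorem setReg_reg (s : Mem R A) (r q : Fin R) (v : ℕ) :
    (s.setReg r v).reg q = if q = r then v else s.reg q := by
  simp [setReg, Function.update_apply]

@[simp] theorem setReg_arr (s : Mem R A) (r : Fin R) (v : ℕ) : (s.setReg r v).arr = s.arr := rfl

@[simp] theorem setReg_pos (s : Mem R A) (r : Fin R) (v : ℕ) : (s.setReg r v).pos = s.pos := rfl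

@[simp] theorem setArr_reg (s : Mem R A) (a : Fin A) (l : List ℕ) : (s.setArr a l).reg = s.reg :=
  rfl

@[simp] theorem setArr_pos (s : Mem R A) (a : Fin A) (l : List ℕ) : (s.setArr a l).pos = s.pos :=
  rfl

@[simp] theorem setArr_arr (s : Mem R A) (a b : Fin A) (l : List ℕ) :
    (s.setArr a l).arr b = if b = a then l else s.arr b := by
  simp [setArr, Function.update_apply]

/-- All registers, array cells and array lengths are below `2 ^ S`. -/
def Bdd (S : ℕ) (s : Mem R A) : Prop :=
  (∀ r, s.reg r < 2 ^ S) ∧ (∀ a, (s.arr a).length < 2 ^ S) ∧ ∀ a, ∀ v ∈ s.arr a, v < 2 ^ S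

end Mem

/-- The memory of a configuration. -/
def Config.mem {R A : ℕ} (c : Config R A) : Mem R A := ⟨c.reg, c.arr, c.coinPos⟩

/-- The value of an operand in a memory. -/
def Operand.get {R A : ℕ} (e : Env) (s : Mem R A) : Operand R → ℕ
  | .const k => k
  | .reg r => s.reg r
  | .param p => e.param p

theorem Operand.val_eq_get {R A : ℕ} (e : Env) (c : Config R A) (x : Operand R) :
    x.val e c = x.get e c.mem := by
  cases x <;> rfl

/-- The operations whose result can be longer than both arguments. -/
def BinOp.grows : BinOp → Bool
  | .add | .mul | .shl => true
  | _ => false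

/-- Side conditions to be checked along an execution: on the values produced by growing operations,
and on the numbers of rounds of loops. -/
structure Lim (R : ℕ) where
  val : ℕ → Prop
  rounds : Operand R → ℕ → Prop

/-- No side conditions. -/
def Lim.none {R : ℕ} : Lim R := ⟨fun _ => True, fun _ _ => True⟩

/-- Values stay below `2 ^ S`, and a loop controlled by the operand `x` makes at most `bnd x`
rounds. -/
def Lim.bdd {R : ℕ} (S : ℕ) (bnd : Operand R → ℕ) : Lim R :=
  ⟨fun v => v < 2 ^ S, fun x v => v ≤ bnd x⟩

namespace Prog

variable {R A : ℕ}

/-- `p.wp e lim Q s`: run from the memory `s`, the program `p` respects the side conditions `lim`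
and ends in a memory satisfying `Q`. Loops are described by an invariant.

Programs are specified in continuation style: `p.wp e lim Q s` holds if `Q` holds for all memories
that satisfy the postcondition of `p` and agree with `s` wherever `p` does not write
(`Prog.Frame`). -/
def wp (e : Env) (lim : Lim R) : Prog R A → (Mem R A → Prop) → Mem R A → Prop
  | .skip, Q, s => Q s
  | .op f dst x y, Q, s =>
      (f.grows = true → lim.val (f.eval (x.get e s) (y.get e s))) ∧
        Q (s.setReg dst (f.eval (x.get e s) (y.get e s)))
  | .load dst a i, Q, s => Q (s.setReg dst ((s.arr a).getD (i.get e s) 0))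
  | .store a i v, Q, s => Q (s.setArr a ((s.arr a).set (i.get e s) (v.get e s)))
  | .push a v, Q, s =>
      lim.val ((s.arr a).length + 1) ∧ Q (s.setArr a (s.arr a ++ [v.get e s]))
  | .pop a, Q, s => Q (s.setArr a (s.arr a).dropLast)
  | .length dst a, Q, s => Q (s.setReg dst (s.arr a).length)
  | .input dst i, Q, s => Q (s.setReg dst (e.item (i.get e s)))
  | .coin dst, Q, s =>
      Q { s.setReg dst (e.coins s.pos).toNat with pos := s.pos + 1 }
  | .seq p q, Q, s => p.wp e lim (q.wp e lim Q) s
  | .ite x p q, Q, s => (x.get e s ≠ 0 → p.wp e lim Q s) ∧ (x.get e s = 0 → q.wp e lim Q s)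
  | .loop r x p, Q, s =>
      lim.rounds x (x.get e s) ∧ ∃ I : ℕ → Mem R A → Prop, I 0 s ∧
        (∀ i < x.get e s, ∀ s', I i s' → p.wp e lim (I (i + 1)) (s'.setReg r i)) ∧
        ∀ s', I (x.get e s) s' → Q s'

/-- The registers that a program may write. -/
def modR : Prog R A → Fin R → Bool
  | .op _ d _ _, q | .load d _ _, q | .length d _, q | .input d _, q | .coin d, q => decide (q = d)
  | .seq p p', q | .ite _ p p', q => p.modR q || p'.modR q
  | .loop r _ p, q => decide (q = r) || p.modR q
  | _, _ => false

/-- The arrays that a program may write. -/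
def modA : Prog R A → Fin A → Bool
  | .store a _ _, q | .push a _, q | .pop a, q => decide (q = a)
  | .seq p p', q | .ite _ p p', q => p.modA q || p'.modA q
  | .loop _ _ p, q => p.modA q
  | _, _ => false

/-- `s'` agrees with `s` on all registers and arrays that `p` does not write. -/
def Frame (p : Prog R A) (s s' : Mem R A) : Prop :=
  (∀ q, p.modR q = false → s'.reg q = s.reg q) ∧ ∀ a, p.modA a = false → s'.arr a = s.arr a

theorem wp_mono {e : Env} {lim : Lim R} {p : Prog R A} {Q Q' : Mem R A → Prop}
    (hQ : ∀ s, Q s → Q' s) {s : Mem R A} (h : p.wp e lim Q s) : p.wp e lim Q' s := by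
  induction p generalizing Q Q' s with
  | skip => exact hQ _ h
  | op => exact ⟨h.1, hQ _ h.2⟩
  | load => exact hQ _ h
  | store => exact hQ _ h
  | push => exact ⟨h.1, hQ _ h.2⟩
  | pop => exact hQ _ h
  | length => exact hQ _ h
  | input => exact hQ _ h
  | coin => exact hQ _ h
  | seq p q ihp ihq => exact ihp (fun s' hs' => ihq hQ hs') h
  | ite x p q ihp ihq => exact ⟨fun hx => ihp hQ (h.1 hx), fun hx => ihq hQ (h.2 hx)⟩
  | loop r x p ih =>
    obtain ⟨hb, I, h0, hs, hI⟩ := h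
    exact ⟨hb, I, h0, hs, fun s' hs' => hQ _ (hI s' hs')⟩

/-- The frame property relative to a memory `s₀` from which `s` may differ already, in the places
that `P` and `P'` allow; in this form it passes through sequences and loops. -/
theorem wp_frame_aux {e : Env} {lim : Lim R} {p : Prog R A} {Q : Mem R A → Prop}
    {s s₀ : Mem R A} (P : Fin R → Bool) (P' : Fin A → Bool)
    (hP : ∀ q, P q = false → p.modR q = false) (hP' : ∀ q, P' q = false → p.modA q = false)
    (hr : ∀ q, P q = false → s.reg q = s₀.reg q) (ha : ∀ a, P' a = false → s.arr a = s₀.arr a)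
    (h : p.wp e lim Q s) :
    p.wp e lim (fun s' => Q s' ∧ (∀ q, P q = false → s'.reg q = s₀.reg q) ∧
      ∀ a, P' a = false → s'.arr a = s₀.arr a) s := by
  have key : ∀ (d : Fin R) (v : ℕ), (∀ q, P q = false → decide (q = d) = false) →
      ∀ q, P q = false → (s.setReg d v).reg q = s₀.reg q := by
    intro d v hd q hq
    have := hd q hq
    simp only [decide_eq_false_iff_not] at this
    simp [this, hr q hq]
  have key' : ∀ (d : Fin A) (v : List ℕ), (∀ q, P' q = false → decide (q = d) = false) →
      ∀ q, P' q = false → (s.setArr d v).arr q = s₀.arr q := by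
    intro d v hd q hq
    have := hd q hq
    simp only [decide_eq_false_iff_not] at this
    simp [this, ha q hq]
  induction p generalizing Q s with
  | skip => exact ⟨h, hr, ha⟩
  | op f d x y => exact ⟨h.1, h.2, key d _ hP, ha⟩
  | load d => exact ⟨h, key d _ hP, ha⟩
  | store a => exact ⟨h, hr, key' a _ hP'⟩
  | push a => exact ⟨h.1, h.2, hr, key' a _ hP'⟩
  | pop a => exact ⟨h, hr, key' a _ hP'⟩
  | length d => exact ⟨h, key d _ hP, ha⟩
  | input d => exact ⟨h, key d _ hP, ha⟩
  | coin d => exact ⟨h, key d _ hP, ha⟩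
  | seq p q ihp ihq =>
    simp only [modR, modA, Bool.or_eq_false_iff] at hP hP'
    simp only [wp] at h ⊢
    refine wp_mono ?_ (ihp (fun q h => (hP q h).1) (fun q h => (hP' q h).1) hr ha h key key')
    rintro s' ⟨h1, h2, h3⟩
    refine ihq (fun q h => (hP q h).2) (fun q h => (hP' q h).2) h2 h3 h1 ?_ ?_
    · intro d v hd q hq
      have := hd q hq
      simp only [decide_eq_false_iff_not] at this
      simp [this, h2 q hq]
    · intro d v hd q hq
      have := hd q hq
      simp only [decide_eq_false_iff_not] at this
      simp [this, h3 q hq]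
  | ite x p q ihp ihq =>
    simp only [modR, modA, Bool.or_eq_false_iff] at hP hP'
    exact ⟨fun hx => ihp (fun q h => (hP q h).1) (fun q h => (hP' q h).1) hr ha (h.1 hx) key key',
      fun hx => ihq (fun q h => (hP q h).2) (fun q h => (hP' q h).2) hr ha (h.2 hx) key key'⟩
  | loop r x p ih =>
    simp only [modR, modA, Bool.or_eq_false_iff] at hP hP'
    obtain ⟨hb, I, h0, hs, hI⟩ := h
    refine ⟨hb, fun i s' => I i s' ∧ (∀ q, P q = false → s'.reg q = s₀.reg q) ∧
      ∀ a, P' a = false → s'.arr a = s₀.arr a, ⟨h0, hr, ha⟩, ?_, fun s' hs' => ⟨hI _ hs'.1, hs'.2⟩⟩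
    rintro i hi s' ⟨h1, h2, h3⟩
    have hr' : ∀ q, P q = false → (s'.setReg r i).reg q = s₀.reg q := by
      intro q hq
      have := (hP q hq).1
      simp only [decide_eq_false_iff_not] at this
      simp [this, h2 q hq]
    refine ih (fun q h => (hP q h).2) hP' hr' h3 (hs i hi s' h1) ?_ ?_
    · intro d v hd q hq
      have := hd q hq
      simp only [decide_eq_false_iff_not] at this
      rw [Mem.setReg_reg, if_neg this]; exact hr' q hq
    · intro d v hd q hq
      have := hd q hq
      simp only [decide_eq_false_iff_not] at this
      simp [this, h3 q hq]

/-- What a program does not write stays as it was. -/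
theorem wp_frame {e : Env} {lim : Lim R} {p : Prog R A} {Q : Mem R A → Prop} {s : Mem R A}
    (h : p.wp e lim (fun s' => p.Frame s s' → Q s') s) : p.wp e lim Q s :=
  wp_mono (fun _ h => h.1 h.2) (wp_frame_aux p.modR p.modA (fun _ h => h) (fun _ h => h)
    (fun _ _ => rfl) (fun _ _ => rfl) h)

/-- The rule for loops. In every round the frame property of the whole loop is available. -/
theorem wp_loop {e : Env} {lim : Lim R} {r : Fin R} {x : Operand R} {p : Prog R A}
    {Q : Mem R A → Prop} {s : Mem R A} (I : ℕ → Mem R A → Prop)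
    (hb : lim.rounds x (x.get e s)) (h0 : I 0 s)
    (hs : ∀ i s', i < x.get e s → I i s' → (loop r x p).Frame s s' →
      p.wp e lim (I (i + 1)) (s'.setReg r i))
    (hQ : ∀ s', I (x.get e s) s' → (loop r x p).Frame s s' → Q s') :
    (loop r x p).wp e lim Q s := by
  refine ⟨hb, fun i s' => I i s' ∧ (loop r x p).Frame s s', ⟨h0, fun _ _ => rfl, fun _ _ => rfl⟩,
    ?_, fun s' h => hQ s' h.1 h.2⟩
  rintro i hi s' ⟨h1, h2⟩
  refine wp_mono (fun _ h => ?_) (wp_frame_aux (s₀ := s) (loop r x p).modR (loop r x p).modA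
    ?_ (fun _ h => h) ?_ h2.2 (hs i s' hi h1 h2))
  · exact ⟨h.1, h.2⟩
  · intro q hq
    simp only [modR, Bool.or_eq_false_iff] at hq
    exact hq.2
  · intro q hq
    have := hq
    simp only [modR, Bool.or_eq_false_iff, decide_eq_false_iff_not] at this
    simp [this.1, h2.1 q hq]

/-! ### Soundness of the predicate transformer -/

theorem loop_foldl_mem {e : Env} {lim : Lim R} {r : Fin R} {p : Prog R A} (I : ℕ → Mem R A → Prop)
    (hp : ∀ {Q : Mem R A → Prop} {c : Config R A}, p.wp e lim Q c.mem → Q (p.exec e c).mem)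
    (k : ℕ) (c : Config R A) (h0 : I 0 c.mem)
    (hs : ∀ i < k, ∀ s', I i s' → p.wp e lim (I (i + 1)) (s'.setReg r i)) :
    I k ((List.range k).foldl
      (fun c' i => p.exec e ((c'.setReg r i).tick (1 + i.size))) c).mem := by
  induction k with
  | zero => exact h0
  | succ k ih =>
    rw [List.range_succ, List.foldl_append]
    exact hp (hs k (Nat.lt_succ_self k) _ (ih fun i hi => hs i (hi.trans (Nat.lt_succ_self k))))

/-- If the precondition computed by `wp` holds before an execution, then `Q` holds after it. -/
theorem wp_sound {e : Env} {lim : Lim R} {p : Prog R A} {Q : Mem R A → Prop} {c : Config R A}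
    (h : p.wp e lim Q c.mem) : Q (p.exec e c).mem := by
  induction p generalizing Q c with
  | skip => exact h
  | op f d x y =>
    have := h.2
    rw [← Operand.val_eq_get, ← Operand.val_eq_get] at this
    exact this
  | load d a i =>
    simp only [wp] at h
    rw [← Operand.val_eq_get] at h
    exact h
  | store a i v =>
    simp only [wp] at h
    rw [← Operand.val_eq_get, ← Operand.val_eq_get] at h
    exact h
  | push a v =>
    have := h.2
    rw [← Operand.val_eq_get] at this
    exact this
  | pop a => exact h
  | length d a => exact h
  | input d i =>
    simp only [wp] at h
    rw [← Operand.val_eq_get] at h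
    exact h
  | coin d => exact h
  | seq p q ihp ihq => exact ihq (ihp h)
  | ite x p q ihp ihq =>
    simp only [exec]
    split_ifs with hx
    · exact ihp (h.1 (by rwa [← Operand.val_eq_get]))
    · exact ihq (h.2 (by rw [← Operand.val_eq_get]; exact not_not.mp hx))
  | loop r x p ih =>
    obtain ⟨-, I, h0, hs, hI⟩ := h
    rw [← Operand.val_eq_get] at hs hI
    exact hI _ (loop_foldl_mem I (fun h => ih h) _ _ h0 hs)

/-! ### Worst-case cost of a program -/

/-- An operand without parameters, all of whose constants are at most `2`. -/
def _root_.Operand.plain : Operand R → Bool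
  | .const k => decide (k ≤ 2)
  | .reg _ => true
  | .param _ => false

/-- A program that reads no parameters and uses no constants above `2`. -/
def plain : Prog R A → Bool
  | .skip | .pop _ | .length _ _ | .coin _ => true
  | .op _ _ x y | .store _ x y => x.plain && y.plain
  | .load _ _ x | .push _ x | .input _ x => x.plain
  | .seq p q => p.plain && q.plain
  | .ite x p q => x.plain && (p.plain && q.plain)
  | .loop _ x p => x.plain && p.plain

/-- A bound for the number of instructions executed, if a loop controlled by `x` makes at most
`bnd x` rounds. -/
def ticks (bnd : Operand R → ℕ) : Prog R A → ℕ
  | .skip => 0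
  | .seq p q => p.ticks bnd + q.ticks bnd
  | .ite _ p q => 1 + (p.ticks bnd + q.ticks bnd)
  | .loop _ x p => 1 + bnd x * (1 + p.ticks bnd)
  | _ => 1

end Prog

/-- Operations outside of `BinOp.grows` do not lead out of the numbers below `2 ^ S`. -/
theorem BinOp.eval_lt {f : BinOp} {S a b : ℕ} (ha : a < 2 ^ S) (hb : b < 2 ^ S) (hS : 1 ≤ S)
    (h : f.grows = true → f.eval a b < 2 ^ S) : f.eval a b < 2 ^ S := by
  have h1 : 1 < 2 ^ S := Nat.one_lt_two_pow (by omega)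
  cases f with
  | add => exact h rfl
  | mul => exact h rfl
  | shl => exact h rfl
  | sub => exact (Nat.sub_le _ _).trans_lt ha
  | div => exact (Nat.div_le_self _ _).trans_lt ha
  | mod => exact (Nat.mod_le _ _).trans_lt ha
  | and => exact Nat.and_lt_two_pow _ hb
  | or => exact Nat.or_lt_two_pow ha hb
  | xor => exact Nat.xor_lt_two_pow ha hb
  | shr => exact (Nat.shiftRight_le _ _).trans_lt ha
  | lt => simp only [eval]; split_ifs <;> omega
  | eq => simp only [eval]; split_ifs <;> omega

theorem BinOp.cost_le {f : BinOp} {S a b : ℕ} (ha : a < 2 ^ S) (hb : b < 2 ^ S)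
    (hr : f.eval a b < 2 ^ S) : f.cost a b ≤ 3 * (S + 1) ^ 2 := by
  have h1 := Nat.size_le.mpr ha
  have h2 := Nat.size_le.mpr hb
  have h3 := Nat.size_le.mpr hr
  cases f <;> simp only [cost] <;> nlinarith

namespace Prog

variable {R A : ℕ}

theorem _root_.Operand.plain.lt {e : Env} {s : Mem R A} {S : ℕ} {x : Operand R} (hS : 2 ≤ S)
    (hx : x.plain = true) (hs : s.Bdd S) : x.get e s < 2 ^ S := by
  cases x with
  | const k =>
    have h : k ≤ 2 := by simpa [Operand.plain] using hx
    calc k ≤ 2 := h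
      _ < 2 ^ 2 := by norm_num
      _ ≤ 2 ^ S := Nat.pow_le_pow_right (by norm_num) hS
  | reg r => exact hs.1 r
  | param p => simp [Operand.plain] at hx

theorem _root_.Mem.Bdd.setReg {S : ℕ} {s : Mem R A} (hs : s.Bdd S) {r : Fin R} {v : ℕ}
    (hv : v < 2 ^ S) : (s.setReg r v).Bdd S := by
  refine ⟨fun q => ?_, hs.2.1, hs.2.2⟩
  rw [Mem.setReg_reg]
  split_ifs
  · exact hv
  · exact hs.1 q

theorem _root_.Mem.Bdd.setArr {S : ℕ} {s : Mem R A} (hs : s.Bdd S) {a : Fin A} {l : List ℕ}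
    (hl : l.length < 2 ^ S) (hv : ∀ v ∈ l, v < 2 ^ S) : (s.setArr a l).Bdd S := by
  refine ⟨hs.1, fun q => ?_, fun q => ?_⟩ <;> rw [Mem.setArr_arr] <;> split_ifs
  · exact hl
  · exact hs.2.1 q
  · exact hv
  · exact hs.2.2 q

theorem _root_.Mem.Bdd.getD {S : ℕ} {s : Mem R A} (hs : s.Bdd S) (a : Fin A) (i : ℕ) :
    (s.arr a).getD i 0 < 2 ^ S := by
  rcases lt_or_ge i (s.arr a).length with h | h
  · rw [List.getD_eq_getElem _ _ h]
    exact hs.2.2 a _ (List.getElem_mem h)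
  · rw [List.getD_eq_default _ _ h]
    positivity

/-- If all values stay below `2 ^ S`, then every instruction costs at most `3 * (S + 1) ^ 2`. -/
theorem wp_time {e : Env} {S : ℕ} {bnd : Operand R → ℕ} (hS : 2 ≤ S) (he : ∀ i, e.item i < 2 ^ S)
    {p : Prog R A} {Q : Mem R A → Prop} {c : Config R A} (hp : p.plain = true)
    (hc : c.mem.Bdd S) (h : p.wp e (Lim.bdd S bnd) Q c.mem) :
    (p.exec e c).mem.Bdd S ∧
      (p.exec e c).time ≤ c.time + p.ticks bnd * (3 * (S + 1) ^ 2) := by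
  have small : ∀ a b : ℕ, a < 2 ^ S → b < 2 ^ S → 1 + a.size + b.size ≤ 3 * (S + 1) ^ 2 := by
    intro a b ha hb
    have h1 := Nat.size_le.mpr ha
    have h2 := Nat.size_le.mpr hb
    nlinarith
  have small1 : ∀ a : ℕ, a < 2 ^ S → 1 + a.size ≤ 3 * (S + 1) ^ 2 := by
    intro a ha
    have := small a a ha ha
    omega
  induction p generalizing Q c with
  | skip => exact ⟨hc, by simp [exec]⟩
  | op f d x y =>
    simp only [plain, Bool.and_eq_true] at hp
    have hx := Operand.plain.lt (e := e) hS hp.1 hc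
    have hy := Operand.plain.lt (e := e) hS hp.2 hc
    have hr := BinOp.eval_lt hx hy (by omega) h.1
    simp only [exec, ticks, one_mul, Operand.val_eq_get]
    exact ⟨hc.setReg hr, by
      simpa [Config.tick, Config.setReg, Config.mem] using BinOp.cost_le hx hy hr⟩
  | load d a i =>
    simp only [plain] at hp
    have hx := Operand.plain.lt (e := e) hS hp hc
    have hv := hc.getD a (i.get e c.mem)
    simp only [exec, ticks, one_mul, Operand.val_eq_get]
    exact ⟨hc.setReg hv, by simpa [Config.tick, Config.setReg, Config.mem] using small _ _ hx hv⟩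
  | store a i v =>
    simp only [plain, Bool.and_eq_true] at hp
    have hx := Operand.plain.lt (e := e) hS hp.1 hc
    have hv := Operand.plain.lt (e := e) hS hp.2 hc
    simp only [exec, ticks, one_mul, Operand.val_eq_get]
    refine ⟨hc.setArr (by simpa [Config.mem] using hc.2.1 a) fun w hw => ?_,
      by simpa [Config.tick, Config.setArr, Config.mem] using small _ _ hx hv⟩
    rcases List.mem_or_eq_of_mem_set hw with hw | rfl
    · exact hc.2.2 a w hw
    · exact hv
  | push a v =>
    simp only [plain] at hp
    have hv := Operand.plain.lt (e := e) hS hp hc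
    simp only [exec, ticks, one_mul, Operand.val_eq_get]
    refine ⟨hc.setArr (by simpa [Config.mem, Lim.bdd] using h.1) fun w hw => ?_,
      by simpa [Config.tick, Config.setArr, Config.mem] using small _ _ (hc.2.1 a) hv⟩
    rcases List.mem_append.mp hw with hw | hw
    · exact hc.2.2 a w hw
    · rw [List.mem_singleton.mp hw]; exact hv
  | pop a =>
    simp only [exec, ticks, one_mul]
    refine ⟨hc.setArr ?_ fun w hw => hc.2.2 a w (List.mem_of_mem_dropLast hw),
      by simpa [Config.tick, Config.setArr, Config.mem] using small1 _ (hc.2.1 a)⟩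
    rw [List.length_dropLast]
    exact (Nat.sub_le _ _).trans_lt (hc.2.1 a)
  | length d a =>
    simp only [exec, ticks, one_mul]
    exact ⟨hc.setReg (hc.2.1 a), by
      simpa [Config.tick, Config.setReg, Config.mem] using small1 _ (hc.2.1 a)⟩
  | input d i =>
    simp only [plain] at hp
    have hx := Operand.plain.lt (e := e) hS hp hc
    simp only [exec, ticks, one_mul, Operand.val_eq_get]
    exact ⟨hc.setReg (he _), by
      simpa [Config.tick, Config.setReg, Config.mem] using small _ _ hx (he _)⟩
  | coin d =>
    simp only [exec, ticks, one_mul]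
    have h1 : (e.coins c.coinPos).toNat < 2 ^ S :=
      lt_of_lt_of_le (by have := Bool.toNat_le (e.coins c.coinPos); omega)
        (Nat.pow_le_pow_right (by norm_num : 0 < 2) (by omega : 1 ≤ S))
    have := hc.setReg (r := d) h1
    refine ⟨this, ?_⟩
    simp only [Config.tick, Config.setReg]
    nlinarith
  | seq p q ihp ihq =>
    simp only [plain, Bool.and_eq_true] at hp
    obtain ⟨h1, h2⟩ := ihp hp.1 hc h
    obtain ⟨h3, h4⟩ := ihq hp.2 h1 (wp_sound h)
    refine ⟨h3, ?_⟩
    simp only [exec, ticks]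
    linarith
  | ite x p q ihp ihq =>
    simp only [plain, Bool.and_eq_true] at hp
    have hx := small1 _ (Operand.plain.lt (e := e) hS hp.1 hc)
    rw [← Operand.val_eq_get] at hx
    simp only [exec]
    split_ifs with hx'
    · obtain ⟨h1, h2⟩ := ihp (c := c.tick (1 + (x.val e c).size)) hp.2.1 hc
        (h.1 (by rwa [← Operand.val_eq_get]))
      refine ⟨h1, h2.trans ?_⟩
      simp only [Config.tick, ticks]
      nlinarith [Nat.zero_le (q.ticks bnd * (3 * (S + 1) ^ 2))]
    · obtain ⟨h1, h2⟩ := ihq (c := c.tick (1 + (x.val e c).size)) hp.2.2 hc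
        (h.2 (by rw [← Operand.val_eq_get]; exact not_not.mp hx'))
      refine ⟨h1, h2.trans ?_⟩
      simp only [Config.tick, ticks]
      nlinarith [Nat.zero_le (p.ticks bnd * (3 * (S + 1) ^ 2))]
  | loop r x p ih =>
    simp only [plain, Bool.and_eq_true] at hp
    have hx := Operand.plain.lt (e := e) hS hp.1 hc
    obtain ⟨hb, I, h0, hs, -⟩ := h
    rw [← Operand.val_eq_get] at hs hx hb
    have key : ∀ k ≤ x.val e c, ∀ c₀ : Config R A, c₀.mem = c.mem →
        ((List.range k).foldl
          (fun c' i => p.exec e ((c'.setReg r i).tick (1 + i.size))) c₀).mem.Bdd S ∧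
        ((List.range k).foldl
          (fun c' i => p.exec e ((c'.setReg r i).tick (1 + i.size))) c₀).time ≤
            c₀.time + k * ((1 + p.ticks bnd) * (3 * (S + 1) ^ 2)) := by
      intro k hk c₀ hc₀
      induction k with
      | zero => exact ⟨by simpa [hc₀] using hc, by simp⟩
      | succ k ihk =>
        obtain ⟨h1, h2⟩ := ihk (by omega)
        have hI := loop_foldl_mem (r := r) I (fun h => wp_sound h) k c₀ (hc₀ ▸ h0)
          fun i hi => hs i (by omega)
        rw [List.range_succ, List.foldl_append]
        set c₁ := (List.range k).foldl
          (fun c' i => p.exec e ((c'.setReg r i).tick (1 + i.size))) c₀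
        have hk' : k < 2 ^ S := by omega
        obtain ⟨h3, h4⟩ := ih (c := (c₁.setReg r k).tick (1 + k.size)) hp.2
          (h1.setReg hk') (hs k (by omega) _ hI)
        refine ⟨h3, h4.trans ?_⟩
        have := small1 k hk'
        simp only [Config.tick, Config.setReg]
        nlinarith
    obtain ⟨h1, h2⟩ := key _ le_rfl (c.tick (1 + (x.val e c).size)) rfl
    refine ⟨h1, h2.trans ?_⟩
    have h3 := small1 _ hx
    have h4 : x.val e c * ((1 + p.ticks bnd) * (3 * (S + 1) ^ 2)) ≤
        bnd x * ((1 + p.ticks bnd) * (3 * (S + 1) ^ 2)) := Nat.mul_le_mul_right _ hb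
    simp only [Config.tick, ticks]
    nlinarith

end Prog

namespace RangeSketch

/-! ### The hash functions and the pieces of a range, as computed by the machine -/

/-- Column `b` of the augmented matrix of the hash function with key `H`: the unit vector `2 ^ b`,
and above it (shifted by `m`) the window of `m` bits of `H` that starts at position `b`. -/
def hashCol (m H b : ℕ) : ℕ := (((H >>> b) % 2 ^ m) <<< m) ^^^ (1 <<< b)

/-- The sum over `𝔽₂` of the columns that belong to the bits `b < k` of `v`. -/
def augTo (m H v : ℕ) : ℕ → ℕ
  | 0 => 0
  | k + 1 => if v.testBit k then augTo m H v k ^^^ hashCol m H k else augTo m H v k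

/-- A bit vector `v < 2 ^ m`, augmented by its image under the linear part of the hash function. -/
def aug (m H v : ℕ) : ℕ := augTo m H v m

/-- The constant part of an entry: the top `m` bits of the key, and a bit `1` above them. -/
def offset (m H : ℕ) : ℕ := ((H >>> (2 * m)) ^^^ 2 ^ m) <<< m

/-- What is stored for a point with code `v`: the code, the `m` bits of its hash value, and a
sentinel bit `1`. -/
def entry (m H v : ℕ) : ℕ := aug m H v ^^^ offset m H

/-- The point with code `v` lies in the range presented as the tuple `it`. -/
def InBox (n d : ℕ) (it : ℕ → ℕ) (v : ℕ) : Prop :=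
  ∀ i < d, it (2 * i) ≤ (v >>> (n * i)) % 2 ^ n ∧ (v >>> (n * i)) % 2 ^ n ≤ it (2 * i + 1)

instance (n d : ℕ) (it : ℕ → ℕ) : DecidablePred (InBox n d it) := fun v => by
  unfold InBox; infer_instance

/-- Whether the piece of `[a, b]` with index `k` is nonempty. Piece `0` consists of `a` and `b`.
Piece `j + 1` consists of the dyadic blocks of length `2 ^ j` that lie strictly between those of `a`
and `b`, but in the block of length `2 ^ (j + 1)` of `a` or of `b`, if these two differ. So the only
candidates are the sibling of the block of `a`, provided that bit `j` of `a` is `0`, and the sibling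
of the block of `b`, provided that bit `j` of `b` is `1`. -/
def pieceOk (a b k : ℕ) : Prop :=
  if k = 0 then a ≤ b
  else a >>> (k - 1) >>> 1 < b >>> (k - 1) >>> 1 ∧
    (a.testBit (k - 1) = false ∨ b.testBit (k - 1) = true)

instance (a b k : ℕ) : Decidable (pieceOk a b k) := by
  unfold pieceOk; infer_instance

/-- The number of the lower dyadic block of the piece with index `k`; it is equal to `pieceQ` if
there is only one block. -/
def pieceP (a b k : ℕ) : ℕ :=
  if k = 0 then a
  else if a.testBit (k - 1) then b >>> (k - 1) ^^^ 1 else a >>> (k - 1) ^^^ 1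

/-- The number of the upper dyadic block of the piece with index `k`; it is equal to `pieceP` if
there is only one block. -/
def pieceQ (a b k : ℕ) : ℕ :=
  if k = 0 then b
  else if a.testBit (k - 1) ∨ b.testBit (k - 1) then b >>> (k - 1) ^^^ 1 else a >>> (k - 1) ^^^ 1

/-- Digit `i` of a term number in base `n`: the index of the piece used in dimension `i`. -/
def digit (n t i : ℕ) : ℕ := t / n ^ i % n

/-- Base point of the term with number `t`, restricted to the first `i` dimensions. -/
def termBase (n : ℕ) (it : ℕ → ℕ) (t : ℕ) : ℕ → ℕ
  | 0 => 0
  | i + 1 => termBase n it t i ^^^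
      pieceP (it (2 * i)) (it (2 * i + 1)) (digit n t i) <<< (n * i + (digit n t i - 1))

/-- Generators of the term with number `t`, restricted to the first `i` dimensions. -/
def termGens (n : ℕ) (it : ℕ → ℕ) (t : ℕ) : ℕ → List ℕ
  | 0 => []
  | i + 1 => termGens n it t i ++
      ((pieceQ (it (2 * i)) (it (2 * i + 1)) (digit n t i) ^^^
        pieceP (it (2 * i)) (it (2 * i + 1)) (digit n t i)) <<< (n * i + (digit n t i - 1)) ::
        (List.range (digit n t i - 1)).map fun b => 1 <<< (n * i + b))

/-- All pieces that make up the term with number `t` are nonempty. -/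
def TermOk (n : ℕ) (it : ℕ → ℕ) (t d : ℕ) : Prop :=
  ∀ i < d, pieceOk (it (2 * i)) (it (2 * i + 1)) (digit n t i)

instance (n : ℕ) (it : ℕ → ℕ) (t d : ℕ) : Decidable (TermOk n it t d) := by
  unfold TermOk; infer_instance

/-- Clearing bit `s` of `x` with the help of a pivot `p`. -/
def clearBit (s p x : ℕ) : ℕ := if x.testBit s then x ^^^ p else x

/-- Doubling a list along the nonzero generators. -/
def spanList (l : List ℕ) (G : List ℕ) : List ℕ :=
  G.foldl (fun l g => if g = 0 then l else l ++ l.map (· ^^^ g)) l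

/-! ### The program -/

-- Names of registers. The first nine hold `n`, `d`, `m = n * d`, `2 ^ m`, `2 ^ n`, the number of
-- copies, the capacity of a copy, the number `n ^ d` of terms, and `m + 1`; they are constant after
-- initialization.
notation "rN" => (0 : Fin 42)
notation "rDim" => (1 : Fin 42)
notation "rM" => (2 : Fin 42)
notation "rPw" => (3 : Fin 42)
notation "rPn" => (4 : Fin 42)
notation "rK" => (5 : Fin 42)
notation "rT" => (6 : Fin 42)
notation "rTm" => (7 : Fin 42)
notation "rMs" => (8 : Fin 42)
-- The current copy, its key, its level, and the offset of its block in the array of samples.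
notation "rC" => (9 : Fin 42)
notation "rH" => (10 : Fin 42)
notation "rLev" => (11 : Fin 42)
notation "rOff" => (12 : Fin 42)
-- Working registers.
notation "rJ" => (13 : Fin 42)
notation "rZ" => (14 : Fin 42)
notation "rIn" => (15 : Fin 42)
notation "rI" => (16 : Fin 42)
notation "rLo" => (17 : Fin 42)
notation "rHi" => (18 : Fin 42)
notation "rE" => (19 : Fin 42)
notation "rS" => (20 : Fin 42)
notation "rU" => (21 : Fin 42)
notation "rV" => (22 : Fin 42)
notation "rW" => (23 : Fin 42)
notation "rTerm" => (24 : Fin 42)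
notation "rQ" => (25 : Fin 42)
notation "rOk" => (26 : Fin 42)
notation "rBase" => (27 : Fin 42)
notation "rKk" => (28 : Fin 42)
notation "rJj" => (29 : Fin 42)
notation "rB" => (30 : Fin 42)
notation "rLen" => (31 : Fin 42)
notation "rG" => (32 : Fin 42)
notation "rAcc" => (33 : Fin 42)
notation "rPv" => (34 : Fin 42)
notation "rSz" => (35 : Fin 42)
notation "rSt" => (36 : Fin 42)
notation "rX" => (37 : Fin 42)
notation "rLx" => (38 : Fin 42)
notation "rSo" => (39 : Fin 42)
-- The output.
notation "rNum" => (40 : Fin 42)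
notation "rDen" => (41 : Fin 42)
-- Names of arrays: the keys, the levels and the samples of all copies; the generators of a term;
-- the sample of the current copy, and a buffer for it; the estimates. The last four are empty
-- between items.
notation "aH" => (0 : Fin 7)
notation "aLev" => (1 : Fin 7)
notation "aBig" => (2 : Fin 7)
notation "aG" => (3 : Fin 7)
notation "aX" => (4 : Fin 7)
notation "aY" => (5 : Fin 7)
notation "aE" => (6 : Fin 7)

/-- Programs of the algorithm. -/
abbrev P := Prog 42 7

/-- Memories of the algorithm. -/
abbrev M := Mem 42 7

instance : Coe (Fin 42) (Operand 42) := ⟨.reg⟩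

infixr:60 ";;" => Prog.seq

open Prog

/-- Copying an operand to a register. -/
def mov (r : Fin 42) (x : Operand 42) : P := op .or r x (.const 0)

/-- Emptying an array with at most `m + 1` cells. -/
def clearArr (a : Fin 7) (r : Fin 42) : P :=
  length r a ;; loop rG r (pop a)

/-- Tests whether the point stored in `rZ` lies in the current item. The flag `rIn` starts at `1`;
subtraction is truncated, so that it stays at `0` after the first violated inequality. -/
def membLoop : P :=
  loop rI rDim (
    op .mul rS rN rI ;; op .shr rX rZ rS ;; op .mod rX rX rPn ;;
    op .add rE rI rI ;; input rLo rE ;; op .add rE rE (.const 1) ;; input rHi rE ;;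
    op .lt rU rX rLo ;; op .sub rIn rIn rU ;; op .lt rU rHi rX ;; op .sub rIn rIn rU)

/-- Loads the stored points of the current copy, except those in the current item. A cell that
contains `0` is unused. -/
def loadLoop : P :=
  loop rJ rT (
    op .add rE rOff rJ ;; load rZ aBig rE ;;
    ite rZ (mov rIn (.const 1) ;; membLoop ;; ite rIn skip (push aX rZ)) skip)

/-- Moves the entries of `a` whose bit `rS` is `0` to `b`, and drops the others. -/
def moveLoop (a b : Fin 7) : P :=
  length rLx a ;; loop rJ rLx (
    length rE a ;; op .sub rE rE (.const 1) ;; load rZ a rE ;; pop a ;;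
    op .shr rU rZ rS ;; op .and rU rU (.const 1) ;; ite rU skip (push b rZ))

/-- Drops the stored points with bit `rS`. Moving them twice keeps their order. -/
def purge : P := moveLoop aX aY ;; moveLoop aY aX

/-- Pushes the unit vectors of the `rJj` bits that are free in the blocks of a piece. -/
def bitsLoop : P :=
  loop rB rJj (op .add rE rSo rB ;; op .shl rE (.const 1) rE ;; push aG rE)

/-- Replaces the ends `rLo` and `rHi` of an interval by the blocks of its piece with index `rKk`,
and computes in `rU` whether that piece is nonempty. -/
def selectPiece : P :=
  ite rKk (
    op .shr rLo rLo rJj ;; op .shr rHi rHi rJj ;;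
    op .shr rU rLo (.const 1) ;; op .shr rV rHi (.const 1) ;; op .lt rU rU rV ;;
    op .and rV rLo (.const 1) ;; op .and rW rHi (.const 1) ;;
    op .xor rLo rLo (.const 1) ;; op .xor rHi rHi (.const 1) ;;
    ite rV (mov rLo rHi ;; op .and rU rU rW) (ite rW skip (mov rHi rLo)))
    (op .lt rU rHi rLo ;; op .eq rU rU (.const 0))

/-- Adds the piece of dimension `rI` to the base point `rBase` and the generators `aG`. -/
def coordBody : P :=
  op .mod rKk rQ rN ;; op .div rQ rQ rN ;;
  op .add rE rI rI ;; input rLo rE ;; op .add rE rE (.const 1) ;; input rHi rE ;;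
  op .mul rSo rN rI ;; op .sub rJj rKk (.const 1) ;; op .add rS rSo rJj ;;
  selectPiece ;;
  op .and rOk rOk rU ;; op .xor rHi rHi rLo ;;
  op .shl rLo rLo rS ;; op .xor rBase rBase rLo ;;
  op .shl rHi rHi rS ;; push aG rHi ;;
  bitsLoop

/-- Computes base point and generators of the term with number `rQ`. -/
def coordLoop : P := loop rI rDim coordBody

/-- Computes in `rAcc` the augmented vector of `rZ`. -/
def augInner : P :=
  loop rB rM (
    op .shr rU rZ rB ;; op .and rU rU (.const 1) ;;
    ite rU (
      op .shr rE rH rB ;; op .mod rE rE rPw ;; op .shl rE rE rM ;;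
      op .shl rU (.const 1) rB ;; op .xor rE rE rU ;; op .xor rAcc rAcc rE) skip)

/-- Replaces all elements of `aG` by augmented ones. -/
def augLoop : P :=
  length rLen aG ;; loop rG rLen (
    load rZ aG rG ;; mov rAcc (.const 0) ;; augInner ;; store aG rG rAcc)

/-- Replaces the raw base point and generators by augmented ones. -/
def augAll : P :=
  push aG rBase ;; augLoop ;;
  op .sub rE rLen (.const 1) ;; load rBase aG rE ;; pop aG ;;
  op .add rE rM rM ;; op .shr rE rH rE ;; op .xor rE rE rPw ;; op .shl rE rE rM ;;
  op .xor rBase rBase rE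

/-- Finds a generator with bit `rS`; the result is `0` if there is none. -/
def findPivot : P :=
  mov rPv (.const 0) ;; length rLen aG ;; loop rG rLen (
    load rZ aG rG ;; op .shr rU rZ rS ;; op .and rU rU (.const 1) ;; ite rU (mov rPv rZ) skip)

/-- Adds the pivot to all generators, and to the base point, that have bit `rS`. The pivot itself
becomes `0`. -/
def applyPivot : P :=
  loop rG rLen (
    load rZ aG rG ;; op .shr rU rZ rS ;; op .and rU rU (.const 1) ;;
    ite rU (op .xor rZ rZ rPv ;; store aG rG rZ) skip) ;;
  op .shr rU rBase rS ;; op .and rU rU (.const 1) ;; ite rU (op .xor rBase rBase rPv) skip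

/-- One step of Gaussian elimination: imposes that bit `rS` is `0`. -/
def eliminate : P := findPivot ;; applyPivot

/-- Imposes all constraints of the current level. -/
def elimLoop : P := loop rI rLev (op .add rS rM rI ;; eliminate)

/-- Computes in `rSz` the number of points of the term that survive at the current level. -/
def computeSize : P :=
  op .shr rZ rBase rM ;; op .shl rE (.const 1) rLev ;; op .mod rZ rZ rE ;;
  op .eq rSz rZ (.const 0) ;; length rLen aG ;; loop rG rLen (
    load rZ aG rG ;; ite rZ (op .add rSz rSz rSz) skip)

/-- Raises the level while the sample would overflow. -/
def raiseLoop : P :=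
  loop rI rMs (
    computeSize ;; length rE aX ;; op .add rE rE rSz ;; op .lt rU rT rE ;;
    ite rU (op .add rS rM rLev ;; purge ;; eliminate ;; op .add rLev rLev (.const 1)) skip)

/-- Appends the translates by `rZ` of the points that are stored from position `rSt` on. -/
def spanInner : P :=
  length rW aX ;; op .sub rW rW rSt ;; loop rB rW (
    op .add rE rSt rB ;; load rE aX rE ;; op .xor rE rE rZ ;; push aX rE)

/-- Appends the surviving points of the term to the sample. -/
def enumerate : P :=
  op .shr rZ rBase rM ;; op .shl rE (.const 1) rLev ;; op .mod rZ rZ rE ;;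
  length rSt aX ;; ite rZ skip (push aX rBase) ;; length rLen aG ;;
  loop rG rLen (load rZ aG rG ;; ite rZ spanInner skip)

/-- Inserts the points of the affine subspace given by `rBase` and `aG` into the sample. -/
def insertTerm : P := augAll ;; elimLoop ;; raiseLoop ;; enumerate

/-- Decodes the term with number `rTerm`, and inserts it if none of its pieces is empty. -/
def termBody : P :=
  mov rQ rTerm ;; mov rOk (.const 1) ;; mov rBase (.const 0) ;; coordLoop ;;
  ite rOk insertTerm skip ;; clearArr aG rLen

/-- Inserts all terms of the current item. -/
def termLoop : P := loop rTerm rTm termBody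

/-- Writes the sample back to the block of the current copy; reading beyond its end gives `0`, which
marks the remaining cells as unused. -/
def storeLoop : P :=
  loop rJ rT (op .add rE rOff rJ ;; load rZ aX rJ ;; store aBig rE rZ)

/-- Processes an item in copy `rC`. -/
def copyBody : P :=
  load rH aH rC ;; load rLev aLev rC ;; op .mul rOff rC rT ;; loadLoop ;; termLoop ;;
  store aLev rC rLev ;; storeLoop ;; clearArr aX rLx

/-- The program that is run on each item. -/
def updateProg : P := loop rC rK copyBody

/-- Appends `rLen` random bits to the binary expansion of `rH`. -/
def coinLoop : P :=
  loop rI rLen (coin rU ;; op .add rH rH rH ;; op .add rH rH rU)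

/-- Computes the constants, among them the number `rK` of copies and the capacity `rT` of each. -/
def sizes : P :=
  mov rN (.param .bits) ;; mov rDim (.param .dim) ;; op .mul rM rN rDim ;;
  op .shl rPw (.const 1) rM ;; op .shl rPn (.const 1) rN ;; op .add rMs rM (.const 1) ;;
  op .mul rT (.param .invEps) (.param .invEps) ;; op .mul rU rT (.param .logInvDelta) ;;
  op .lt rU rU rPw ;;
  ite rU (mov rK (.param .logInvDelta) ;; op .mul rT rT (.const 512))
    (mov rK (.const 1) ;; mov rT rPw)

/-- Computes `n ^ d`, the number of terms. -/
def powerLoop : P := mov rTm (.const 1) ;; loop rI rDim (op .mul rTm rTm rN)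

/-- Reserves `rT` cells for a sample. -/
def zeroLoop : P := loop rJ rT (push aBig (.const 0))

/-- Draws a key for a new copy, and sets up its empty sample at level `0`. -/
def newCopy : P := mov rH (.const 0) ;; coinLoop ;; push aH rH ;; push aLev (.const 0) ;; zeroLoop

/-- The program that is run before the stream starts. -/
def initProg : P :=
  sizes ;; powerLoop ;; op .mul rLen rM (.const 3) ;; loop rC rK newCopy ;; mov rLen (.const 0)

/-- The estimate of copy `rC`: the number of sampled points times `2 ^ level`. -/
def estimate : P :=
  op .mul rOff rC rT ;; mov rSz (.const 0) ;; loop rJ rT (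
    op .add rE rOff rJ ;; load rZ aBig rE ;; ite rZ (op .add rSz rSz (.const 1)) skip) ;;
  load rLev aLev rC ;; op .shl rSz rSz rLev ;; push aE rSz

/-- Counts in `rSz` the estimates that are at most `rZ`. -/
def countLoop : P :=
  mov rSz (.const 0) ;; loop rJ rK (
    load rE aE rJ ;; op .lt rU rZ rE ;; ite rU skip (op .add rSz rSz (.const 1)))

/-- Returns the least estimate below or at which at least half of the estimates lie. -/
def queryProg : P :=
  loop rC rK estimate ;; mov rNum (.const 0) ;; mov rDen (.const 0) ;; loop rC rK (
    load rZ aE rC ;; countLoop ;; op .add rSz rSz rSz ;; op .lt rU rSz rK ;;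
    ite rU skip (op .lt rU rZ rNum ;; op .eq rV rDen (.const 0) ;; op .or rU rU rV ;;
      ite rU (mov rNum rZ ;; mov rDen (.const 1)) skip))

/-- The streaming algorithm. -/
def rangeAlg : StreamAlg := ⟨42, 7, initProg, updateProg, queryProg, rNum, rDen⟩

theorem updateProg_plain : updateProg.plain = true := by decide

end RangeSketch

namespace Prog

variable {R A : ℕ} {e : Env} {lim : Lim R} {Q : Mem R A → Prop} {s : Mem R A}

@[simp] theorem wp_skip : (skip : Prog R A).wp e lim Q s ↔ Q s := Iff.rfl

@[simp] theorem wp_op {f : BinOp} {r : Fin R} {x y : Operand R} :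
    (op f r x y : Prog R A).wp e lim Q s ↔
      (f.grows = true → lim.val (f.eval (x.get e s) (y.get e s))) ∧
        Q (s.setReg r (f.eval (x.get e s) (y.get e s))) := Iff.rfl

@[simp] theorem wp_load {r : Fin R} {a : Fin A} {x : Operand R} :
    (load r a x).wp e lim Q s ↔ Q (s.setReg r ((s.arr a).getD (x.get e s) 0)) := Iff.rfl

@[simp] theorem wp_store {a : Fin A} {x y : Operand R} :
    (store a x y).wp e lim Q s ↔ Q (s.setArr a ((s.arr a).set (x.get e s) (y.get e s))) := Iff.rfl

@[simp] theorem wp_push {a : Fin A} {x : Operand R} :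
    (push a x).wp e lim Q s ↔
      lim.val ((s.arr a).length + 1) ∧ Q (s.setArr a (s.arr a ++ [x.get e s])) := Iff.rfl

@[simp] theorem wp_pop {a : Fin A} :
    (pop a : Prog R A).wp e lim Q s ↔ Q (s.setArr a (s.arr a).dropLast) := Iff.rfl

@[simp] theorem wp_length {r : Fin R} {a : Fin A} :
    (length r a).wp e lim Q s ↔ Q (s.setReg r (s.arr a).length) := Iff.rfl

@[simp] theorem wp_input {r : Fin R} {x : Operand R} :
    (input r x : Prog R A).wp e lim Q s ↔ Q (s.setReg r (e.item (x.get e s))) := Iff.rfl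

@[simp] theorem wp_seq {p q : Prog R A} :
    (seq p q).wp e lim Q s ↔ p.wp e lim (q.wp e lim Q) s := Iff.rfl

@[simp] theorem wp_ite {x : Operand R} {p q : Prog R A} :
    (ite x p q).wp e lim Q s ↔
      (x.get e s ≠ 0 → p.wp e lim Q s) ∧ (x.get e s = 0 → q.wp e lim Q s) := Iff.rfl

end Prog

@[simp] theorem Operand.get_const {R A : ℕ} {e : Env} {s : Mem R A} {k : ℕ} :
    (Operand.const k).get e s = k := rfl

@[simp] theorem Operand.get_reg {R A : ℕ} {e : Env} {s : Mem R A} {r : Fin R} :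
    (Operand.reg r).get e s = s.reg r := rfl

@[simp] theorem Operand.get_param {R A : ℕ} {e : Env} {s : Mem R A} {p : Param} :
    (Operand.param p).get e s = e.param p := rfl

set_option linter.unusedSimpArgs false

namespace RangeSketch

open Prog

attribute [simp] BinOp.eval BinOp.grows mov

/-- Bounds for the numbers of rounds of the loops of the update program. -/
def bnd (n d T K : ℕ) : Operand 42 → ℕ
  | .reg r =>
    if r = rK then K else if r = rT ∨ r = rLx ∨ r = rW then T else if r = rTm then n ^ d
    else if r = rDim then d else if r = rM then n * d else if r = rJj then n else n * d + 1
  | _ => 0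

/-- The side conditions under which the update program runs. -/
def lim (n d T K : ℕ) : Lim 42 := Lim.bdd (3 * (n * d) + 12) (bnd n d T K)

@[simp] theorem lim_val {n d T K v : ℕ} : (lim n d T K).val v ↔ v < 2 ^ (3 * (n * d) + 12) :=
  Iff.rfl

@[simp] theorem lim_rounds {n d T K v : ℕ} {x : Operand 42} :
    (lim n d T K).rounds x v ↔ v ≤ bnd n d T K x := Iff.rfl

/-- The registers that the update program only reads have their intended values. -/
structure Consts (n d T K : ℕ) (s : M) : Prop where
  hN : s.reg rN = n
  hD : s.reg rDim = d
  hM : s.reg rM = n * d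
  hPw : s.reg rPw = 2 ^ (n * d)
  hPn : s.reg rPn = 2 ^ n
  hK : s.reg rK = K
  hT : s.reg rT = T
  hTm : s.reg rTm = n ^ d
  hMs : s.reg rMs = n * d + 1

theorem Consts.of_frame {n d T K : ℕ} {s s' : M} {p : P} (h : Consts n d T K s)
    (hF : p.Frame s s') (hp : ∀ q : Fin 42, q ≤ 8 → p.modR q = false) : Consts n d T K s' where
  hN := (hF.1 _ (hp _ (by decide))).trans h.hN
  hD := (hF.1 _ (hp _ (by decide))).trans h.hD
  hM := (hF.1 _ (hp _ (by decide))).trans h.hM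
  hPw := (hF.1 _ (hp _ (by decide))).trans h.hPw
  hPn := (hF.1 _ (hp _ (by decide))).trans h.hPn
  hK := (hF.1 _ (hp _ (by decide))).trans h.hK
  hT := (hF.1 _ (hp _ (by decide))).trans h.hT
  hTm := (hF.1 _ (hp _ (by decide))).trans h.hTm
  hMs := (hF.1 _ (hp _ (by decide))).trans h.hMs

variable {n d T K : ℕ} {e : Env} {Q : M → Prop} {s : M}

theorem pow_le_lim {n d a k : ℕ} (h : a < 2 ^ k) (hk : k ≤ 3 * (n * d) + 12) :
    a < 2 ^ (3 * (n * d) + 12) :=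
  h.trans_le (Nat.pow_le_pow_right (by norm_num) hk)

theorem shiftRight_and_one (v b : ℕ) : (v >>> b) &&& 1 = (v.testBit b).toNat := by
  rw [Nat.and_one_is_mod, Nat.toNat_testBit, Nat.shiftRight_eq_div_pow]

/-! ### Emptying, filtering and testing -/

theorem clearArr_spec {lim : Lim 42} {a : Fin 7} {r : Fin 42}
    (hl : lim.rounds r (s.arr a).length)
    (hQ : ∀ s', s'.arr a = [] → (clearArr a r).Frame s s' → Q s') :
    (clearArr a r).wp e lim Q s := by
  refine wp_frame ?_
  simp only [clearArr, wp_seq, wp_length]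
  refine wp_loop (fun i s' => s'.arr a = (s.arr a).take ((s.arr a).length - i)) ?_ ?_ ?_ ?_
  · simpa using hl
  · simp
  · intro i s' hi h _
    simp only [wp_pop, Mem.setReg_arr, Mem.setArr_arr, if_true, h] at hi ⊢
    rw [List.dropLast_eq_take, List.take_take, List.length_take]
    congr 1
    omega
  · intro s' h _ hF
    refine hQ s' ?_ hF
    simpa using h

theorem lt_lim {a : ℕ} (h : a ≤ 3 * (n * d) + 12) : a < 2 ^ (3 * (n * d) + 12) :=
  Nat.lt_two_pow_self.trans_le (Nat.pow_le_pow_right (by norm_num) h)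

theorem InBox_succ {n i : ℕ} {it : ℕ → ℕ} {v : ℕ} :
    InBox n (i + 1) it v ↔ InBox n i it v ∧ it (2 * i) ≤ (v >>> (n * i)) % 2 ^ n ∧
      (v >>> (n * i)) % 2 ^ n ≤ it (2 * i + 1) := by
  simp only [InBox, Nat.lt_succ_iff_lt_or_eq, or_imp, forall_and, forall_eq]
  tauto

theorem membLoop_spec (hn : 1 ≤ n) (hC : Consts n d T K s) (hIn : s.reg rIn = 1)
    (hQ : ∀ s', s'.reg rIn = (if InBox n d e.item (s.reg rZ) then 1 else 0) →
      membLoop.Frame s s' → Q s') :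
    membLoop.wp e (lim n d T K) Q s := by
  refine wp_loop (fun i s' => s'.reg rIn = if InBox n i e.item (s.reg rZ) then 1 else 0)
    ?_ ?_ ?_ ?_
  · simp [hC.hD, bnd]
  · simp [hIn, InBox]
  · intro i s' hi h hF
    have hC' := hC.of_frame hF (by decide)
    have hZ : s'.reg rZ = s.reg rZ := hF.1 _ rfl
    simp only [Operand.get_reg, hC.hD] at hi
    have h1 : n * i ≤ n * d := Nat.mul_le_mul_left _ hi.le
    have h2 : d ≤ n * d := Nat.le_mul_of_pos_left _ hn
    simp [hC'.hN, hC'.hPn, hZ, h, InBox_succ, ← two_mul]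
    refine ⟨lt_lim (by omega), lt_lim (by omega), lt_lim (by omega), ?_⟩
    by_cases hI : InBox n i e.item (s.reg rZ) <;> simp only [hI, if_true, if_false, true_and,
      false_and] <;> split_ifs <;> omega
  · intro s' h hF
    rw [Operand.get_reg, hC.hD] at h
    exact hQ s' h hF

/-- The nonzero entries of the block of length `T` that starts at position `off` of `l`. -/
def blockOf (T : ℕ) (l : List ℕ) (off : ℕ) : List ℕ :=
  ((List.range T).map fun j => l.getD (off + j) 0).filter (· ≠ 0)

theorem blockOf_succ (T : ℕ) (l : List ℕ) (off : ℕ) :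
    blockOf (T + 1) l off = blockOf T l off ++
      if l.getD (off + T) 0 = 0 then [] else [l.getD (off + T) 0] := by
  rw [blockOf, List.range_succ, List.map_append, List.filter_append]
  congr 1
  simp only [List.map_cons, List.map_nil, List.filter_singleton]
  split_ifs <;> simp_all

theorem blockOf_length_le (T : ℕ) (l : List ℕ) (off : ℕ) : (blockOf T l off).length ≤ T :=
  (List.length_filter_le _ _).trans (by simp)

theorem loadLoop_spec (hn : 1 ≤ n) (hC : Consts n d T K s) (hX : s.arr aX = [])
    (hoff : s.reg rOff + T < 2 ^ (3 * (n * d) + 12))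
    (hQ : ∀ s', s'.arr aX = (blockOf T (s.arr aBig) (s.reg rOff)).filter
      (fun z => ¬ InBox n d e.item z) → loadLoop.Frame s s' → Q s') :
    loadLoop.wp e (lim n d T K) Q s := by
  refine wp_loop (fun j s' => s'.arr aX = (blockOf j (s.arr aBig) (s.reg rOff)).filter
      (fun z => ¬ InBox n d e.item z)) ?_ ?_ ?_ ?_
  · simp [hC.hT, bnd]
  · simp [hX, blockOf]
  · intro j s' hj h hF
    have hC' := hC.of_frame hF (by decide)
    have hO : s'.reg rOff = s.reg rOff := hF.1 _ rfl
    have hB : s'.arr aBig = s.arr aBig := hF.2 _ rfl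
    simp only [Operand.get_reg, hC.hT] at hj
    have hlen : (s'.arr aX).length ≤ j := by
      rw [h]; exact (List.length_filter_le _ _).trans (blockOf_length_le _ _ _)
    simp only [wp_seq, wp_op, wp_load, wp_ite, mov, Operand.get_reg, Operand.get_const, wp_skip,
      Mem.setReg_reg, Mem.setReg_arr, Fin.reduceEq, if_true, if_false, hO, hB, BinOp.eval,
      BinOp.grows]
    refine ⟨fun _ => lim_val.2 (by omega), fun hz => ⟨by simp, ?_⟩, fun hz => ?_⟩
    · refine membLoop_spec (n := n) (d := d) hn ?_ ?_ ?_
      · constructor <;> simp [hC'.hN, hC'.hD, hC'.hM, hC'.hPw, hC'.hPn, hC'.hK, hC'.hT, hC'.hTm,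
          hC'.hMs]
      · simp
      · intro s'' h' hF'
        have hX' : s''.arr aX = s'.arr aX := hF'.2 _ rfl
        have hZ' : s''.reg rZ = (s.arr aBig).getD (s.reg rOff + j) 0 := by
          rw [hF'.1 _ rfl]; simp
        simp only [Mem.setReg_reg, Fin.reduceEq, if_true, if_false] at h'
        simp only [wp_ite, wp_skip, wp_push, Operand.get_reg, h', hX', hZ', Mem.setArr_arr, if_true,
          blockOf_succ, List.filter_append, if_neg hz, ← h, List.filter_cons, List.filter_nil]
        generalize (s.arr aBig).getD (s.reg rOff + j) 0 = z at *
        by_cases hin : InBox n d e.item z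
        · simp [hin]
        · simp only [hin]
          simp
          omega
    · simp only [wp_seq, wp_op, wp_load, wp_store, wp_push, wp_pop, wp_length, wp_input, wp_ite,
        wp_skip, mov, Operand.get_reg, Operand.get_const, Mem.setReg_reg, Mem.setReg_arr,
        Mem.setArr_reg, Mem.setArr_arr, Fin.reduceEq, if_true, if_false, BinOp.eval, BinOp.grows,
        Bool.false_eq_true, false_imp_iff, true_and, true_imp_iff, h, blockOf_succ, if_pos hz,
        List.append_nil]
  · intro s' h hF
    rw [Operand.get_reg, hC.hT] at h
    exact hQ s' h hF

/-- The array `a` is consumed from its end, hence the reversal. -/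
theorem moveLoop_spec {a b : Fin 7} (hab : a ≠ b) (hla : (s.arr a).length ≤ T)
    (hlb : (s.arr b).length + (s.arr a).length < 2 ^ (3 * (n * d) + 12))
    (hQ : ∀ s', s'.arr a = [] → s'.arr b = s.arr b ++
      (s.arr a).reverse.filter (fun z => !z.testBit (s.reg rS)) →
        (moveLoop a b).Frame s s' → Q s') :
    (moveLoop a b).wp e (lim n d T K) Q s := by
  refine wp_frame ?_
  simp only [moveLoop, wp_seq, wp_length]
  refine wp_loop (fun i s' => ∃ x y, s.arr a = x ++ y ∧ y.length = i ∧ s'.arr a = x ∧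
    s'.arr b = s.arr b ++ y.reverse.filter (fun z => !z.testBit (s.reg rS))) ?_ ?_ ?_ ?_
  · simpa [bnd] using hla
  · exact ⟨s.arr a, [], by simp⟩
  · rintro i s' hi ⟨x, y, hxy, hy, hx, hb⟩ hF
    have hS : s'.reg rS = s.reg rS := (hF.1 _ rfl).trans (by simp)
    obtain rfl | ⟨x, z, rfl⟩ := List.eq_nil_or_concat x
    · simp [hxy, hy] at hi
    · have hl : (s.arr b ++ List.filter (fun z => !z.testBit (s.reg rS)) y.reverse).length + 1
          < 2 ^ (3 * (n * d) + 12) := by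
        have := List.length_filter_le (fun z => !z.testBit (s.reg rS)) y.reverse
        simp [hxy] at hlb this ⊢
        omega
      simp only [List.length_append] at hl
      simp only [wp_seq, wp_op, wp_load, wp_store, wp_push, wp_pop, wp_length, wp_input, wp_ite,
        wp_skip, mov, Operand.get_reg, Operand.get_const, Mem.setReg_reg, Mem.setReg_arr,
        Mem.setArr_reg, Mem.setArr_arr, Fin.reduceEq, if_true, if_false, BinOp.eval, BinOp.grows,
        Bool.false_eq_true, false_imp_iff, true_and, true_imp_iff, hx, hS, hb, shiftRight_and_one,
        hab, hab.symm, lim_val]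
      simp only [List.concat_eq_append, List.length_append, List.length_singleton,
        Nat.add_sub_cancel, List.dropLast_concat]
      have hz : (x ++ [z]).getD x.length 0 = z := by simp
      rw [hz]
      refine ⟨fun hz' => ⟨x, z :: y, ?_⟩, fun hz' => ⟨by omega, x, z :: y, ?_⟩⟩
      · simp at hz'
        simp [hxy, hy, hz']
      · simp at hz'
        simp [hxy, hy, hz']
  · rintro s' ⟨x, y, hxy, hy, hx, hb⟩ - hF
    have : x = [] := by
      simpa [hxy] using hy
    subst this
    exact hQ s' hx (by rw [hb, hxy]; rfl) hF

theorem purge_spec (hY : s.arr aY = []) (hla : (s.arr aX).length ≤ T)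
    (hT : T < 2 ^ (3 * (n * d) + 12))
    (hQ : ∀ s', s'.arr aX = (s.arr aX).filter (fun z => !z.testBit (s.reg rS)) → s'.arr aY = [] →
      purge.Frame s s' → Q s') :
    purge.wp e (lim n d T K) Q s := by
  refine wp_frame ?_
  simp only [purge, wp_seq]
  refine moveLoop_spec (by decide) hla (by simp [hY]; omega) fun s₁ hX₁ hY₁ hF₁ => ?_
  have hS : s₁.reg rS = s.reg rS := hF₁.1 _ rfl
  have hl := List.length_filter_le (fun z => !z.testBit (s.reg rS)) (s.arr aX).reverse
  rw [List.length_reverse] at hl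
  refine moveLoop_spec (by decide) ?_ ?_ fun s₂ hY₂ hX₂ hF₂ hF => ?_
  · simp only [hY₁, hY, List.nil_append]; omega
  · simp only [hY₁, hY, hX₁, List.nil_append, List.length_nil]; omega
  · refine hQ s₂ ?_ hY₂ hF
    rw [hX₂, hX₁, hY₁, hY, hS, List.nil_append, List.nil_append, ← List.filter_reverse,
      List.reverse_reverse, List.filter_filter]
    simp

end RangeSketch

namespace RangeSketch

open Prog

variable {n d T K : ℕ} {e : Env} {Q : M → Prop} {s : M}

/-! ### Decoding a term -/

theorem selectPiece_spec {lim : Lim 42} {a b k : ℕ} (ha : s.reg rLo = a) (hb : s.reg rHi = b)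
    (hk : s.reg rKk = k) (hj : s.reg rJj = k - 1)
    (hQ : ∀ s', s'.reg rLo = pieceP a b k → s'.reg rHi = pieceQ a b k →
      s'.reg rU = (if pieceOk a b k then 1 else 0) → selectPiece.Frame s s' → Q s') :
    selectPiece.wp e lim Q s := by
  refine wp_frame ?_
  simp only [wp_seq, wp_op, wp_load, wp_store, wp_push, wp_pop, wp_length, wp_input, wp_ite,
    wp_skip, mov, Operand.get_reg, Operand.get_const, Mem.setReg_reg, Mem.setReg_arr,
    Mem.setArr_reg, Mem.setArr_arr, Fin.reduceEq, if_true, if_false, BinOp.eval, BinOp.grows,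
    Bool.false_eq_true, false_imp_iff, true_and, true_imp_iff, selectPiece, ha, hb, hk, hj,
    shiftRight_and_one]
  have h1 : ∀ c : Bool, c.toNat ≠ 0 ↔ c = true := by decide
  have h0 : ∀ c : Bool, c.toNat = 0 ↔ c = false := by decide
  refine ⟨fun hk0 => ⟨fun hV => ?_, fun hV => ⟨fun hW => ?_, fun hW => ?_⟩⟩, fun hk0 hF => ?_⟩
  · rw [h1] at hV
    intro hF
    refine hQ _ ?_ ?_ ?_ hF
    · simp [pieceP, hk0, hV]
    · simp [pieceQ, hk0, hV]
    · simp [pieceOk, hk0, hV]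
      cases b.testBit (k - 1)
      · simp
      · simp only [Bool.toNat_true, and_true]
        split_ifs <;> rfl
  · rw [h0] at hV
    rw [h1] at hW
    intro hF
    refine hQ _ ?_ ?_ ?_ hF
    · simp [pieceP, hk0, hV]
    · simp [pieceQ, hk0, hV, hW]
    · simp [pieceOk, hk0, hV]
  · rw [h0] at hV hW
    intro hF
    refine hQ _ ?_ ?_ ?_ hF
    · simp [pieceP, hk0, hV]
    · simp [pieceQ, hk0, hV, hW]
    · simp [pieceOk, hk0, hV]
  · refine hQ _ ?_ ?_ ?_ hF
    · simp [pieceP, hk0, ha]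
    · simp [pieceQ, hk0, hb]
    · simp [pieceOk, hk0]

theorem bitsLoop_spec {j o : ℕ} (hj : s.reg rJj = j) (ho : s.reg rSo = o) (hjn : j ≤ n)
    (hoj : o + j ≤ n * d) (hG : (s.arr aG).length + j ≤ n * d + 1)
    (hQ : ∀ s', s'.arr aG = s.arr aG ++ (List.range j).map (fun b => 1 <<< (o + b)) →
      bitsLoop.Frame s s' → Q s') :
    bitsLoop.wp e (lim n d T K) Q s := by
  refine wp_loop (fun i s' => s'.arr aG = s.arr aG ++ (List.range i).map fun b => 1 <<< (o + b))
    ?_ ?_ ?_ ?_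
  · simp [hj, bnd, hjn]
  · simp
  · intro i s' hi h hF
    have hO : s'.reg rSo = o := (hF.1 _ rfl).trans ho
    rw [Operand.get_reg, hj] at hi
    simp only [wp_seq, wp_op, wp_load, wp_store, wp_push, wp_pop, wp_length, wp_input, wp_ite,
      wp_skip, mov, Operand.get_reg, Operand.get_const, Mem.setReg_reg, Mem.setReg_arr,
      Mem.setArr_reg, Mem.setArr_arr, Fin.reduceEq, if_true, if_false, BinOp.eval, BinOp.grows,
      Bool.false_eq_true, false_imp_iff, true_and, true_imp_iff, hO, h, lim_val]
    refine ⟨lt_lim (by omega), ?_, ?_, ?_⟩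
    · rw [Nat.one_shiftLeft]
      exact Nat.pow_lt_pow_right (by norm_num) (by omega)
    · refine lt_lim ?_
      simp
      omega
    · simp [List.range_succ]
  · intro s' h hF
    rw [Operand.get_reg, hj] at h
    exact hQ s' h hF

theorem xor_one_lt {a : ℕ} (hn : 1 ≤ n) (ha : a < 2 ^ n) : a ^^^ 1 < 2 ^ n :=
  Nat.xor_lt_two_pow ha (Nat.one_lt_two_pow (by omega))

theorem shiftRight_lt {a j : ℕ} (ha : a < 2 ^ n) : a >>> j < 2 ^ n :=
  (Nat.shiftRight_le _ _).trans_lt ha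

theorem pieceP_lt {a b k : ℕ} (hn : 1 ≤ n) (ha : a < 2 ^ n) (hb : b < 2 ^ n) :
    pieceP a b k < 2 ^ n := by
  unfold pieceP
  split_ifs
  · exact ha
  · exact xor_one_lt hn (shiftRight_lt hb)
  · exact xor_one_lt hn (shiftRight_lt ha)

theorem pieceQ_lt {a b k : ℕ} (hn : 1 ≤ n) (ha : a < 2 ^ n) (hb : b < 2 ^ n) :
    pieceQ a b k < 2 ^ n := by
  unfold pieceQ
  split_ifs
  · exact hb
  · exact xor_one_lt hn (shiftRight_lt hb)
  · exact xor_one_lt hn (shiftRight_lt ha)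

theorem shiftLeft_lt {a k j r : ℕ} (ha : a < 2 ^ k) (h : k + j ≤ r) : a <<< j < 2 ^ r := by
  rw [Nat.shiftLeft_eq]
  calc a * 2 ^ j < 2 ^ k * 2 ^ j := Nat.mul_lt_mul_of_pos_right ha (by positivity)
    _ = 2 ^ (k + j) := (pow_add _ _ _).symm
    _ ≤ 2 ^ r := Nat.pow_le_pow_right (by norm_num) h

theorem coordBody_spec {i q k : ℕ} (hn : 1 ≤ n) (he : ∀ j, e.item j < 2 ^ n)
    (hN : s.reg rN = n) (hi : s.reg rI = i) (hid : i < d)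
    (hq : s.reg rQ = q) (hk : q % n = k) (hG : (s.arr aG).length ≤ n * i)
    (hQ : ∀ s', s'.reg rQ = q / n →
      s'.reg rOk = s.reg rOk &&&
          (if pieceOk (e.item (2 * i)) (e.item (2 * i + 1)) k then 1 else 0) →
      s'.reg rBase = s.reg rBase ^^^
        pieceP (e.item (2 * i)) (e.item (2 * i + 1)) k <<< (n * i + (k - 1)) →
      s'.arr aG = s.arr aG ++ ((pieceQ (e.item (2 * i)) (e.item (2 * i + 1)) k ^^^
        pieceP (e.item (2 * i)) (e.item (2 * i + 1)) k) <<< (n * i + (k - 1)) ::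
        (List.range (k - 1)).map fun b => 1 <<< (n * i + b)) →
      coordBody.Frame s s' → Q s') :
    coordBody.wp e (lim n d T K) Q s := by
  refine wp_frame ?_
  have hkn : k < n := hk ▸ Nat.mod_lt _ hn
  have h1 : n * i + n ≤ n * d := by
    rw [← Nat.mul_succ]; exact Nat.mul_le_mul_left _ hid
  have h2 : d ≤ n * d := Nat.le_mul_of_pos_left _ hn
  have hP := pieceP_lt (k := k) hn (he (2 * i)) (he (2 * i + 1))
  have hQ' := pieceQ_lt (k := k) hn (he (2 * i)) (he (2 * i + 1))
  simp only [wp_seq, wp_op, wp_load, wp_store, wp_push, wp_pop, wp_length, wp_input, wp_ite,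
    wp_skip, mov, Operand.get_reg, Operand.get_const, Mem.setReg_reg, Mem.setReg_arr,
    Mem.setArr_reg, Mem.setArr_arr, Fin.reduceEq, if_true, if_false, BinOp.eval, BinOp.grows,
    Bool.false_eq_true, false_imp_iff, true_and, true_imp_iff, coordBody, hN, hi, hq, hk, ← two_mul,
    lim_val]
  refine ⟨lt_lim (by omega), lt_lim (by omega), lt_lim (by omega), lt_lim (by omega), ?_⟩
  refine selectPiece_spec (a := e.item (2 * i)) (b := e.item (2 * i + 1)) (k := k)
    (by simp) (by simp) (by simp) (by simp) fun s' hLo hHi hU hF => ?_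
  have hS : s'.reg rS = n * i + (k - 1) := (hF.1 _ rfl).trans (by simp)
  have hB : s'.reg rBase = s.reg rBase := (hF.1 _ rfl).trans (by simp)
  have hO : s'.reg rOk = s.reg rOk := (hF.1 _ rfl).trans (by simp)
  have hG' : s'.arr aG = s.arr aG := (hF.2 _ rfl).trans (by simp)
  have hQ3 : s'.reg rQ = q / n := (hF.1 _ rfl).trans (by simp)
  have hJ : s'.reg rJj = k - 1 := (hF.1 _ rfl).trans (by simp)
  have hSo : s'.reg rSo = n * i := (hF.1 _ rfl).trans (by simp)
  simp only [wp_seq, wp_op, wp_load, wp_store, wp_push, wp_pop, wp_length, wp_input, wp_ite,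
    wp_skip, mov, Operand.get_reg, Operand.get_const, Mem.setReg_reg, Mem.setReg_arr,
    Mem.setArr_reg, Mem.setArr_arr, Fin.reduceEq, if_true, if_false, BinOp.eval, BinOp.grows,
    Bool.false_eq_true, false_imp_iff, true_and, true_imp_iff, hS, hB, hO, hG', hHi, hLo, hU,
    lim_val]
  refine ⟨shiftLeft_lt hP (by omega), shiftLeft_lt (Nat.xor_lt_two_pow hQ' hP) (by omega),
    lt_lim (by omega), ?_⟩
  refine bitsLoop_spec (j := k - 1) (o := n * i) (by simp [hJ]) (by simp [hSo]) (by omega)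
    (by omega) (by simp; omega) fun s'' hG'' hF' hF2 => ?_
  refine hQ s'' ?_ ?_ ?_ ?_ hF2
  · rw [hF'.1 _ rfl]; simp [hQ3]
  · rw [hF'.1 _ rfl]; simp
  · rw [hF'.1 _ rfl]; simp
  · rw [hG'']; simp

theorem TermOk_succ {n : ℕ} {it : ℕ → ℕ} {t i : ℕ} : TermOk n it t (i + 1) ↔
    TermOk n it t i ∧ pieceOk (it (2 * i)) (it (2 * i + 1)) (digit n t i) := by
  simp only [TermOk, Nat.lt_succ_iff_lt_or_eq, or_imp, forall_and, forall_eq]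

theorem termGens_length_le {n : ℕ} (hn : 1 ≤ n) (it : ℕ → ℕ) (t i : ℕ) :
    (termGens n it t i).length ≤ n * i := by
  induction i with
  | zero => simp [termGens]
  | succ i ih =>
    have : digit n t i < n := Nat.mod_lt _ hn
    simp [termGens, Nat.mul_succ]
    omega

theorem coordLoop_spec {t : ℕ} (hn : 1 ≤ n) (he : ∀ j, e.item j < 2 ^ n) (hC : Consts n d T K s)
    (hq : s.reg rQ = t) (hOk : s.reg rOk = 1) (hB : s.reg rBase = 0) (hG : s.arr aG = [])
    (hQ : ∀ s', s'.reg rOk = (if TermOk n e.item t d then 1 else 0) →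
      s'.reg rBase = termBase n e.item t d → s'.arr aG = termGens n e.item t d →
      coordLoop.Frame s s' → Q s') :
    coordLoop.wp e (lim n d T K) Q s := by
  refine wp_loop (fun i s' => s'.reg rOk = (if TermOk n e.item t i then 1 else 0) ∧
      s'.reg rBase = termBase n e.item t i ∧ s'.arr aG = termGens n e.item t i ∧
      s'.reg rQ = t / n ^ i) ?_ ?_ ?_ ?_
  · simp [hC.hD, bnd]
  · simp [hOk, hB, hG, hq, TermOk, termBase, termGens]
  · rintro i s' hi ⟨h1, h2, h3, h4⟩ hF
    have hC' := hC.of_frame hF (by decide)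
    rw [Operand.get_reg, hC.hD] at hi
    refine coordBody_spec (i := i) (q := t / n ^ i) (k := digit n t i) hn he
      (by simp [hC'.hN]) (by simp) hi (by simp [h4]) rfl
      (by simpa [h3] using termGens_length_le hn _ _ _) fun s'' g1 g2 g3 g4 _ => ⟨?_, ?_, ?_, ?_⟩
    · rw [g2]
      simp only [Mem.setReg_reg, Fin.reduceEq, if_false, h1, TermOk_succ]
      split_ifs <;> simp_all
    · rw [g3]; simp [h2, termBase]
    · rw [g4]; simp [h3, termGens]
    · rw [g1, Nat.div_div_eq_div_mul, pow_succ]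
  · rintro s' ⟨h1, h2, h3, -⟩ hF
    rw [Operand.get_reg, hC.hD] at h1 h2 h3
    exact hQ s' h1 h2 h3 hF

end RangeSketch

namespace RangeSketch

/-! ### Affine subspaces over the field with two elements, and Gaussian elimination -/

/-- The points of the affine subspace of bit vectors with base point `b` and generators `G`, listed
with multiplicity if the generators are dependent. -/
def affinePts (b : ℕ) : List ℕ → Multiset ℕ
  | [] => {b}
  | g :: G => affinePts b G + affinePts (b ^^^ g) G

theorem affinePts_xor (b c : ℕ) (G : List ℕ) :
    affinePts (b ^^^ c) G = (affinePts b G).map (· ^^^ c) := by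
  induction G generalizing b with
  | nil => simp [affinePts]
  | cons g G ih =>
    simp only [affinePts, Multiset.map_add]
    rw [ih, ← ih (b ^^^ g), Nat.xor_right_comm]

theorem affinePts_cons (b g : ℕ) (G : List ℕ) :
    affinePts b (g :: G) = affinePts b G + (affinePts b G).map (· ^^^ g) := by
  rw [affinePts, affinePts_xor]

theorem affinePts_perm {b : ℕ} {G G' : List ℕ} (h : G.Perm G') :
    affinePts b G = affinePts b G' := by
  induction h generalizing b with
  | nil => rfl
  | cons g _ ih => simp only [affinePts, ih]
  | swap g g' G =>
    simp only [affinePts]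
    rw [add_add_add_comm, Nat.xor_right_comm]
  | trans _ _ ih ih' => exact ih.trans ih'

theorem affinePts_concat (b g : ℕ) (G : List ℕ) :
    affinePts b (G ++ [g]) = affinePts b G + (affinePts b G).map (· ^^^ g) := by
  rw [← affinePts_cons]
  exact affinePts_perm (List.perm_append_singleton g G)

theorem mem_affinePts_self (b : ℕ) (G : List ℕ) : b ∈ affinePts b G := by
  induction G with
  | nil => simp [affinePts]
  | cons g G ih => simp [affinePts, ih]

theorem card_affinePts (b : ℕ) (G : List ℕ) : (affinePts b G).card = 2 ^ G.length := by
  induction G generalizing b with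
  | nil => simp [affinePts]
  | cons g G ih => simp [affinePts, ih, pow_succ]; ring

/-- Generators that list every point only once are nonzero. -/
theorem zero_notMem_of_nodup {b : ℕ} {G : List ℕ} (h : (affinePts b G).Nodup) : 0 ∉ G := by
  intro h0
  rw [affinePts_perm (List.perm_cons_erase h0), affinePts, Nat.xor_zero,
    Multiset.nodup_add] at h
  exact Multiset.disjoint_left.mp h.2.2 (mem_affinePts_self _ _) (mem_affinePts_self _ _)

/-- Doubling a list along nonzero generators enumerates an affine subspace. -/
theorem coe_spanList {b : ℕ} {l L : List ℕ} (G : List ℕ) (h : (l : Multiset ℕ) = affinePts b L) :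
    (spanList l G : Multiset ℕ) = affinePts b (L ++ G.filter (· ≠ 0)) := by
  induction G generalizing l L with
  | nil => simpa [spanList] using h
  | cons g G ih =>
    by_cases hg : g = 0
    · simpa [spanList, hg] using ih h
    · have := ih (l := l ++ l.map (· ^^^ g)) (L := L ++ [g]) (by
        rw [affinePts_concat, ← h]; rfl)
      simpa [spanList, hg] using this

theorem clearBit_zero_right (s p : ℕ) : clearBit s p 0 = 0 := by simp [clearBit]

theorem clearBit_zero_pivot (s x : ℕ) : clearBit s 0 x = x := by simp [clearBit]

theorem clearBit_self {s p : ℕ} (hp : p.testBit s = true) : clearBit s p p = 0 := by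
  simp [clearBit, hp]

theorem testBit_clearBit_self {s p x : ℕ} (hp : p.testBit s = true) :
    (clearBit s p x).testBit s = false := by
  unfold clearBit
  split_ifs with h
  · simp [hp, h]
  · simpa using h

theorem clearBit_xor {s p : ℕ} (x y : ℕ) :
    clearBit s p (x ^^^ y) = clearBit s p x ^^^ clearBit s p y := by
  unfold clearBit
  cases hx : x.testBit s <;> cases hy : y.testBit s <;> simp [hx, hy]
  · rw [Nat.xor_assoc]
  · rw [Nat.xor_right_comm]
  · rw [Nat.xor_assoc, Nat.xor_comm p, Nat.xor_assoc, Nat.xor_self, Nat.xor_zero]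

/-- Imposing that bit `s` is `0` removes a generator `p` that has this bit, and adds it to those
other vectors that have it. -/
theorem filter_affinePts {s p : ℕ} (hp : p.testBit s = true) (b : ℕ) (C : List ℕ) :
    (affinePts b (p :: C)).filter (fun z => z.testBit s = false) =
      affinePts (clearBit s p b) (C.map (clearBit s p)) := by
  induction C generalizing b with
  | nil =>
    simp only [affinePts, List.map_nil, Multiset.filter_add, Multiset.filter_singleton, clearBit]
    cases h : b.testBit s <;> simp [hp, h]
  | cons c C ih =>
    rw [affinePts_perm (List.Perm.swap c p C), affinePts, Multiset.filter_add, ih, ih,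
      List.map_cons, affinePts, clearBit_xor]

/-- The bits `m, …, m + l - 1` of `z` vanish. -/
def LowZero (m l z : ℕ) : Prop := ∀ i < l, z.testBit (m + i) = false

instance (m l : ℕ) : DecidablePred (LowZero m l) := fun z => by
  unfold LowZero; infer_instance

theorem LowZero_succ {m l z : ℕ} :
    LowZero m (l + 1) z ↔ z.testBit (m + l) = false ∧ LowZero m l z := by
  simp only [LowZero, Nat.lt_succ_iff_lt_or_eq, or_imp, forall_and, forall_eq]
  tauto

theorem lowZero_iff_mod {m l z : ℕ} : LowZero m l z ↔ (z >>> m) % 2 ^ l = 0 := by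
  constructor
  · intro h
    refine Nat.eq_of_testBit_eq fun i => ?_
    rw [Nat.testBit_mod_two_pow, Nat.testBit_shiftRight, Nat.zero_testBit]
    by_cases hi : i < l
    · simp [h i hi]
    · simp [hi]
  · intro h i hi
    have := congrArg (fun x => x.testBit i) h
    simpa [Nat.testBit_mod_two_pow, Nat.testBit_shiftRight, hi] using this

theorem filter_lowZero_succ (m l : ℕ) (E : Multiset ℕ) :
    E.filter (LowZero m (l + 1)) =
      (E.filter (LowZero m l)).filter (fun z => z.testBit (m + l) = false) := by
  rw [Multiset.filter_filter]
  exact Multiset.filter_congr fun z _ => LowZero_succ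

/-- The base point `b` and the generators `G` (of which those equal to `0` do not count) describe an
affine subspace that agrees with the given set `E` as far as vectors with `LowZero m l` are
concerned, and all generators satisfy the `l` constraints. -/
structure Eliminated (m : ℕ) (E : Multiset ℕ) (b : ℕ) (G : List ℕ) (l : ℕ) : Prop where
  low : ∀ g ∈ G, LowZero m l g
  nodup : (affinePts b (G.filter (· ≠ 0))).Nodup
  eq : (affinePts b (G.filter (· ≠ 0))).filter (LowZero m l) = E.filter (LowZero m l)

/-- `p` is a generator with bit `s`, or there is none and `p = 0`. -/
def IsPivot (s p : ℕ) (G : List ℕ) : Prop :=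
  (p = 0 ∧ ∀ g ∈ G, g.testBit s = false) ∨ (p ∈ G ∧ p.testBit s = true)

/-- One more constraint. Without a pivot it is constant on the subspace. Otherwise the pivot is used
up, and its place in the list of generators is taken by `0`. -/
theorem Eliminated.step {m l p b : ℕ} {E : Multiset ℕ} {G : List ℕ} (h : Eliminated m E b G l)
    (hp : IsPivot (m + l) p G) :
    Eliminated m E (clearBit (m + l) p b) (G.map (clearBit (m + l) p)) (l + 1) := by
  rcases hp with ⟨rfl, hG⟩ | ⟨hpG, hp⟩
  · have hid : clearBit (m + l) 0 = id := funext fun x => clearBit_zero_pivot _ x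
    rw [hid, List.map_id, id]
    refine ⟨fun g hg => LowZero_succ.2 ⟨hG g hg, h.low g hg⟩, h.nodup, ?_⟩
    rw [filter_lowZero_succ, filter_lowZero_succ, h.eq]
  · have hp0 : p ≠ 0 := by
      rintro rfl
      simp at hp
    have hpm : p ∈ G.filter (· ≠ 0) := by simp [hpG, hp0]
    set C := (G.filter (· ≠ 0)).erase p with hC
    have hperm : (G.filter (· ≠ 0)).Perm (p :: C) := List.perm_cons_erase hpm
    have hfil := filter_affinePts hp b C
    rw [← affinePts_perm hperm] at hfil
    have hnd : (affinePts (clearBit (m + l) p b) (C.map (clearBit (m + l) p))).Nodup := by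
      rw [← hfil]
      exact h.nodup.filter _
    have h0 := zero_notMem_of_nodup hnd
    have hG' : ((G.map (clearBit (m + l) p)).filter (· ≠ 0)).Perm
        (C.map (clearBit (m + l) p)) := by
      have h1 : (G.map (clearBit (m + l) p)).filter (· ≠ 0) =
          ((G.filter (· ≠ 0)).map (clearBit (m + l) p)).filter (· ≠ 0) := by
        clear * -
        induction G with
        | nil => rfl
        | cons g G ih =>
          by_cases hg : g = 0
          · simpa [hg, clearBit_zero_right] using ih
          · by_cases hg' : clearBit (m + l) p g = 0
            · simpa [hg, hg'] using ih
            · simpa [hg, hg'] using ih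
      have h3 : (C.map (clearBit (m + l) p)).filter (· ≠ 0) = C.map (clearBit (m + l) p) :=
        List.filter_eq_self.2 fun x hx => by simpa using fun hx0 : x = 0 => h0 (hx0 ▸ hx)
      rw [h1]
      have h2 := (hperm.map (clearBit (m + l) p)).filter (· ≠ 0)
      rw [List.map_cons, clearBit_self hp, List.filter_cons_of_neg (by simp),
        h3] at h2
      exact h2
    refine ⟨?_, ?_, ?_⟩
    · intro g' hg'
      obtain ⟨g, hg, rfl⟩ := List.mem_map.1 hg'
      refine LowZero_succ.2 ⟨testBit_clearBit_self hp, fun i hi => ?_⟩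
      unfold clearBit
      split_ifs
      · rw [Nat.testBit_xor, h.low g hg i hi, h.low p hpG i hi]; rfl
      · exact h.low g hg i hi
    · rw [affinePts_perm hG']; exact hnd
    · rw [affinePts_perm hG', ← hfil, filter_lowZero_succ m l E, ← h.eq, ← filter_lowZero_succ,
        Multiset.filter_filter]
      refine Multiset.filter_congr fun z _ => ?_
      rw [LowZero_succ]
      tauto

theorem lowZero_xor {m l x y : ℕ} (hy : LowZero m l y) : LowZero m l (x ^^^ y) ↔ LowZero m l x := by
  simp only [LowZero] at hy ⊢
  refine forall₂_congr fun i hi => ?_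
  simp [hy i hi]

theorem lowZero_of_mem_affinePts {m l b z : ℕ} {G : List ℕ} (hG : ∀ g ∈ G, LowZero m l g)
    (hz : z ∈ affinePts b G) : LowZero m l z ↔ LowZero m l b := by
  induction G generalizing b with
  | nil => rw [Multiset.mem_singleton.1 hz]
  | cons g G ih =>
    rcases Multiset.mem_add.1 hz with hz | hz
    · exact ih (fun g hg => hG g (by simp [hg])) hz
    · rw [ih (fun g hg => hG g (by simp [hg])) hz, lowZero_xor (hG g (by simp))]

/-- After elimination, either all points of the affine subspace satisfy the constraints, or none
does. -/
theorem Eliminated.filter_eq {m l b : ℕ} {E : Multiset ℕ} {G : List ℕ}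
    (h : Eliminated m E b G l) :
    E.filter (LowZero m l) =
      if LowZero m l b then affinePts b (G.filter (· ≠ 0)) else 0 := by
  have hG : ∀ g ∈ G.filter (· ≠ 0), LowZero m l g := fun g hg => h.low g (List.mem_of_mem_filter hg)
  rw [← h.eq]
  split_ifs with hb
  · exact Multiset.filter_eq_self.2 fun z hz => (lowZero_of_mem_affinePts hG hz).2 hb
  · exact Multiset.filter_eq_nil.2 fun z hz hz' => hb ((lowZero_of_mem_affinePts hG hz).1 hz')

end RangeSketch

namespace RangeSketch

open Prog

variable {n d T K : ℕ} {e : Env} {Q : M → Prop} {s : M}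

/-! ### Augmenting, eliminating and enumerating on the machine -/

theorem augInner_spec {z H : ℕ} (hC : Consts n d T K s) (hz : s.reg rZ = z) (hH : s.reg rH = H)
    (hA : s.reg rAcc = 0)
    (hQ : ∀ s', s'.reg rAcc = aug (n * d) H z → augInner.Frame s s' → Q s') :
    augInner.wp e (lim n d T K) Q s := by
  refine wp_loop (fun i s' => s'.reg rAcc = augTo (n * d) H z i) ?_ ?_ ?_ ?_
  · simp [hC.hM, bnd]
  · simp [hA, augTo]
  · intro i s' hi h hF
    have hC' := hC.of_frame hF (by decide)
    have hZ : s'.reg rZ = z := (hF.1 _ rfl).trans hz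
    have hH' : s'.reg rH = H := (hF.1 _ rfl).trans hH
    rw [Operand.get_reg, hC.hM] at hi
    simp only [wp_seq, wp_op, wp_load, wp_store, wp_push, wp_pop, wp_length, wp_input, wp_ite,
      wp_skip, mov, Operand.get_reg, Operand.get_const, Mem.setReg_reg, Mem.setReg_arr,
      Mem.setArr_reg, Mem.setArr_arr, Fin.reduceEq, if_true, if_false, BinOp.eval, BinOp.grows,
      Bool.false_eq_true, false_imp_iff, true_and, true_imp_iff, hZ, hH', h, hC'.hM, hC'.hPw,
      shiftRight_and_one, lim_val]
    refine ⟨fun hb => ⟨shiftLeft_lt (k := n * d) (Nat.mod_lt _ (by positivity)) (by omega),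
      shiftLeft_lt (k := 1) (by norm_num) (by omega), ?_⟩, fun hb => ?_⟩
    · have hb' : z.testBit i = true := by
        by_contra hh
        simp [hh] at hb
      simp [augTo, hb', hashCol]
    · have hb' : z.testBit i = false := by
        by_contra hh
        simp [hh] at hb
      simp [augTo, hb']
  · intro s' h hF
    rw [Operand.get_reg, hC.hM] at h
    exact hQ s' h hF

theorem map_take_succ (f : ℕ → ℕ) {G : List ℕ} {i : ℕ} (hi : i < G.length) :
    ((G.take i).map f ++ G.drop i).set i (f (G.getD i 0)) =
      (G.take (i + 1)).map f ++ G.drop (i + 1) := by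
  have h1 : G.take (i + 1) = G.take i ++ [G[i]] := (List.take_append_getElem hi).symm
  have h2 : G.drop i = G[i] :: G.drop (i + 1) := List.drop_eq_getElem_cons hi
  rw [h1, h2, List.getD_eq_getElem _ _ hi, List.set_append_right _ _ (by simp)]
  simp only [List.map_append, List.map_cons, List.map_nil, List.length_map, List.length_take,
    Nat.min_eq_left hi.le, Nat.sub_self, List.set_cons_zero, List.append_assoc,
    List.singleton_append]

theorem getD_map_take (f : ℕ → ℕ) {G : List ℕ} {i : ℕ} (hi : i < G.length) :
    ((G.take i).map f ++ G.drop i).getD i 0 = G.getD i 0 := by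
  rw [List.getD_append_right _ _ _ _ (by simp)]
  simp [Nat.min_eq_left hi.le]

theorem augLoop_spec {H : ℕ} (hC : Consts n d T K s) (hH : s.reg rH = H)
    (hl : (s.arr aG).length ≤ n * d + 1)
    (hQ : ∀ s', s'.arr aG = (s.arr aG).map (aug (n * d) H) → s'.reg rLen = (s.arr aG).length →
      augLoop.Frame s s' → Q s') :
    augLoop.wp e (lim n d T K) Q s := by
  refine wp_frame ?_
  simp only [wp_seq, wp_op, wp_load, wp_store, wp_push, wp_pop, wp_length, wp_input, wp_ite,
    wp_skip, mov, Operand.get_reg, Operand.get_const, Mem.setReg_reg, Mem.setReg_arr,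
    Mem.setArr_reg, Mem.setArr_arr, Fin.reduceEq, if_true, if_false, BinOp.eval, BinOp.grows,
    Bool.false_eq_true, false_imp_iff, true_and, true_imp_iff, augLoop]
  refine wp_loop (fun i s' => s'.arr aG = ((s.arr aG).take i).map (aug (n * d) H) ++
    (s.arr aG).drop i) ?_ ?_ ?_ ?_
  · simpa [bnd] using hl
  · simp
  · intro i s' hi h hF
    have hC' : Consts n d T K s' := by
      refine Consts.of_frame (s := s.setReg rLen (s.arr aG).length) ?_ hF (by decide)
      constructor <;> simp [hC.hN, hC.hD, hC.hM, hC.hPw, hC.hPn, hC.hK, hC.hT, hC.hTm, hC.hMs]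
    have hH' : s'.reg rH = H := (hF.1 _ rfl).trans (by simp [hH])
    simp only [wp_seq, wp_op, wp_load, wp_store, wp_push, wp_pop, wp_length, wp_input, wp_ite,
      wp_skip, mov, Operand.get_reg, Operand.get_const, Mem.setReg_reg, Mem.setReg_arr,
      Mem.setArr_reg, Mem.setArr_arr, Fin.reduceEq, if_true, if_false, BinOp.eval, BinOp.grows,
      Bool.false_eq_true, false_imp_iff, true_and, true_imp_iff] at hi ⊢
    rw [h, getD_map_take _ hi]
    refine augInner_spec (z := (s.arr aG).getD i 0) (H := H) ?_ (by simp) (by simp [hH'])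
      (by simp) fun s'' g1 hF' => ?_
    · constructor <;> simp [hC'.hN, hC'.hD, hC'.hM, hC'.hPw, hC'.hPn, hC'.hK, hC'.hT, hC'.hTm,
        hC'.hMs]
    · have hG : s''.arr aG = s'.arr aG := hF'.2 _ rfl
      have hi' : s''.reg rG = i := (hF'.1 _ rfl).trans (by simp)
      simp only [wp_seq, wp_op, wp_load, wp_store, wp_push, wp_pop, wp_length, wp_input, wp_ite,
        wp_skip, mov, Operand.get_reg, Operand.get_const, Mem.setReg_reg, Mem.setReg_arr,
        Mem.setArr_reg, Mem.setArr_arr, Fin.reduceEq, if_true, if_false, BinOp.eval, BinOp.grows,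
        Bool.false_eq_true, false_imp_iff, true_and, true_imp_iff, hG, hi', g1, h]
      exact map_take_succ _ hi
  · intro s' h hF hF'
    have hL : s'.reg rLen = (s.arr aG).length := (hF.1 _ rfl).trans (by simp)
    refine hQ s' ?_ hL hF'
    simpa using h

theorem augAll_spec {H : ℕ} (hC : Consts n d T K s) (hH : s.reg rH = H)
    (hH3 : H < 2 ^ (3 * (n * d))) (hl : (s.arr aG).length ≤ n * d)
    (hQ : ∀ s', s'.arr aG = (s.arr aG).map (aug (n * d) H) →
      s'.reg rBase = entry (n * d) H (s.reg rBase) → augAll.Frame s s' → Q s') :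
    augAll.wp e (lim n d T K) Q s := by
  refine wp_frame ?_
  simp only [wp_seq, wp_op, wp_load, wp_store, wp_push, wp_pop, wp_length, wp_input, wp_ite,
    wp_skip, mov, Operand.get_reg, Operand.get_const, Mem.setReg_reg, Mem.setReg_arr,
    Mem.setArr_reg, Mem.setArr_arr, Fin.reduceEq, if_true, if_false, BinOp.eval, BinOp.grows,
    Bool.false_eq_true, false_imp_iff, true_and, true_imp_iff, augAll, lim_val]
  refine ⟨lt_lim (by omega), ?_⟩
  refine augLoop_spec (H := H) ?_ (by simp [hH]) (by simp; omega) fun s' hG hL hF => ?_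
  · constructor <;> simp [hC.hN, hC.hD, hC.hM, hC.hPw, hC.hPn, hC.hK, hC.hT, hC.hTm, hC.hMs]
  have hH' : s'.reg rH = H := (hF.1 _ rfl).trans (by simp [hH])
  have hM : s'.reg rM = n * d := (hF.1 _ rfl).trans (by simp [hC.hM])
  have hPw : s'.reg rPw = 2 ^ (n * d) := (hF.1 _ rfl).trans (by simp [hC.hPw])
  simp only [wp_seq, wp_op, wp_load, wp_store, wp_push, wp_pop, wp_length, wp_input, wp_ite,
    wp_skip, mov, Operand.get_reg, Operand.get_const, Mem.setReg_reg, Mem.setReg_arr,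
    Mem.setArr_reg, Mem.setArr_arr, Fin.reduceEq, if_true, if_false, BinOp.eval, BinOp.grows,
    Bool.false_eq_true, false_imp_iff, true_and, true_imp_iff, hG, hL, hH', hM, hPw,
    List.map_append, List.map_cons, List.map_nil, List.length_append, List.length_singleton,
    Nat.add_sub_cancel, List.dropLast_concat, ← two_mul, lim_val]
  have hH2 : H >>> (2 * (n * d)) < 2 ^ (n * d) := by
    rw [Nat.shiftRight_eq_div_pow, Nat.div_lt_iff_lt_mul (by positivity), ← pow_add]
    convert hH3 using 2
    omega
  refine ⟨lt_lim (by omega), shiftLeft_lt (k := n * d + 1) (Nat.xor_lt_two_pow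
    (hH2.trans (Nat.pow_lt_pow_right (by norm_num) (by omega)))
    (Nat.pow_lt_pow_right (by norm_num) (by omega))) (by omega), fun hF' => ?_⟩
  refine hQ _ ?_ ?_ hF'
  · simp
  · simp only [Mem.setReg_reg, Fin.reduceEq, if_true, if_false, entry, offset]
    congr 1
    rw [List.getD_append_right _ _ _ _ (by simp)]
    simp

theorem findPivot_spec {b : ℕ} (hS : s.reg rS = b) (hl : (s.arr aG).length ≤ n * d + 1)
    (hQ : ∀ s', IsPivot b (s'.reg rPv) (s.arr aG) → s'.reg rLen = (s.arr aG).length →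
      findPivot.Frame s s' → Q s') :
    findPivot.wp e (lim n d T K) Q s := by
  refine wp_frame ?_
  simp only [wp_seq, wp_op, wp_load, wp_store, wp_push, wp_pop, wp_length, wp_input, wp_ite,
    wp_skip, mov, Operand.get_reg, Operand.get_const, Mem.setReg_reg, Mem.setReg_arr,
    Mem.setArr_reg, Mem.setArr_arr, Fin.reduceEq, if_true, if_false, BinOp.eval, BinOp.grows,
    Bool.false_eq_true, false_imp_iff, true_and, true_imp_iff, findPivot]
  refine wp_loop (fun i s' => IsPivot b (s'.reg rPv) ((s.arr aG).take i)) ?_ ?_ ?_ ?_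
  · simpa [bnd] using hl
  · left
    simp
  · intro i s' hi h hF
    have hS' : s'.reg rS = b := (hF.1 _ rfl).trans (by simp [hS])
    have hG : s'.arr aG = s.arr aG := (hF.2 _ rfl).trans (by simp)
    simp only [wp_seq, wp_op, wp_load, wp_store, wp_push, wp_pop, wp_length, wp_input, wp_ite,
      wp_skip, mov, Operand.get_reg, Operand.get_const, Mem.setReg_reg, Mem.setReg_arr,
      Mem.setArr_reg, Mem.setArr_arr, Fin.reduceEq, if_true, if_false, BinOp.eval, BinOp.grows,
      Bool.false_eq_true, false_imp_iff, true_and, true_imp_iff] at hi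
    simp only [wp_seq, wp_op, wp_load, wp_store, wp_push, wp_pop, wp_length, wp_input, wp_ite,
      wp_skip, mov, Operand.get_reg, Operand.get_const, Mem.setReg_reg, Mem.setReg_arr,
      Mem.setArr_reg, Mem.setArr_arr, Fin.reduceEq, if_true, if_false, BinOp.eval, BinOp.grows,
      Bool.false_eq_true, false_imp_iff, true_and, true_imp_iff, hS', hG,
      List.getD_eq_getElem _ _ hi, shiftRight_and_one]
    have h1 : (s.arr aG).take (i + 1) = (s.arr aG).take i ++ [(s.arr aG)[i]] :=
      (List.take_append_getElem hi).symm
    rw [h1]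
    refine ⟨fun hb => ?_, fun hb => ?_⟩
    · right
      refine ⟨List.mem_append_right _ (by simp), ?_⟩
      by_contra hh
      simp at hh
      simp [hh] at hb
    · rcases h with ⟨h0, h2⟩ | ⟨h0, h2⟩
      · left
        refine ⟨h0, fun g hg => ?_⟩
        rcases List.mem_append.1 hg with hg | hg
        · exact h2 g hg
        · rw [List.mem_singleton.1 hg]
          by_contra hh
          simp at hh
          simp [hh] at hb
      · right
        exact ⟨List.mem_append_left _ h0, h2⟩
  · intro s' h hF hF'
    have hL : s'.reg rLen = (s.arr aG).length := (hF.1 _ rfl).trans (by simp)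
    refine hQ s' ?_ hL hF'
    simpa using h

/-- The pivot is passed in a register, so that the generators may change while it is applied. -/
theorem applyPivot_spec {b p : ℕ} (hS : s.reg rS = b) (hp : s.reg rPv = p)
    (hL : s.reg rLen = (s.arr aG).length) (hl : (s.arr aG).length ≤ n * d + 1)
    (hQ : ∀ s', s'.arr aG = (s.arr aG).map (clearBit b p) →
      s'.reg rBase = clearBit b p (s.reg rBase) → applyPivot.Frame s s' → Q s') :
    applyPivot.wp e (lim n d T K) Q s := by
  refine wp_frame ?_
  simp only [applyPivot, wp_seq]
  refine wp_loop (fun i s' => s'.arr aG = ((s.arr aG).take i).map (clearBit b p) ++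
    (s.arr aG).drop i) ?_ ?_ ?_ ?_
  · simpa [bnd, hL] using hl
  · simp
  · intro i s' hi h hF
    have hS' : s'.reg rS = b := (hF.1 _ rfl).trans (by simp [hS])
    have hp' : s'.reg rPv = p := (hF.1 _ rfl).trans (by simp [hp])
    rw [Operand.get_reg, hL] at hi
    simp only [wp_seq, wp_op, wp_load, wp_store, wp_push, wp_pop, wp_length, wp_input, wp_ite,
      wp_skip, mov, Operand.get_reg, Operand.get_const, Mem.setReg_reg, Mem.setReg_arr,
      Mem.setArr_reg, Mem.setArr_arr, Fin.reduceEq, if_true, if_false, BinOp.eval, BinOp.grows,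
      Bool.false_eq_true, false_imp_iff, true_and, true_imp_iff, hS', hp', h, getD_map_take _ hi,
      shiftRight_and_one]
    have key := map_take_succ (clearBit b p) hi
    refine ⟨fun hb => ?_, fun hb => ?_⟩
    · rw [← key]
      have hb' : ((s.arr aG).getD i 0).testBit b = true := by
        by_contra hh
        simp only [Bool.not_eq_true] at hh
        simp only [hh, Bool.toNat_false] at hb
        exact hb rfl
      rw [clearBit, if_pos hb']
    · rw [← key]
      have hb' : ¬((s.arr aG).getD i 0).testBit b = true := by
        intro hh
        simp only [hh, Bool.toNat_true] at hb
        exact one_ne_zero hb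
      rw [clearBit, if_neg hb']
      have h3 := getD_map_take (clearBit b p) hi
      have h4 : i < (((s.arr aG).take i).map (clearBit b p) ++ (s.arr aG).drop i).length := by
        simp; omega
      rw [← h3, List.getD_eq_getElem _ _ h4, List.set_getElem_self]
  · intro s' h hF
    have hS' : s'.reg rS = b := (hF.1 _ rfl).trans (by simp [hS])
    have hp' : s'.reg rPv = p := (hF.1 _ rfl).trans (by simp [hp])
    have hB' : s'.reg rBase = s.reg rBase := (hF.1 _ rfl)
    rw [Operand.get_reg, hL, List.take_length, List.drop_length, List.append_nil] at h
    simp only [wp_seq, wp_op, wp_load, wp_store, wp_push, wp_pop, wp_length, wp_input, wp_ite,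
      wp_skip, mov, Operand.get_reg, Operand.get_const, Mem.setReg_reg, Mem.setReg_arr,
      Mem.setArr_reg, Mem.setArr_arr, Fin.reduceEq, if_true, if_false, BinOp.eval, BinOp.grows,
      Bool.false_eq_true, false_imp_iff, true_and, true_imp_iff, hS', hp', hB', shiftRight_and_one]
    refine ⟨fun hb hF' => hQ _ (by simpa using h) ?_ hF',
      fun hb hF' => hQ _ (by simpa using h) ?_ hF'⟩
    · have hb' : (s.reg rBase).testBit b = true := by
        by_contra hh
        simp [hh] at hb
      simp [clearBit, hb']
    · have hb' : (s.reg rBase).testBit b = false := by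
        by_contra hh
        simp [hh] at hb
      simp [clearBit, hb', hB']

theorem eliminate_spec {b : ℕ} (hS : s.reg rS = b) (hl : (s.arr aG).length ≤ n * d + 1)
    (hQ : ∀ s' p, IsPivot b p (s.arr aG) → s'.arr aG = (s.arr aG).map (clearBit b p) →
      s'.reg rBase = clearBit b p (s.reg rBase) → eliminate.Frame s s' → Q s') :
    eliminate.wp e (lim n d T K) Q s := by
  refine wp_frame ?_
  simp only [eliminate, wp_seq]
  refine findPivot_spec hS hl fun s' h1 h2 hF => ?_
  have hG : s'.arr aG = s.arr aG := hF.2 _ rfl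
  have hB : s'.reg rBase = s.reg rBase := hF.1 _ rfl
  refine applyPivot_spec ((hF.1 _ rfl).trans hS) rfl (by rw [h2, hG]) (by rwa [hG])
    fun s'' h3 h4 _ hF' => ?_
  exact hQ s'' _ h1 (by rw [h3, hG]) (by rw [h4, hB]) hF'

theorem elimLoop_spec {l : ℕ} {E : Multiset ℕ} (hC : Consts n d T K s) (hlev : s.reg rLev = l)
    (hlm : l ≤ n * d + 1) (hl : (s.arr aG).length ≤ n * d + 1)
    (hE : Eliminated (n * d) E (s.reg rBase) (s.arr aG) 0)
    (hQ : ∀ s', Eliminated (n * d) E (s'.reg rBase) (s'.arr aG) l →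
      (s'.arr aG).length = (s.arr aG).length → elimLoop.Frame s s' → Q s') :
    elimLoop.wp e (lim n d T K) Q s := by
  refine wp_loop (fun i s' => Eliminated (n * d) E (s'.reg rBase) (s'.arr aG) i ∧
    (s'.arr aG).length = (s.arr aG).length) ?_ ?_ ?_ ?_
  · simpa [bnd, hlev] using hlm
  · exact ⟨hE, rfl⟩
  · rintro i s' hi ⟨h1, h2⟩ hF
    have hM : s'.reg rM = n * d := (hF.1 _ rfl).trans hC.hM
    rw [Operand.get_reg, hlev] at hi
    simp only [wp_seq, wp_op, wp_load, wp_store, wp_push, wp_pop, wp_length, wp_input, wp_ite,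
      wp_skip, mov, Operand.get_reg, Operand.get_const, Mem.setReg_reg, Mem.setReg_arr,
      Mem.setArr_reg, Mem.setArr_arr, Fin.reduceEq, if_true, if_false, BinOp.eval, BinOp.grows,
      Bool.false_eq_true, false_imp_iff, true_and, true_imp_iff, hM, lim_val]
    refine ⟨lt_lim (by omega), ?_⟩
    refine eliminate_spec (b := n * d + i) (by simp) (by simp; omega) fun s'' p g1 g2 g3 _ => ?_
    simp only [wp_seq, wp_op, wp_load, wp_store, wp_push, wp_pop, wp_length, wp_input, wp_ite,
      wp_skip, mov, Operand.get_reg, Operand.get_const, Mem.setReg_reg, Mem.setReg_arr,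
      Mem.setArr_reg, Mem.setArr_arr, Fin.reduceEq, if_true, if_false, BinOp.eval, BinOp.grows,
      Bool.false_eq_true, false_imp_iff, true_and, true_imp_iff] at g1 g2 g3
    rw [g2, g3]
    exact ⟨h1.step g1, by simpa using h2⟩
  · rintro s' ⟨h1, h2⟩ hF
    rw [Operand.get_reg, hlev] at h1
    exact hQ s' h1 h2 hF

end RangeSketch

namespace RangeSketch

open Prog

variable {n d T K : ℕ} {e : Env} {Q : M → Prop} {s : M}

/-! ### Inserting a term into the sample -/

theorem computeSize_spec {l : ℕ} (hC : Consts n d T K s) (hlev : s.reg rLev = l)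
    (hlm : l ≤ n * d + 1) (hl : (s.arr aG).length ≤ n * d)
    (hQ : ∀ s', s'.reg rSz = (if LowZero (n * d) l (s.reg rBase) then
      2 ^ ((s.arr aG).filter (· ≠ 0)).length else 0) → computeSize.Frame s s' → Q s') :
    computeSize.wp e (lim n d T K) Q s := by
  refine wp_frame ?_
  simp only [wp_seq, wp_op, wp_load, wp_store, wp_push, wp_pop, wp_length, wp_input, wp_ite,
    wp_skip, mov, Operand.get_reg, Operand.get_const, Mem.setReg_reg, Mem.setReg_arr,
    Mem.setArr_reg, Mem.setArr_arr, Fin.reduceEq, if_true, if_false, BinOp.eval, BinOp.grows,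
    Bool.false_eq_true, false_imp_iff, true_and, true_imp_iff, computeSize, hC.hM, hlev, lim_val,
    Nat.one_shiftLeft]
  refine ⟨Nat.pow_lt_pow_right (by norm_num) (by omega), ?_⟩
  refine wp_loop (fun i s' => s'.reg rSz = if LowZero (n * d) l (s.reg rBase) then
      2 ^ (((s.arr aG).take i).filter (· ≠ 0)).length else 0) ?_ ?_ ?_ ?_
  · simpa [bnd] using hl.trans (Nat.le_succ _)
  · by_cases h : LowZero (n * d) l (s.reg rBase)
    · simp [h, lowZero_iff_mod.1 h]
    · simp [h, mt lowZero_iff_mod.2 h]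
  · intro i s' hi h hF
    have hG : s'.arr aG = s.arr aG := (hF.2 _ rfl).trans (by simp)
    simp only [wp_seq, wp_op, wp_load, wp_store, wp_push, wp_pop, wp_length, wp_input, wp_ite,
      wp_skip, mov, Operand.get_reg, Operand.get_const, Mem.setReg_reg, Mem.setReg_arr,
      Mem.setArr_reg, Mem.setArr_arr, Fin.reduceEq, if_true, if_false, BinOp.eval, BinOp.grows,
      Bool.false_eq_true, false_imp_iff, true_and, true_imp_iff] at hi
    have h1 : (s.arr aG).take (i + 1) = (s.arr aG).take i ++ [(s.arr aG)[i]] :=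
      (List.take_append_getElem hi).symm
    simp only [wp_seq, wp_op, wp_load, wp_store, wp_push, wp_pop, wp_length, wp_input, wp_ite,
      wp_skip, mov, Operand.get_reg, Operand.get_const, Mem.setReg_reg, Mem.setReg_arr,
      Mem.setArr_reg, Mem.setArr_arr, Fin.reduceEq, if_true, if_false, BinOp.eval, BinOp.grows,
      Bool.false_eq_true, false_imp_iff, true_and, true_imp_iff, hG, List.getD_eq_getElem _ _ hi,
      lim_val, h, h1, List.filter_append]
    have hlen : (((s.arr aG).take i).filter (· ≠ 0)).length ≤ n * d :=
      (List.length_filter_le _ _).trans (by simp; omega)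
    refine ⟨fun hz => ⟨?_, ?_⟩, fun hz => ?_⟩
    · split_ifs
      · rw [← two_mul, ← pow_succ']
        exact Nat.pow_lt_pow_right (by norm_num) (by omega)
      · positivity
    · split_ifs
      · rw [List.filter_singleton, decide_eq_true hz]
        simp [pow_succ, mul_two]
      · rfl
    · simp [hz]
  · intro s' h hF hF'
    refine hQ s' ?_ hF'
    simpa using h

/-- Because of the sentinel bit nothing survives at level `m + 1`. So the level never has to be
raised further. -/
theorem filter_sentinel {m : ℕ} {W : Multiset ℕ} (hW : ∀ z ∈ W, z.testBit (m + m) = true) :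
    W.filter (LowZero m (m + 1)) = 0 :=
  Multiset.filter_eq_nil.2 fun z hz h => by
    have := h m (Nat.lt_succ_self m)
    rw [hW z hz] at this
    exact Bool.noConfusion this

/-- The number of points of the sample and of the term that survive at level `l`. -/
def levelCard (m : ℕ) (W E : Multiset ℕ) (l : ℕ) : ℕ :=
  (W.filter (LowZero m l)).card + (E.filter (LowZero m l)).card

/-- `W` are the entries of all points seen so far, and `E` those of the term to be inserted. -/
theorem raiseLoop_spec {l₀ : ℕ} {W E : Multiset ℕ} (hC : Consts n d T K s)
    (hT : T < 2 ^ (n * d + 10)) (hlev : s.reg rLev = l₀) (hlm : l₀ ≤ n * d + 1)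
    (hl : (s.arr aG).length ≤ n * d)
    (hE : Eliminated (n * d) E (s.reg rBase) (s.arr aG) l₀)
    (hW' : ∀ z ∈ W, z.testBit (n * d + n * d) = true)
    (hE' : ∀ z ∈ E, z.testBit (n * d + n * d) = true)
    (hX : (s.arr aX : Multiset ℕ) = W.filter (LowZero (n * d) l₀))
    (hXT : (s.arr aX).length ≤ T) (hY : s.arr aY = [])
    (hQ : ∀ s' l, s'.reg rLev = l → l₀ ≤ l → l ≤ n * d + 1 →
      Eliminated (n * d) E (s'.reg rBase) (s'.arr aG) l →
      (s'.arr aG).length = (s.arr aG).length →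
      (s'.arr aX : Multiset ℕ) = W.filter (LowZero (n * d) l) → s'.arr aY = [] →
      levelCard (n * d) W E l ≤ T → (∀ l' < l, l₀ ≤ l' → T < levelCard (n * d) W E l') →
      raiseLoop.Frame s s' → Q s') :
    raiseLoop.wp e (lim n d T K) Q s := by
  have hTS : T < 2 ^ (3 * (n * d) + 12) := pow_le_lim hT (by omega)
  have htop : levelCard (n * d) W E (n * d + 1) = 0 := by
    rw [levelCard, filter_sentinel hW', filter_sentinel hE']; rfl
  refine wp_loop (fun i s' => ∃ l, s'.reg rLev = l ∧ l₀ ≤ l ∧ l ≤ n * d + 1 ∧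
      Eliminated (n * d) E (s'.reg rBase) (s'.arr aG) l ∧
      (s'.arr aG).length = (s.arr aG).length ∧
      (s'.arr aX : Multiset ℕ) = W.filter (LowZero (n * d) l) ∧ s'.arr aY = [] ∧
      (s'.arr aX).length ≤ T ∧
      (∀ l' < l, l₀ ≤ l' → T < levelCard (n * d) W E l') ∧
      -- Every round raises the level, unless the sample fits already; the latter is the case after
      -- `m + 1` rounds by `htop`.
      (i + l₀ ≤ l ∨ levelCard (n * d) W E l ≤ T)) ?_ ?_ ?_ ?_
  · simp [hC.hMs, bnd]
  · exact ⟨l₀, hlev, le_rfl, hlm, hE, rfl, hX, hY, hXT, fun l' h1 h2 => by omega, by simp⟩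
  · rintro i s' hi ⟨l, h1, h2, h3, h4, h5, h6, h7, h8, h9, h10⟩ hF
    have hC' := hC.of_frame hF (by decide)
    simp only [wp_seq]
    refine computeSize_spec (l := l) ?_ (by simp [h1]) h3 (by simp; omega) fun s₁ g1 hF₁ => ?_
    · constructor <;> simp [hC'.hN, hC'.hD, hC'.hM, hC'.hPw, hC'.hPn, hC'.hK, hC'.hT, hC'.hTm,
        hC'.hMs]
    have hcard : s₁.reg rSz = (E.filter (LowZero (n * d) l)).card := by
      rw [g1, h4.filter_eq]
      simp only [wp_seq, wp_op, wp_load, wp_store, wp_push, wp_pop, wp_length, wp_input, wp_ite,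
        wp_skip, mov, Operand.get_reg, Operand.get_const, Mem.setReg_reg, Mem.setReg_arr,
        Mem.setArr_reg, Mem.setArr_arr, Fin.reduceEq, if_true, if_false, BinOp.eval, BinOp.grows,
        Bool.false_eq_true, false_imp_iff, true_and, true_imp_iff]
      split_ifs
      · rw [card_affinePts]
      · rfl
    have hsz : s₁.reg rSz < 2 ^ (n * d + 1) := by
      rw [g1]
      simp only [wp_seq, wp_op, wp_load, wp_store, wp_push, wp_pop, wp_length, wp_input, wp_ite,
        wp_skip, mov, Operand.get_reg, Operand.get_const, Mem.setReg_reg, Mem.setReg_arr,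
        Mem.setArr_reg, Mem.setArr_arr, Fin.reduceEq, if_true, if_false, BinOp.eval, BinOp.grows,
        Bool.false_eq_true, false_imp_iff, true_and, true_imp_iff]
      split_ifs
      · refine Nat.pow_lt_pow_right (by norm_num) ?_
        have := List.length_filter_le (fun x => decide (x ≠ 0)) (s'.arr aG)
        omega
      · positivity
    have hX₁ : s₁.arr aX = s'.arr aX := (hF₁.2 _ rfl).trans (by simp)
    have hY₁ : s₁.arr aY = s'.arr aY := (hF₁.2 _ rfl).trans (by simp)
    have hG₁ : s₁.arr aG = s'.arr aG := (hF₁.2 _ rfl).trans (by simp)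
    have hB₁ : s₁.reg rBase = s'.reg rBase := (hF₁.1 _ rfl).trans (by simp)
    have hL₁ : s₁.reg rLev = l := (hF₁.1 _ rfl).trans (by simp [h1])
    have hM₁ : s₁.reg rM = n * d := (hF₁.1 _ rfl).trans (by simp [hC'.hM])
    have hT₁ : s₁.reg rT = T := (hF₁.1 _ rfl).trans (by simp [hC'.hT])
    have hlc : (s₁.arr aX).length + s₁.reg rSz = levelCard (n * d) W E l := by
      rw [hcard, levelCard, ← h6, hX₁]; rfl
    simp only [wp_seq, wp_op, wp_load, wp_store, wp_push, wp_pop, wp_length, wp_input, wp_ite,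
      wp_skip, mov, Operand.get_reg, Operand.get_const, Mem.setReg_reg, Mem.setReg_arr,
      Mem.setArr_reg, Mem.setArr_arr, Fin.reduceEq, if_true, if_false, BinOp.eval, BinOp.grows,
      Bool.false_eq_true, false_imp_iff, true_and, true_imp_iff, hlc, hT₁, lim_val]
    refine ⟨?_, fun hbig => ?_, fun hsmall => ?_⟩
    · rw [← hlc, hX₁]
      have e1 : 2 ^ (n * d + 1) ≤ 2 ^ (n * d + 10) := Nat.pow_le_pow_right (by norm_num) (by omega)
      have e2 : 2 ^ (n * d + 10) + 2 ^ (n * d + 10) ≤ 2 ^ (3 * (n * d) + 12) := by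
        rw [← two_mul, ← pow_succ']
        exact Nat.pow_le_pow_right (by norm_num) (by omega)
      omega
    · have hbig' : T < levelCard (n * d) W E l := by
        by_contra hh
        exact hbig (if_neg hh)
      have hlt : l < n * d + 1 := by
        refine lt_of_le_of_ne h3 fun hh => ?_
        rw [hh, htop] at hbig'
        exact Nat.not_lt_zero _ hbig'
      simp only [hM₁, hL₁]
      refine ⟨lt_lim (by omega), ?_⟩
      refine purge_spec (T := T) (by simp [hY₁, h7]) (by simp [hX₁, h8]) hTS
        fun s₂ k1 k2 hF₂ => ?_
      have hG₂ : s₂.arr aG = s'.arr aG := (hF₂.2 _ rfl).trans (by simp [hG₁])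
      have hB₂ : s₂.reg rBase = s'.reg rBase := (hF₂.1 _ rfl).trans (by simp [hB₁])
      have hS₂ : s₂.reg rS = n * d + l := (hF₂.1 _ rfl).trans (by simp)
      have hL₂ : s₂.reg rLev = l := (hF₂.1 _ rfl).trans (by simp [hL₁])
      refine eliminate_spec (b := n * d + l) hS₂ (by rw [hG₂, h5]; omega)
        fun s₃ p j1 j2 j3 hF₃ => ?_
      have hX₃ : s₃.arr aX = s₂.arr aX := hF₃.2 _ rfl
      have hY₃ : s₃.arr aY = s₂.arr aY := hF₃.2 _ rfl
      have hL₃ : s₃.reg rLev = l := (hF₃.1 _ rfl).trans hL₂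
      simp only [wp_seq, wp_op, wp_load, wp_store, wp_push, wp_pop, wp_length, wp_input, wp_ite,
        wp_skip, mov, Operand.get_reg, Operand.get_const, Mem.setReg_reg, Mem.setReg_arr,
        Mem.setArr_reg, Mem.setArr_arr, Fin.reduceEq, if_true, if_false, BinOp.eval, BinOp.grows,
        Bool.false_eq_true, false_imp_iff, true_and, true_imp_iff] at k1
      simp only [wp_seq, wp_op, wp_load, wp_store, wp_push, wp_pop, wp_length, wp_input, wp_ite,
        wp_skip, mov, Operand.get_reg, Operand.get_const, Mem.setReg_reg, Mem.setReg_arr,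
        Mem.setArr_reg, Mem.setArr_arr, Fin.reduceEq, if_true, if_false, BinOp.eval, BinOp.grows,
        Bool.false_eq_true, false_imp_iff, true_and, true_imp_iff, hL₃, lim_val]
      refine ⟨lt_lim (by omega), l + 1, by simp, by omega, by omega, ?_, ?_, ?_, ?_, ?_, ?_, ?_⟩
      · rw [j3, j2, hG₂, hB₂]
        exact h4.step (by rwa [hG₂] at j1)
      · rw [j2, hG₂]; simpa using h5
      · rw [hX₃, k1, hX₁, filter_lowZero_succ, ← h6, Multiset.filter_coe]
        simp
      · rw [hY₃, k2]
      · rw [hX₃, k1, hX₁]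
        exact (List.length_filter_le _ _).trans h8
      · intro l' hl' hl''
        rcases Nat.lt_succ_iff_lt_or_eq.1 hl' with h | rfl
        · exact h9 l' h hl''
        · exact hbig'
      · left
        rcases h10 with h10 | h10 <;> omega
    · have hsmall' : levelCard (n * d) W E l ≤ T := by
        by_contra hh
        rw [if_pos (by omega)] at hsmall
        exact one_ne_zero hsmall
      refine ⟨l, by simp [hL₁], h2, h3, ?_, ?_, ?_, ?_, ?_, h9, Or.inr hsmall'⟩
      · simpa [hG₁, hB₁] using h4
      · simpa [hG₁] using h5
      · simpa [hX₁] using h6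
      · simpa [hY₁] using h7
      · simpa [hX₁] using h8
  · rintro s' ⟨l, h1, h2, h3, h4, h5, h6, h7, h8, h9, h10⟩ hF
    refine hQ s' l h1 h2 h3 h4 h5 h6 h7 ?_ h9 hF
    rcases h10 with h10 | h10
    · rw [Operand.get_reg, hC.hMs] at h10
      have : l = n * d + 1 := by omega
      rw [this, htop]
      exact Nat.zero_le _
    · exact h10

theorem spanInner_spec {z : ℕ} {X₀ l : List ℕ} (hz : s.reg rZ = z) (hSt : s.reg rSt = X₀.length)
    (hX : s.arr aX = X₀ ++ l) (hl : l.length ≤ T)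
    (hT : (X₀ ++ l ++ l).length < 2 ^ (3 * (n * d) + 12))
    (hQ : ∀ s', s'.arr aX = X₀ ++ (l ++ l.map (· ^^^ z)) → spanInner.Frame s s' → Q s') :
    spanInner.wp e (lim n d T K) Q s := by
  refine wp_frame ?_
  simp only [wp_seq, wp_op, wp_load, wp_store, wp_push, wp_pop, wp_length, wp_input, wp_ite,
    wp_skip, mov, Operand.get_reg, Operand.get_const, Mem.setReg_reg, Mem.setReg_arr,
    Mem.setArr_reg, Mem.setArr_arr, Fin.reduceEq, if_true, if_false, BinOp.eval, BinOp.grows,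
    Bool.false_eq_true, false_imp_iff, true_and, true_imp_iff, spanInner, hSt, hX,
    List.length_append, Nat.add_sub_cancel_left]
  simp only [List.length_append] at hT
  refine wp_loop (fun i s' => s'.arr aX = X₀ ++ (l ++ (l.take i).map (· ^^^ z))) ?_ ?_ ?_ ?_
  · simpa [bnd] using hl
  · simp [hX]
  · intro i s' hi h hF
    have hz' : s'.reg rZ = z := (hF.1 _ rfl).trans (by simp [hz])
    have hSt' : s'.reg rSt = X₀.length := (hF.1 _ rfl).trans (by simp [hSt])
    simp only [wp_seq, wp_op, wp_load, wp_store, wp_push, wp_pop, wp_length, wp_input, wp_ite,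
      wp_skip, mov, Operand.get_reg, Operand.get_const, Mem.setReg_reg, Mem.setReg_arr,
      Mem.setArr_reg, Mem.setArr_arr, Fin.reduceEq, if_true, if_false, BinOp.eval, BinOp.grows,
      Bool.false_eq_true, false_imp_iff, true_and, true_imp_iff] at hi
    have h1 : l.take (i + 1) = l.take i ++ [l[i]] := (List.take_append_getElem hi).symm
    have h2 : (X₀ ++ (l ++ (l.take i).map (· ^^^ z))).getD (X₀.length + i) 0 = l[i] := by
      rw [List.getD_append_right _ _ _ _ (by simp), Nat.add_sub_cancel_left,
        List.getD_append _ _ _ _ hi, List.getD_eq_getElem _ _ hi]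
    simp only [wp_seq, wp_op, wp_load, wp_store, wp_push, wp_pop, wp_length, wp_input, wp_ite,
      wp_skip, mov, Operand.get_reg, Operand.get_const, Mem.setReg_reg, Mem.setReg_arr,
      Mem.setArr_reg, Mem.setArr_arr, Fin.reduceEq, if_true, if_false, BinOp.eval, BinOp.grows,
      Bool.false_eq_true, false_imp_iff, true_and, true_imp_iff, hz', hSt', h, h2, h1, lim_val]
    refine ⟨by omega, ?_, ?_⟩
    · simp only [List.length_append, List.length_map, List.length_take]
      omega
    · simp only [List.map_append, List.map_cons, List.map_nil, List.append_assoc]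
  · intro s' h hF hF'
    simp only [wp_seq, wp_op, wp_load, wp_store, wp_push, wp_pop, wp_length, wp_input, wp_ite,
      wp_skip, mov, Operand.get_reg, Operand.get_const, Mem.setReg_reg, Mem.setReg_arr,
      Mem.setArr_reg, Mem.setArr_arr, Fin.reduceEq, if_true, if_false, BinOp.eval, BinOp.grows,
      Bool.false_eq_true, false_imp_iff, true_and, true_imp_iff, List.take_length] at h
    exact hQ s' h hF'

theorem spanList_concat (l G : List ℕ) (g : ℕ) : spanList l (G ++ [g]) =
    if g = 0 then spanList l G else spanList l G ++ (spanList l G).map (· ^^^ g) := by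
  simp [spanList]

theorem length_spanList_mono {l G G' : List ℕ} :
    (spanList l G).length ≤ (spanList l (G ++ G')).length := by
  induction G' using List.reverseRecOn with
  | nil => simp
  | append_singleton G' g ih =>
    rw [← List.append_assoc, spanList_concat]
    split_ifs
    · exact ih
    · rw [List.length_append]; omega

/-- The subspace is listed if its base point survives; otherwise none of its points does, and
doubling starts from the empty list. -/
theorem enumerate_spec {l : ℕ} (hC : Consts n d T K s) (hT : T < 2 ^ (n * d + 10))
    (hlev : s.reg rLev = l) (hlm : l ≤ n * d + 1) (hl : (s.arr aG).length ≤ n * d)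
    (hXT : (s.arr aX).length + (if LowZero (n * d) l (s.reg rBase) then
      (spanList [s.reg rBase] (s.arr aG)).length else 0) ≤ T)
    (hQ : ∀ s', s'.arr aX = s.arr aX ++ (if LowZero (n * d) l (s.reg rBase) then
      spanList [s.reg rBase] (s.arr aG) else []) → enumerate.Frame s s' → Q s') :
    enumerate.wp e (lim n d T K) Q s := by
  have hTS : T + T + 1 < 2 ^ (3 * (n * d) + 12) := by
    calc T + T + 1 < 2 ^ (n * d + 10) + 2 ^ (n * d + 10) := by omega
      _ = 2 ^ (n * d + 11) := by rw [pow_succ _ (n * d + 10)]; ring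
      _ ≤ _ := Nat.pow_le_pow_right (by norm_num) (by omega)
  refine wp_frame ?_
  set l₀ : List ℕ := if LowZero (n * d) l (s.reg rBase) then [s.reg rBase] else [] with hl₀
  have hsp : (if LowZero (n * d) l (s.reg rBase) then
      spanList [s.reg rBase] (s.arr aG) else []) = spanList l₀ (s.arr aG) := by
    rw [hl₀]
    split_ifs
    · rfl
    · symm
      generalize s.arr aG = G
      induction G using List.reverseRecOn with
      | nil => rfl
      | append_singleton G g ih => rw [spanList_concat, ih]; simp
  have hXT' : (s.arr aX).length + (spanList l₀ (s.arr aG)).length ≤ T := by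
    rw [← hsp]
    split_ifs at hXT ⊢
    · exact hXT
    · simpa using hXT
  rw [hsp] at hQ
  have hloop : ∀ s₁ : M, s₁.arr aX = s.arr aX ++ l₀ → s₁.arr aG = s.arr aG →
      s₁.reg rSt = (s.arr aX).length →
      (length rLen aG ;; loop rG rLen (load rZ aG rG ;; Prog.ite rZ spanInner skip)).wp e
        (lim n d T K) (fun s' => enumerate.Frame s s' → Q s') s₁ := by
    intro s₁ h1 h2 h3
    simp only [wp_seq, wp_length]
    refine wp_loop (fun i s' => s'.arr aX = s.arr aX ++ spanList l₀ ((s.arr aG).take i))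
      ?_ ?_ ?_ ?_
    · simpa [bnd, h2] using hl.trans (Nat.le_succ _)
    · simpa [spanList] using h1
    · intro i s' hi h hF
      have hG : s'.arr aG = s.arr aG := (hF.2 _ rfl).trans (by simp [h2])
      have hSt : s'.reg rSt = (s.arr aX).length := (hF.1 _ rfl).trans (by simp [h3])
      simp only [wp_seq, wp_op, wp_load, wp_store, wp_push, wp_pop, wp_length, wp_input, wp_ite,
        wp_skip, mov, Operand.get_reg, Operand.get_const, Mem.setReg_reg, Mem.setReg_arr,
        Mem.setArr_reg, Mem.setArr_arr, Fin.reduceEq, if_true, if_false, BinOp.eval, BinOp.grows,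
        Bool.false_eq_true, false_imp_iff, true_and, true_imp_iff, h2] at hi
      have h4 : (s.arr aG).take (i + 1) = (s.arr aG).take i ++ [(s.arr aG)[i]] :=
        (List.take_append_getElem hi).symm
      have h5 : (spanList l₀ ((s.arr aG).take i)).length ≤ (spanList l₀ (s.arr aG)).length := by
        conv_rhs => rw [← List.take_append_drop i (s.arr aG)]
        exact length_spanList_mono
      simp only [wp_seq, wp_op, wp_load, wp_store, wp_push, wp_pop, wp_length, wp_input, wp_ite,
        wp_skip, mov, Operand.get_reg, Operand.get_const, Mem.setReg_reg, Mem.setReg_arr,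
        Mem.setArr_reg, Mem.setArr_arr, Fin.reduceEq, if_true, if_false, BinOp.eval, BinOp.grows,
        Bool.false_eq_true, false_imp_iff, true_and, true_imp_iff, hG, List.getD_eq_getElem _ _ hi,
        h4, spanList_concat]
      refine ⟨fun hz => ?_, fun hz => ?_⟩
      · refine spanInner_spec (X₀ := s.arr aX) (l := spanList l₀ ((s.arr aG).take i))
          (z := (s.arr aG)[i]) (by simp) (by simp [hSt]) (by simp [h]) (by omega) ?_
          fun s'' h6 _ => ?_
        · simp only [List.length_append]; omega
        · rw [h6, if_neg hz]
      · rw [if_pos hz, h]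
    · intro s' h hF
      simp only [wp_seq, wp_op, wp_load, wp_store, wp_push, wp_pop, wp_length, wp_input, wp_ite,
        wp_skip, mov, Operand.get_reg, Operand.get_const, Mem.setReg_reg, Mem.setReg_arr,
        Mem.setArr_reg, Mem.setArr_arr, Fin.reduceEq, if_true, if_false, BinOp.eval, BinOp.grows,
        Bool.false_eq_true, false_imp_iff, true_and, true_imp_iff, h2, List.take_length] at h
      exact hQ s' h
  have h0 : LowZero (n * d) l (s.reg rBase) ↔ s.reg rBase >>> (n * d) % 2 ^ l = 0 :=
    lowZero_iff_mod
  have h8 := length_spanList_mono (l := l₀) (G := []) (G' := s.arr aG)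
  unfold enumerate
  simp only [wp_op, wp_length, wp_ite, wp_push, Operand.get_reg, Operand.get_const,
    Mem.setReg_reg, Mem.setReg_arr, Fin.reduceEq, if_true, if_false, BinOp.eval, BinOp.grows,
    wp_seq (p := op _ _ _ _), wp_seq (p := length rSt aX), wp_seq (p := Prog.ite _ _ _), wp_skip,
    Bool.false_eq_true, false_imp_iff, true_and, true_imp_iff, hC.hM, hlev, lim_val,
    Nat.one_shiftLeft, ← h0]
  refine ⟨Nat.pow_lt_pow_right (by norm_num) (by omega), fun hz => ?_, fun hz => ⟨?_, ?_⟩⟩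
  · rw [ne_eq, ← h0] at hz
    exact hloop _ (by simp [hl₀, hz]) (by simp) (by simp)
  · omega
  · exact hloop _ (by simp [hl₀, hz]) (by simp) (by simp)

end RangeSketch

namespace RangeSketch

/-! ### Splitting a range into affine subspaces -/

/-- `x` lies in the piece of `[a, b]` with index `k`. -/
def InPiece (a b k x : ℕ) : Prop :=
  pieceOk a b k ∧ (x >>> (k - 1) = pieceP a b k ∨ x >>> (k - 1) = pieceQ a b k)

theorem inPiece_zero {a b x : ℕ} : InPiece a b 0 x ↔ a ≤ b ∧ (x = a ∨ x = b) := by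
  simp [InPiece, pieceOk, pieceP, pieceQ]

theorem xor_one_eq (y : ℕ) : y ^^^ 1 = if y % 2 = 0 then y + 1 else y - 1 := by
  split_ifs with h
  · rw [Nat.xor_one_of_even (Nat.even_iff.2 h)]
  · rw [Nat.xor_one_of_odd (Nat.odd_iff.2 (by omega))]

/-- For `j ≥ 0`, the piece with index `j + 1` consists of those `x` whose dyadic block of length
`2 ^ j` lies strictly between those of `a` and `b`, while their block of length `2 ^ (j + 1)`
does not. -/
theorem inPiece_succ {a b j x : ℕ} : InPiece a b (j + 1) x ↔
    (a >>> j < x >>> j ∧ x >>> j < b >>> j) ∧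
      ¬(a >>> (j + 1) < x >>> (j + 1) ∧ x >>> (j + 1) < b >>> (j + 1)) := by
  simp only [InPiece, pieceOk, pieceP, pieceQ, Nat.add_sub_cancel, Nat.succ_ne_zero, if_false,
    Nat.testBit_eq_decide_div_mod_eq, ← Nat.shiftRight_eq_div_pow, Nat.shiftRight_add]
  generalize a >>> j = a'
  generalize b >>> j = b'
  generalize x >>> j = x'
  simp only [xor_one_eq, Nat.shiftRight_eq_div_pow, decide_eq_true_eq, decide_eq_false_iff_not]
  split_ifs <;> omega

theorem between_of_succ {a b j x : ℕ}
    (h : a >>> (j + 1) < x >>> (j + 1) ∧ x >>> (j + 1) < b >>> (j + 1)) :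
    a >>> j < x >>> j ∧ x >>> j < b >>> j := by
  simp only [Nat.shiftRight_add, Nat.shiftRight_eq_div_pow _ 1] at h
  omega

theorem between_mono {a b i j x : ℕ} (hij : i ≤ j) (h : a >>> j < x >>> j ∧ x >>> j < b >>> j) :
    a >>> i < x >>> i ∧ x >>> i < b >>> i := by
  induction hij with
  | refl => exact h
  | step _ ih => exact ih (between_of_succ h)

theorem InPiece.mem {a b k x : ℕ} (h : InPiece a b k x) : a ≤ x ∧ x ≤ b := by
  cases k with
  | zero =>
    rw [inPiece_zero] at h
    omega
  | succ j =>
    have := between_mono (Nat.zero_le j) (inPiece_succ.1 h).1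
    simp only [Nat.shiftRight_zero] at this
    omega

/-- Every number in `[a, b]` lies in a piece: with index `0` if it is `a` or `b`, and otherwise with
the least index `k` such that its dyadic block of length `2 ^ k` is not strictly between those of
`a` and `b`. -/
theorem exists_inPiece {n a b x : ℕ} (hn : 1 ≤ n) (hb : b < 2 ^ n) (hax : a ≤ x) (hxb : x ≤ b) :
    ∃ k < n, InPiece a b k x := by
  by_cases h0 : x = a ∨ x = b
  · exact ⟨0, hn, inPiece_zero.2 ⟨hax.trans hxb, h0⟩⟩
  have hex : ∃ j, ¬(a >>> j < x >>> j ∧ x >>> j < b >>> j) := by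
    refine ⟨n, ?_⟩
    rw [Nat.shiftRight_eq_div_pow b, Nat.div_eq_of_lt hb]
    exact fun h => Nat.not_lt_zero _ h.2
  classical
  have hspec := Nat.find_spec hex
  have hmin : ∀ j < Nat.find hex, a >>> j < x >>> j ∧ x >>> j < b >>> j :=
    fun j hj => not_not.1 (Nat.find_min hex hj)
  generalize Nat.find hex = k at hspec hmin
  have hk0 : k ≠ 0 := by
    rintro rfl
    simp only [Nat.shiftRight_zero] at hspec
    omega
  obtain ⟨j, rfl⟩ := Nat.exists_eq_succ_of_ne_zero hk0
  refine ⟨j + 1, ?_, inPiece_succ.2 ⟨hmin j (Nat.lt_succ_self j), hspec⟩⟩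
  by_contra hjn
  have := between_mono (by omega : n - 1 ≤ j) (hmin j (Nat.lt_succ_self j))
  have h2 : b >>> (n - 1) < 2 := by
    rw [Nat.shiftRight_eq_div_pow, Nat.div_lt_iff_lt_mul (by positivity), ← pow_succ']
    rwa [Nat.sub_add_cancel hn]
  have h3 := Nat.zero_le (a >>> (n - 1))
  omega

/-- Piece `j + 1` is strictly between `a` and `b` at the scale `2 ^ j`, but not at the scale
`2 ^ (j + 1)`, and being strictly between is inherited by finer scales. -/
theorem InPiece.unique {a b k k' x : ℕ} (h : InPiece a b k x) (h' : InPiece a b k' x) :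
    k = k' := by
  have key : ∀ k k', InPiece a b k x → InPiece a b k' x → ¬k < k' := by
    intro k k' h h' hlt
    obtain ⟨j', rfl⟩ : ∃ j, k' = j + 1 := ⟨k' - 1, by omega⟩
    rw [inPiece_succ] at h'
    cases k with
    | zero =>
      have := between_mono (Nat.zero_le _) h'.1
      rw [inPiece_zero] at h
      simp only [Nat.shiftRight_zero] at this
      omega
    | succ j =>
      exact (inPiece_succ.1 h).2 (between_mono (by omega) h'.1)
  have h1 := key _ _ h h'
  have h2 := key _ _ h' h
  omega

/-- The codes of the points in the first `i` dimensions of the term with number `t`. -/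
def InTerm (n : ℕ) (it : ℕ → ℕ) (t i v : ℕ) : Prop :=
  ∀ i' < i, InPiece (it (2 * i')) (it (2 * i' + 1)) (digit n t i') ((v >>> (n * i')) % 2 ^ n)

theorem InTerm.inBox {n d : ℕ} {it : ℕ → ℕ} {t v : ℕ} (h : InTerm n it t d v) :
    InBox n d it v := fun i hi => (h i hi).mem

theorem digit_finFunctionFinEquiv {n d : ℕ} (k : Fin d → Fin n) (i : Fin d) :
    digit n (finFunctionFinEquiv k) i = k i := by
  rw [digit, ← finFunctionFinEquiv_symm_apply_val, Equiv.symm_apply_apply]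

/-- Every point of a range lies in one of its terms. -/
theorem exists_inTerm {n d : ℕ} {it : ℕ → ℕ} {v : ℕ} (hn : 1 ≤ n) (hit : ∀ j, it j < 2 ^ n)
    (h : InBox n d it v) : ∃ t < n ^ d, InTerm n it t d v := by
  have : ∀ i : Fin d, ∃ k : Fin n, InPiece (it (2 * i)) (it (2 * i + 1)) k
      ((v >>> (n * i)) % 2 ^ n) := fun i => by
    obtain ⟨k, hk, h'⟩ := exists_inPiece hn (hit _) (h i i.2).1 (h i i.2).2
    exact ⟨⟨k, hk⟩, h'⟩
  choose k hk using this
  refine ⟨finFunctionFinEquiv k, (finFunctionFinEquiv k).2, fun i hi => ?_⟩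
  have := digit_finFunctionFinEquiv k ⟨i, hi⟩
  simp only at this
  rw [this]
  exact hk ⟨i, hi⟩

/-- The terms of a range are disjoint. -/
theorem InTerm.unique {n d : ℕ} {it : ℕ → ℕ} {v t t' : ℕ} (ht : t < n ^ d) (ht' : t' < n ^ d)
    (h : InTerm n it t d v) (h' : InTerm n it t' d v) : t = t' := by
  have : finFunctionFinEquiv.symm (⟨t, ht⟩ : Fin (n ^ d)) =
      finFunctionFinEquiv.symm (⟨t', ht'⟩ : Fin (n ^ d)) := by
    funext i
    refine Fin.ext ?_
    rw [finFunctionFinEquiv_symm_apply_val, finFunctionFinEquiv_symm_apply_val]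
    exact (h i i.2).unique (h' i i.2)
  simpa using finFunctionFinEquiv.symm.injective this

theorem affinePts_append (b c : ℕ) (G L : List ℕ) : affinePts (b ^^^ c) (G ++ L) =
    (affinePts c L).bind fun y => (affinePts b G).map (· ^^^ y) := by
  rw [affinePts_perm List.perm_append_comm]
  induction L generalizing c with
  | nil => simp [affinePts, affinePts_xor]
  | cons l L ih =>
    rw [List.cons_append, affinePts, affinePts, Multiset.add_bind, ih, Nat.xor_assoc, ih]

theorem affinePts_shiftLeft (c s : ℕ) (L : List ℕ) :
    affinePts (c <<< s) (L.map (· <<< s)) = (affinePts c L).map (· <<< s) := by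
  induction L generalizing c with
  | nil => simp [affinePts]
  | cons l L ih =>
    rw [List.map_cons, affinePts, affinePts, Multiset.map_add, ih, ← Nat.shiftLeft_xor_distrib, ih]

theorem xor_shiftLeft_shiftRight {x w s : ℕ} (hx : x < 2 ^ s) :
    (x ^^^ w <<< s) >>> s = w ∧ (x ^^^ w <<< s) % 2 ^ s = x := by
  constructor
  · rw [Nat.shiftRight_xor_distrib, Nat.shiftLeft_shiftRight, Nat.shiftRight_eq_div_pow,
      Nat.div_eq_of_lt hx, Nat.zero_xor]
  · rw [Nat.xor_mod_two_pow, Nat.mod_eq_of_lt hx, Nat.shiftLeft_eq, Nat.mul_mod_left, Nat.xor_zero]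

theorem mod_xor_shiftRight (v s : ℕ) : (v % 2 ^ s) ^^^ ((v >>> s) <<< s) = v := by
  refine Nat.eq_of_testBit_eq fun i => ?_
  simp only [Nat.testBit_xor, Nat.testBit_mod_two_pow, Nat.testBit_shiftLeft,
    Nat.testBit_shiftRight]
  rcases lt_or_ge i s with h | h
  · simp [h, not_le.2 h]
  · simp [h, not_lt.2 h]

/-- The product of an affine subspace of vectors of length `s` with another one placed above it. -/
theorem affinePts_prod {b c s : ℕ} {G L : List ℕ} (hA : (affinePts b G).Nodup)
    (hlt : ∀ x ∈ affinePts b G, x < 2 ^ s) (hB : (affinePts c L).Nodup) :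
    (affinePts (b ^^^ c <<< s) (G ++ L.map (· <<< s))).Nodup ∧
      ∀ v, v ∈ affinePts (b ^^^ c <<< s) (G ++ L.map (· <<< s)) ↔
        v % 2 ^ s ∈ affinePts b G ∧ v >>> s ∈ affinePts c L := by
  rw [affinePts_append, affinePts_shiftLeft, Multiset.bind_map]
  constructor
  · rw [Multiset.nodup_bind]
    refine ⟨fun y _ => hA.map fun x x' h => ?_, ?_⟩
    · have := congrArg (· ^^^ y <<< s) h
      simpa [Nat.xor_assoc] using this
    · refine Multiset.Nodup.pairwise ?_ hB
      intro y _ z _ hyz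
      rw [Function.onFun, Multiset.disjoint_left]
      intro v hv hv'
      obtain ⟨x, hx, rfl⟩ := Multiset.mem_map.1 hv
      obtain ⟨x', hx', h⟩ := Multiset.mem_map.1 hv'
      have h1 := (xor_shiftLeft_shiftRight (w := y) (hlt x hx)).1
      rw [← h, (xor_shiftLeft_shiftRight (hlt x' hx')).1] at h1
      exact hyz h1.symm
  · intro v
    simp only [Multiset.mem_bind, Multiset.mem_map]
    constructor
    · rintro ⟨y, hy, x, hx, rfl⟩
      rw [(xor_shiftLeft_shiftRight (hlt x hx)).1, (xor_shiftLeft_shiftRight (hlt x hx)).2]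
      exact ⟨hx, hy⟩
    · rintro ⟨h1, h2⟩
      exact ⟨_, h2, _, h1, mod_xor_shiftRight v s⟩

theorem affinePts_bits (j : ℕ) :
    (affinePts 0 ((List.range j).map (1 <<< ·))).Nodup ∧
      ∀ v, v ∈ affinePts 0 ((List.range j).map (1 <<< ·)) ↔ v < 2 ^ j := by
  induction j with
  | zero => simp [affinePts]
  | succ j ih =>
    have h01 : affinePts 0 [1] = {0, 1} := by decide
    have := affinePts_prod (c := 0) (L := [1]) ih.1 (fun x hx => (ih.2 x).1 hx)
      (by rw [h01]; decide)
    rw [List.range_succ, List.map_append]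
    simp only [Nat.zero_shiftLeft, Nat.xor_zero, List.map_cons, List.map_nil] at this ⊢
    refine ⟨this.1, fun v => ?_⟩
    rw [this.2, ih.2, h01]
    have h1 : v % 2 ^ j < 2 ^ j := Nat.mod_lt _ (by positivity)
    have h2 : v >>> j < 2 ↔ v < 2 ^ (j + 1) := by
      rw [Nat.shiftRight_eq_div_pow, Nat.div_lt_iff_lt_mul (by positivity), pow_succ']
    rw [← h2]
    simp only [h1, true_and, Multiset.insert_eq_cons, Multiset.mem_cons, Multiset.mem_singleton]
    have h3 := Nat.zero_le (v >>> j)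
    omega

theorem affinePts_pair (p q : ℕ) : (affinePts p ([q ^^^ p].filter (· ≠ 0))).Nodup ∧
    ∀ v, v ∈ affinePts p ([q ^^^ p].filter (· ≠ 0)) ↔ v = p ∨ v = q := by
  by_cases h : q ^^^ p = 0
  · have : q = p := by simpa using h
    subst this
    simp [affinePts]
  · have hne : p ≠ q := by
      rintro rfl
      simp at h
    have h2 : p ^^^ (q ^^^ p) = q := by
      rw [Nat.xor_comm q, ← Nat.xor_assoc, Nat.xor_self, Nat.zero_xor]
    simp only [List.filter_cons, h, List.filter_nil, ne_eq, not_false_eq_true, decide_true, if_true,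
      affinePts, h2, Multiset.singleton_add]
    refine ⟨by simpa using hne, fun v => by simp⟩

/-- The generators of the piece with index `k`. -/
def pieceGens (a b k : ℕ) : List ℕ :=
  (pieceQ a b k ^^^ pieceP a b k) <<< (k - 1) :: (List.range (k - 1)).map (1 <<< ·)

theorem filter_shiftLeft (s : ℕ) (L : List ℕ) :
    (L.map (· <<< s)).filter (· ≠ 0) = (L.filter (· ≠ 0)).map (· <<< s) := by
  rw [List.filter_map]
  congr 1
  refine List.filter_congr fun x _ => ?_
  simp [Nat.shiftLeft_eq]

/-- A nonempty piece is an affine subspace, whose nonzero generators are independent. -/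
theorem affinePts_piece {a b k : ℕ} (hok : pieceOk a b k) :
    (affinePts (pieceP a b k <<< (k - 1)) ((pieceGens a b k).filter (· ≠ 0))).Nodup ∧
      ∀ v, v ∈ affinePts (pieceP a b k <<< (k - 1)) ((pieceGens a b k).filter (· ≠ 0)) ↔
        InPiece a b k v := by
  have hb := affinePts_bits (k - 1)
  have hp := affinePts_pair (pieceP a b k) (pieceQ a b k)
  have := affinePts_prod hb.1 (fun x hx => (hb.2 x).1 hx) hp.1
  have hperm : ((pieceGens a b k).filter (· ≠ 0)).Perm
      ((List.range (k - 1)).map (1 <<< ·) ++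
        ([pieceQ a b k ^^^ pieceP a b k].filter (· ≠ 0)).map (· <<< (k - 1))) := by
    rw [← filter_shiftLeft]
    have h1 : ((List.range (k - 1)).map (1 <<< ·)).filter (· ≠ 0) =
        (List.range (k - 1)).map (1 <<< ·) := by
      refine List.filter_eq_self.2 fun x hx => ?_
      obtain ⟨i, -, rfl⟩ := List.mem_map.1 hx
      simp [Nat.shiftLeft_eq]
    rw [pieceGens, ← List.singleton_append, List.filter_append, h1]
    exact List.perm_append_comm
  rw [Nat.zero_xor] at this
  rw [affinePts_perm hperm]
  refine ⟨this.1, fun v => ?_⟩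
  rw [this.2, hb.2, hp.2, InPiece]
  have h1 : v % 2 ^ (k - 1) < 2 ^ (k - 1) := Nat.mod_lt _ (by positivity)
  simp only [h1, hok, true_and]

theorem pieceGens_shiftLeft (a b k s : ℕ) : (pieceGens a b k).map (· <<< s) =
    (pieceQ a b k ^^^ pieceP a b k) <<< (s + (k - 1)) ::
      (List.range (k - 1)).map fun i => 1 <<< (s + i) := by
  simp [pieceGens, ← Nat.shiftLeft_add, Nat.add_comm, Function.comp_def]

/-- The affine subspace computed for the term with number `t` consists of the codes of the points
of that term. -/
theorem affinePts_term {n : ℕ} {it : ℕ → ℕ} {t : ℕ} (hit : ∀ j, it j < 2 ^ n) (i : ℕ)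
    (hok : TermOk n it t i) :
    (affinePts (termBase n it t i) ((termGens n it t i).filter (· ≠ 0))).Nodup ∧
      ∀ v, v ∈ affinePts (termBase n it t i) ((termGens n it t i).filter (· ≠ 0)) ↔
        v < 2 ^ (n * i) ∧ InTerm n it t i v := by
  induction i with
  | zero => simp [termBase, termGens, affinePts, InTerm]
  | succ i ih =>
    rw [TermOk_succ] at hok
    obtain ⟨ih1, ih2⟩ := ih hok.1
    obtain ⟨h1, h2⟩ := affinePts_piece hok.2
    have := affinePts_prod ih1 (fun x hx => ((ih2 x).1 hx).1) h1
    rw [← filter_shiftLeft, pieceGens_shiftLeft, ← List.filter_append, ← Nat.shiftLeft_add,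
      Nat.add_comm (digit n t i - 1)] at this
    refine ⟨this.1, fun v => (this.2 v).trans ?_⟩
    rw [ih2, h2]
    have h3 : v % 2 ^ (n * i) < 2 ^ (n * i) := Nat.mod_lt _ (by positivity)
    have h4 : InTerm n it t i (v % 2 ^ (n * i)) ↔ InTerm n it t i v := by
      refine forall₂_congr fun i' hi' => ?_
      have : (v % 2 ^ (n * i)) >>> (n * i') % 2 ^ n = v >>> (n * i') % 2 ^ n := by
        have h5 : n * i' + n ≤ n * i := by
          rw [← Nat.mul_succ]; exact Nat.mul_le_mul_left _ hi'
        refine Nat.eq_of_testBit_eq fun q => ?_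
        simp only [Nat.testBit_mod_two_pow, Nat.testBit_shiftRight]
        by_cases hq : q < n
        · simp [hq, show n * i' + q < n * i by omega]
        · simp [hq]
      rw [this]
    have h5 : InTerm n it t (i + 1) v ↔ InTerm n it t i v ∧
        InPiece (it (2 * i)) (it (2 * i + 1)) (digit n t i) (v >>> (n * i) % 2 ^ n) := by
      simp only [InTerm, Nat.lt_succ_iff_lt_or_eq, or_imp, forall_and, forall_eq]
    have h6 : v < 2 ^ (n * (i + 1)) ↔ v >>> (n * i) < 2 ^ n := by
      rw [Nat.shiftRight_eq_div_pow, Nat.div_lt_iff_lt_mul (by positivity), ← pow_add, Nat.mul_succ,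
        Nat.add_comm]
    rw [h4, h5, h6]
    constructor
    · rintro ⟨⟨-, h⟩, h'⟩
      have hlt : v >>> (n * i) < 2 ^ n := h'.mem.2.trans_lt (hit _)
      rw [Nat.mod_eq_of_lt hlt]
      exact ⟨hlt, h, h'⟩
    · rintro ⟨hlt, h, h'⟩
      rw [Nat.mod_eq_of_lt hlt] at h'
      exact ⟨⟨h3, h⟩, h'⟩

/-! ### Entries of the sketch -/

theorem augTo_xor (m H x y k : ℕ) :
    augTo m H (x ^^^ y) k = augTo m H x k ^^^ augTo m H y k := by
  induction k with
  | zero => simp [augTo]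
  | succ k ih =>
    simp only [augTo, Nat.testBit_xor, ih]
    cases x.testBit k <;> cases y.testBit k <;> simp
    · rw [Nat.xor_assoc]
    · rw [Nat.xor_right_comm]
    · rw [Nat.xor_assoc, Nat.xor_comm (hashCol m H k), Nat.xor_assoc, Nat.xor_self, Nat.xor_zero]

theorem aug_xor (m H x y : ℕ) : aug m H (x ^^^ y) = aug m H x ^^^ aug m H y :=
  augTo_xor m H x y m

/-- The low bits of an augmented vector are the vector itself. -/
theorem augTo_testBit_low {m H v k i : ℕ} (hi : i < m) :
    (augTo m H v k).testBit i = (decide (i < k) && v.testBit i) := by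
  induction k with
  | zero => simp [augTo]
  | succ k ih =>
    have hcol : (hashCol m H k).testBit i = decide (i = k) := by
      simp [hashCol, not_le.2 hi, Nat.one_shiftLeft, Nat.testBit_two_pow, eq_comm]
    simp only [augTo]
    by_cases hk : i = k
    · subst hk
      split_ifs with h <;> simp [hcol, ih, h]
    · have : i < k + 1 ↔ i < k := by omega
      split_ifs <;> simp [hcol, ih, hk, this]

/-- The parity of the number of positions below `k` at which both `v` and `H`, shifted by `i`, have
a bit `1`. -/
def hashBit (H i v : ℕ) : ℕ → Bool
  | 0 => false
  | k + 1 => (hashBit H i v k).xor (v.testBit k && H.testBit (k + i))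

theorem augTo_testBit_high {m H v k i : ℕ} (hi : i < m) (hk : k ≤ m) :
    (augTo m H v k).testBit (m + i) = hashBit H i v k := by
  induction k with
  | zero => simp [augTo, hashBit]
  | succ k ih =>
    have hcol : (hashCol m H k).testBit (m + i) = H.testBit (k + i) := by
      have : k ≠ m + i := by omega
      simp [hashCol, Nat.one_shiftLeft, hi, this]
    simp only [augTo, hashBit]
    split_ifs with h <;> simp [hcol, ih (by omega), h]

theorem augTo_lt {m H v k : ℕ} (hk : k ≤ m) : augTo m H v k < 2 ^ (m + m) := by
  induction k with
  | zero => simp [augTo]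
  | succ k ih =>
    have hcol : hashCol m H k < 2 ^ (m + m) :=
      Nat.xor_lt_two_pow (shiftLeft_lt (Nat.mod_lt _ (by positivity)) le_rfl)
        (by rw [Nat.one_shiftLeft]; exact Nat.pow_lt_pow_right (by norm_num) (by omega))
    simp only [augTo]
    split_ifs
    · exact Nat.xor_lt_two_pow (ih (by omega)) hcol
    · exact ih (by omega)

theorem entry_xor (m H x y : ℕ) : entry m H (x ^^^ y) = entry m H x ^^^ aug m H y := by
  rw [entry, entry, aug_xor, Nat.xor_right_comm]

theorem offset_testBit_low {m H i : ℕ} (hi : i < m) : (offset m H).testBit i = false := by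
  simp [offset, not_le.2 hi]

/-- An entry contains the code of its point. -/
theorem entry_mod {m H v : ℕ} (hv : v < 2 ^ m) : entry m H v % 2 ^ m = v := by
  refine Nat.eq_of_testBit_eq fun i => ?_
  rw [Nat.testBit_mod_two_pow, entry, Nat.testBit_xor]
  by_cases hi : i < m
  · simp [hi, aug, augTo_testBit_low hi, offset_testBit_low hi]
  · simp [hi, Nat.testBit_lt_two_pow (hv.trans_le (Nat.pow_le_pow_right (by norm_num)
      (not_lt.1 hi)))]

theorem entry_sentinel {m H : ℕ} (hH : H < 2 ^ (3 * m)) (v : ℕ) :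
    (entry m H v).testBit (m + m) = true := by
  have h1 : (aug m H v).testBit (m + m) = false := Nat.testBit_lt_two_pow (augTo_lt le_rfl)
  have h2 : H.testBit (2 * m + m) = false :=
    Nat.testBit_lt_two_pow (by convert hH using 2; omega)
  simp [entry, h1, offset, h2]

theorem entry_ne_zero {m H : ℕ} (hH : H < 2 ^ (3 * m)) (v : ℕ) : entry m H v ≠ 0 := by
  intro h
  have := entry_sentinel hH v
  simp [h] at this

/-- Membership in a range can be tested on entries. -/
theorem inBox_entry {n d H : ℕ} {it : ℕ → ℕ} {v : ℕ} (hv : v < 2 ^ (n * d)) :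
    InBox n d it (entry (n * d) H v) ↔ InBox n d it v := by
  refine forall₂_congr fun i hi => ?_
  have : (entry (n * d) H v) >>> (n * i) % 2 ^ n = v >>> (n * i) % 2 ^ n := by
    have h5 : n * i + n ≤ n * d := by
      rw [← Nat.mul_succ]; exact Nat.mul_le_mul_left _ hi
    refine Nat.eq_of_testBit_eq fun q => ?_
    simp only [Nat.testBit_mod_two_pow, Nat.testBit_shiftRight]
    by_cases hq : q < n
    · have h6 : n * i + q < n * d := by omega
      have := congrArg (fun x => x.testBit (n * i + q)) (entry_mod (H := H) hv)
      simpa [Nat.testBit_mod_two_pow, h6, hq] using this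
    · simp [hq]
  rw [this]

theorem affinePts_entry (m H b : ℕ) (G : List ℕ) :
    affinePts (entry m H b) (G.map (aug m H)) = (affinePts b G).map (entry m H) := by
  induction G generalizing b with
  | nil => simp [affinePts]
  | cons g G ih => rw [List.map_cons, affinePts, affinePts, Multiset.map_add, ih, ← entry_xor, ih]

theorem aug_eq_zero {m H g : ℕ} (hg : g < 2 ^ m) : aug m H g = 0 ↔ g = 0 := by
  constructor
  · intro h
    refine Nat.eq_of_testBit_eq fun i => ?_
    rw [Nat.zero_testBit]
    rcases lt_or_ge i m with hi | hi
    · have := congrArg (fun x => x.testBit i) h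
      simpa [aug, augTo_testBit_low hi, hi] using this
    · exact Nat.testBit_lt_two_pow (hg.trans_le (Nat.pow_le_pow_right (by norm_num) hi))
  · rintro rfl
    have := aug_xor m H 0 0
    simpa using this

theorem lt_of_mem_gens {b g r : ℕ} {G : List ℕ} (h : ∀ v ∈ affinePts b G, v < 2 ^ r)
    (hg : g ∈ G) : g < 2 ^ r := by
  have h1 : b ^^^ g ∈ affinePts b G := by
    rw [affinePts_perm (List.perm_cons_erase hg), affinePts]
    exact Multiset.mem_add.2 (Or.inr (mem_affinePts_self _ _))
  have h2 := Nat.xor_lt_two_pow (h b (mem_affinePts_self _ _)) (h _ h1)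
  rwa [← Nat.xor_assoc, Nat.xor_self, Nat.zero_xor] at h2

/-- At level `0` no constraints are imposed. -/
theorem eliminated_entry {m H b : ℕ} {G : List ℕ}
    (hlt : ∀ v ∈ affinePts b (G.filter (· ≠ 0)), v < 2 ^ m)
    (hnd : (affinePts b (G.filter (· ≠ 0))).Nodup) :
    Eliminated m ((affinePts b (G.filter (· ≠ 0))).map (entry m H)) (entry m H b)
      (G.map (aug m H)) 0 := by
  have h1 : (G.map (aug m H)).filter (· ≠ 0) = (G.filter (· ≠ 0)).map (aug m H) := by
    rw [List.filter_map]
    congr 1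
    refine List.filter_congr fun g hg => ?_
    by_cases hg0 : g = 0
    · subst hg0
      simp [(aug_eq_zero (m := m) (H := H) (g := 0) (by positivity)).2 rfl]
    · have := lt_of_mem_gens hlt (g := g) (by simp [hg, hg0])
      simp [aug_eq_zero this]
  refine ⟨fun g _ i hi => absurd hi (Nat.not_lt_zero i), ?_, ?_⟩
  · rw [h1, affinePts_entry]
    refine hnd.map_on fun x hx y hy hxy => ?_
    rw [← entry_mod (H := H) (hlt x hx), hxy, entry_mod (hlt y hy)]
  · rw [h1, affinePts_entry]

end RangeSketch

namespace RangeSketch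

open Prog

variable {n d T K : ℕ} {e : Env} {Q : M → Prop} {s : M}

/-! ### Processing an item -/

/-- `W` are the entries of the points seen before, and `E` those of the term that is inserted. -/
theorem insertTerm_spec {l₀ H : ℕ} {W : Multiset ℕ} (hC : Consts n d T K s)
    (hT : T < 2 ^ (n * d + 10)) (hH : s.reg rH = H) (hH3 : H < 2 ^ (3 * (n * d)))
    (hlev : s.reg rLev = l₀) (hlm : l₀ ≤ n * d + 1) (hl : (s.arr aG).length ≤ n * d)
    (hnd : (affinePts (s.reg rBase) ((s.arr aG).filter (· ≠ 0))).Nodup)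
    (hlt : ∀ v ∈ affinePts (s.reg rBase) ((s.arr aG).filter (· ≠ 0)), v < 2 ^ (n * d))
    {E : Multiset ℕ}
    (hE : E = (affinePts (s.reg rBase) ((s.arr aG).filter (· ≠ 0))).map (entry (n * d) H))
    (hW' : ∀ z ∈ W, z.testBit (n * d + n * d) = true)
    (hX : (s.arr aX : Multiset ℕ) = W.filter (LowZero (n * d) l₀))
    (hXT : (s.arr aX).length ≤ T) (hY : s.arr aY = [])
    (hQ : ∀ s' l, s'.reg rLev = l → l₀ ≤ l → l ≤ n * d + 1 →
      (s'.arr aX : Multiset ℕ) = (W + E).filter (LowZero (n * d) l) → s'.arr aY = [] →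
      (s'.arr aX).length ≤ T → (s'.arr aG).length ≤ n * d →
      (∀ l' < l, l₀ ≤ l' → T < ((W + E).filter (LowZero (n * d) l')).card) →
      insertTerm.Frame s s' → Q s') :
    insertTerm.wp e (lim n d T K) Q s := by
  have hE' : ∀ z ∈ E, z.testBit (n * d + n * d) = true := by
    intro z hz
    rw [hE] at hz
    obtain ⟨v, -, rfl⟩ := Multiset.mem_map.1 hz
    exact entry_sentinel hH3 v
  refine wp_frame ?_
  simp only [insertTerm, wp_seq]
  refine augAll_spec hC hH hH3 hl fun s₁ g1 g2 hF₁ => ?_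
  have hC₁ := hC.of_frame hF₁ (by decide)
  have hl₁ : (s₁.arr aG).length ≤ n * d := by rw [g1, List.length_map]; exact hl
  have hE₁ : Eliminated (n * d) E (s₁.reg rBase) (s₁.arr aG) 0 := by
    rw [g1, g2, hE]
    exact eliminated_entry hlt hnd
  refine elimLoop_spec hC₁ ((hF₁.1 _ rfl).trans hlev) hlm (by omega) hE₁ fun s₂ k1 k2 hF₂ => ?_
  have hC₂ := hC₁.of_frame hF₂ (by decide)
  have hX₂ : s₂.arr aX = s.arr aX := (hF₂.2 _ rfl).trans (hF₁.2 _ rfl)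
  have hY₂ : s₂.arr aY = [] := (hF₂.2 _ rfl).trans ((hF₁.2 _ rfl).trans hY)
  refine raiseLoop_spec (l₀ := l₀) (W := W) (E := E) hC₂ hT
    ((hF₂.1 _ rfl).trans ((hF₁.1 _ rfl).trans hlev)) hlm (by omega) k1 hW' hE' (by rwa [hX₂])
    (by rwa [hX₂]) hY₂ fun s₃ l j1 j2 j3 j4 j5 j6 j7 j8 j9 hF₃ => ?_
  have hC₃ := hC₂.of_frame hF₃ (by decide)
  have hsplit : ∀ l, ((W + E).filter (LowZero (n * d) l)).card = levelCard (n * d) W E l :=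
    fun l => by rw [levelCard, Multiset.filter_add, Multiset.card_add]
  have hE₃ := j4.filter_eq
  have hspan := coe_spanList (l := [s₃.reg rBase]) (L := []) (b := s₃.reg rBase) (s₃.arr aG) rfl
  rw [List.nil_append] at hspan
  have hnew : ((s₃.arr aX ++ if LowZero (n * d) l (s₃.reg rBase) then
      spanList [s₃.reg rBase] (s₃.arr aG) else [] : List ℕ) : Multiset ℕ) =
      (W + E).filter (LowZero (n * d) l) := by
    rw [← Multiset.coe_add, j6, Multiset.filter_add, hE₃]
    congr 1
    split_ifs
    · exact hspan
    · rfl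
  have hcard := congrArg Multiset.card hnew
  rw [hsplit, Multiset.coe_card, List.length_append] at hcard
  refine enumerate_spec (l := l) hC₃ hT j1 j3 (by omega) ?_ fun s₄ i1 hF₄ hF => ?_
  · split_ifs at hcard ⊢ <;> simp_all
  · refine hQ s₄ l ((hF₄.1 _ rfl).trans j1) j2 j3 (by rw [i1, hnew]) ((hF₄.2 _ rfl).trans j7) ?_ ?_
      (fun l' h1 h2 => by rw [hsplit]; exact j9 l' h1 h2) hF
    · rw [i1, List.length_append, hcard]
      exact j8
    · rw [hF₄.2 _ rfl]; omega

instance (a b k x : ℕ) : Decidable (InPiece a b k x) := by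
  unfold InPiece; infer_instance

instance (n : ℕ) (it : ℕ → ℕ) (t i v : ℕ) : Decidable (InTerm n it t i v) := by
  unfold InTerm; infer_instance

/-- The codes of the points of a range. -/
def boxSet (n d : ℕ) (it : ℕ → ℕ) : Finset ℕ := (Finset.range (2 ^ (n * d))).filter (InBox n d it)

/-- The codes of the points of a term. -/
def termSet (n d : ℕ) (it : ℕ → ℕ) (t : ℕ) : Finset ℕ :=
  (Finset.range (2 ^ (n * d))).filter (InTerm n it t d)

/-- What the sample represents after the first `t` terms of an item have been inserted: the earlier
points outside of the item, and the points of these terms. -/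
def partialSet (n d : ℕ) (it : ℕ → ℕ) (U : Finset ℕ) (t : ℕ) : Finset ℕ :=
  U.filter (fun v => ¬InBox n d it v) ∪
    (Finset.range (2 ^ (n * d))).filter (fun v => ∃ t' < t, InTerm n it t' d v)

theorem partialSet_zero {it : ℕ → ℕ} {U : Finset ℕ} :
    partialSet n d it U 0 = U.filter (fun v => ¬InBox n d it v) := by
  simp [partialSet]

theorem partialSet_last {it : ℕ → ℕ} {U : Finset ℕ} (hn : 1 ≤ n) (hit : ∀ j, it j < 2 ^ n)
    (hU : U ⊆ Finset.range (2 ^ (n * d))) :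
    partialSet n d it U (n ^ d) = U ∪ boxSet n d it := by
  ext v
  simp only [partialSet, boxSet, Finset.mem_union, Finset.mem_filter, Finset.mem_range]
  constructor
  · rintro (h | ⟨h, t, ht, h'⟩)
    · exact Or.inl h.1
    · exact Or.inr ⟨h, h'.inBox⟩
  · intro h
    have hv : v < 2 ^ (n * d) := by
      rcases h with h | h
      · exact Finset.mem_range.1 (hU h)
      · exact h.1
    by_cases hb : InBox n d it v
    · obtain ⟨t, ht, h'⟩ := exists_inTerm hn hit hb
      exact Or.inr ⟨hv, t, ht, h'⟩
    · rcases h with h | h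
      · exact Or.inl ⟨h, hb⟩
      · exact absurd h.2 hb

theorem partialSet_subset {it : ℕ → ℕ} {U : Finset ℕ} (t : ℕ) :
    partialSet n d it U t ⊆ U ∪ boxSet n d it := by
  intro v
  simp only [partialSet, boxSet, Finset.mem_union, Finset.mem_filter, Finset.mem_range]
  rintro (h | ⟨h, t, ht, h'⟩)
  · exact Or.inl h.1
  · exact Or.inr ⟨h, h'.inBox⟩

theorem partialSet_succ_val {it : ℕ → ℕ} {U : Finset ℕ} {t : ℕ} (ht : t < n ^ d) :
    (partialSet n d it U (t + 1)).val = (partialSet n d it U t).val + (termSet n d it t).val := by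
  have hdis : Disjoint (partialSet n d it U t) (termSet n d it t) := by
    rw [Finset.disjoint_left]
    intro v
    simp only [partialSet, termSet, Finset.mem_union, Finset.mem_filter, Finset.mem_range]
    rintro (h | ⟨h, t', ht', h'⟩) ⟨-, h2⟩
    · exact h.2 h2.inBox
    · exact ht'.ne (h'.unique (ht'.trans ht) ht h2)
  rw [← Finset.disjUnion_val _ _ hdis]
  congr 1
  ext v
  simp only [partialSet, termSet, Finset.mem_disjUnion, Finset.mem_union, Finset.mem_filter,
    Finset.mem_range, Nat.lt_succ_iff_lt_or_eq, or_and_right, exists_or, exists_eq_left]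
  rw [and_or_left, or_assoc]

/-- The entries of the points of `U` that survive at level `l`. -/
def survivors (m H : ℕ) (U : Finset ℕ) (l : ℕ) : Multiset ℕ :=
  (U.val.map (entry m H)).filter (LowZero m l)

theorem survivors_card_mono {m H l : ℕ} {U V : Finset ℕ} (h : U ⊆ V) :
    (survivors m H U l).card ≤ (survivors m H V l).card :=
  Multiset.card_le_card (Multiset.filter_le_filter _ (Multiset.map_le_map (Finset.val_le_iff.2 h)))

/-- `X` is the sample of the set `U` at level `l`, and the set `V` is too large for all smaller
levels. -/
structure Sample (m T H : ℕ) (U V : Finset ℕ) (l : ℕ) (X : List ℕ) : Prop where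
  eq : (X : Multiset ℕ) = survivors m H U l
  le : l ≤ m + 1
  len : X.length ≤ T
  least : ∀ l' < l, T < (survivors m H V l').card

/-- The sample after points with entries `E` have been inserted. -/
theorem Sample.step {m H l l' : ℕ} {U U' V : Finset ℕ} {X X' : List ℕ} {E : Multiset ℕ}
    (h : Sample m T H U V l X) (hU' : U'.val.map (entry m H) = U.val.map (entry m H) + E)
    (hV : U' ⊆ V)
    (hX' : (X' : Multiset ℕ) = (U.val.map (entry m H) + E).filter (LowZero m l'))
    (hl' : l' ≤ m + 1) (hlen : X'.length ≤ T)
    (hleast : ∀ k < l', l ≤ k → T < ((U.val.map (entry m H) + E).filter (LowZero m k)).card) :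
    Sample m T H U' V l' X' := by
  refine ⟨by rw [hX', survivors, hU'], hl', hlen, fun k hk => ?_⟩
  rcases lt_or_ge k l with hkl | hkl
  · exact h.least k hkl
  · have := hleast k hk hkl
    rw [← hU'] at this
    exact this.trans_le (survivors_card_mono hV)

theorem termBody_spec {t H l₀ : ℕ} {U : Finset ℕ} (hn : 1 ≤ n) (he : ∀ j, e.item j < 2 ^ n)
    (hC : Consts n d T K s) (hT : T < 2 ^ (n * d + 10)) (hH : s.reg rH = H)
    (hH3 : H < 2 ^ (3 * (n * d))) (ht : s.reg rTerm = t) (htn : t < n ^ d)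
    (hlev : s.reg rLev = l₀) (hG : s.arr aG = []) (hY : s.arr aY = [])
    (hS : Sample (n * d) T H (partialSet n d e.item U t) (U ∪ boxSet n d e.item) l₀ (s.arr aX))
    (hQ : ∀ s', Sample (n * d) T H (partialSet n d e.item U (t + 1)) (U ∪ boxSet n d e.item)
        (s'.reg rLev) (s'.arr aX) → s'.arr aG = [] → s'.arr aY = [] →
        termBody.Frame s s' → Q s') :
    termBody.wp e (lim n d T K) Q s := by
  refine wp_frame ?_
  simp only [wp_seq, wp_op, wp_load, wp_store, wp_push, wp_pop, wp_length, wp_input, wp_ite,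
    wp_skip, mov, Operand.get_reg, Operand.get_const, Mem.setReg_reg, Mem.setReg_arr,
    Mem.setArr_reg, Mem.setArr_arr, Fin.reduceEq, if_true, if_false, BinOp.eval, BinOp.grows,
    Bool.false_eq_true, false_imp_iff, true_and, true_imp_iff, termBody]
  refine coordLoop_spec (t := t) hn he ?_ (by simp [ht]) (by simp) (by simp) (by simp [hG])
    fun s₁ g1 g2 g3 hF₁ => ?_
  · constructor <;> simp [hC.hN, hC.hD, hC.hM, hC.hPw, hC.hPn, hC.hK, hC.hT, hC.hTm, hC.hMs]
  have hC₁ : Consts n d T K s₁ := by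
    refine Consts.of_frame ?_ hF₁ (by decide)
    constructor <;> simp [hC.hN, hC.hD, hC.hM, hC.hPw, hC.hPn, hC.hK, hC.hT, hC.hTm, hC.hMs]
  have hX₁ : s₁.arr aX = s.arr aX := (hF₁.2 _ rfl).trans (by simp)
  have hY₁ : s₁.arr aY = [] := (hF₁.2 _ rfl).trans (by simp [hY])
  have hL₁ : s₁.reg rLev = l₀ := (hF₁.1 _ rfl).trans (by simp [hlev])
  have hH₁ : s₁.reg rH = H := (hF₁.1 _ rfl).trans (by simp [hH])
  have hlen : (s₁.arr aG).length ≤ n * d := by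
    rw [g3]; exact termGens_length_le hn _ _ _
  have hval := partialSet_succ_val (it := e.item) (U := U) htn
  have hsub := partialSet_subset (n := n) (d := d) (it := e.item) (U := U) (t + 1)
  refine ⟨fun hok => ?_, fun hok => ?_⟩
  · rw [Operand.get_reg] at hok
    have hok' : TermOk n e.item t d := by
      by_contra hh
      exact hok (by rw [g1, if_neg hh])
    obtain ⟨hnd, hmem⟩ := affinePts_term he d hok'
    rw [← g2, ← g3] at hnd hmem
    have hterm : affinePts (s₁.reg rBase) ((s₁.arr aG).filter (· ≠ 0)) =
        (termSet n d e.item t).val := by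
      rw [Multiset.Nodup.ext hnd (termSet n d e.item t).nodup]
      intro v
      rw [hmem, Finset.mem_val, termSet, Finset.mem_filter, Finset.mem_range]
    refine insertTerm_spec (l₀ := l₀) (H := H)
      (W := (partialSet n d e.item U t).val.map (entry (n * d) H)) hC₁ hT hH₁ hH3 hL₁ hS.le hlen
      hnd (fun v hv => ((hmem v).1 hv).1) rfl ?_ (by rw [hX₁]; exact hS.eq)
      (by rw [hX₁]; exact hS.len) hY₁ fun s₂ l k1 k2 k3 k4 k5 k6 k7 k8 hF₂ => ?_
    · intro z hz
      obtain ⟨v, -, rfl⟩ := Multiset.mem_map.1 hz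
      exact entry_sentinel hH3 v
    refine clearArr_spec (by simpa [bnd] using k7.trans (Nat.le_succ _)) fun s₃ j1 hF₃ hF => ?_
    have hX₃ : s₃.arr aX = s₂.arr aX := hF₃.2 _ rfl
    have hL₃ : s₃.reg rLev = l := (hF₃.1 _ rfl).trans k1
    refine hQ s₃ ?_ j1 ((hF₃.2 _ rfl).trans k5) hF
    rw [hX₃, hL₃]
    refine hS.step (E := (affinePts (s₁.reg rBase) ((s₁.arr aG).filter (· ≠ 0))).map
      (entry (n * d) H)) ?_ hsub k4 k3 k6 k8
    rw [hval, Multiset.map_add, hterm]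
  · rw [Operand.get_reg] at hok
    have hok' : ¬TermOk n e.item t d := by
      intro hh
      rw [g1, if_pos hh] at hok
      exact one_ne_zero hok
    have hempty : termSet n d e.item t = ∅ := by
      refine Finset.filter_eq_empty_iff.2 fun v _ hv => hok' fun i hi => (hv i hi).1
    refine clearArr_spec (by simpa [bnd] using hlen.trans (Nat.le_succ _)) fun s₃ j1 hF₃ hF => ?_
    have hX₃ : s₃.arr aX = s.arr aX := (hF₃.2 _ rfl).trans hX₁
    have hL₃ : s₃.reg rLev = l₀ := (hF₃.1 _ rfl).trans hL₁
    refine hQ s₃ ?_ j1 ((hF₃.2 _ rfl).trans hY₁) hF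
    rw [hX₃, hL₃]
    have : partialSet n d e.item U (t + 1) = partialSet n d e.item U t := by
      refine Finset.val_injective ?_
      rw [hval, hempty]
      simp
    rw [this]
    exact hS

theorem termLoop_spec {H : ℕ} {U : Finset ℕ} (hn : 1 ≤ n) (he : ∀ j, e.item j < 2 ^ n)
    (hC : Consts n d T K s) (hT : T < 2 ^ (n * d + 10)) (hH : s.reg rH = H)
    (hH3 : H < 2 ^ (3 * (n * d))) (hU : U ⊆ Finset.range (2 ^ (n * d)))
    (hG : s.arr aG = []) (hY : s.arr aY = [])
    (hS : Sample (n * d) T H (U.filter fun v => ¬InBox n d e.item v) (U ∪ boxSet n d e.item)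
      (s.reg rLev) (s.arr aX))
    (hQ : ∀ s', Sample (n * d) T H (U ∪ boxSet n d e.item) (U ∪ boxSet n d e.item)
        (s'.reg rLev) (s'.arr aX) → s'.arr aG = [] → s'.arr aY = [] →
        termLoop.Frame s s' → Q s') :
    termLoop.wp e (lim n d T K) Q s := by
  refine wp_loop (fun t s' => Sample (n * d) T H (partialSet n d e.item U t)
    (U ∪ boxSet n d e.item) (s'.reg rLev) (s'.arr aX) ∧ s'.arr aG = [] ∧ s'.arr aY = [])
    ?_ ?_ ?_ ?_
  · simp [hC.hTm, bnd]
  · rw [partialSet_zero]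
    exact ⟨hS, hG, hY⟩
  · rintro t s' ht ⟨h1, h2, h3⟩ hF
    rw [Operand.get_reg, hC.hTm] at ht
    have hC' := hC.of_frame hF (by decide)
    have hH' : s'.reg rH = H := (hF.1 _ rfl).trans hH
    refine termBody_spec (t := t) (l₀ := s'.reg rLev) hn he ?_ hT (by simp [hH']) hH3 (by simp) ht
      (by simp) (by simp [h2]) (by simp [h3]) (by simpa using h1)
      fun s'' g1 g2 g3 _ => ⟨g1, g2, g3⟩
    constructor <;> simp [hC'.hN, hC'.hD, hC'.hM, hC'.hPw, hC'.hPn, hC'.hK, hC'.hT, hC'.hTm,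
      hC'.hMs]
  · rintro s' ⟨h1, h2, h3⟩ hF
    rw [Operand.get_reg, hC.hTm, partialSet_last hn he hU] at h1
    exact hQ s' h1 h2 h3 hF

theorem getD_set (l : List ℕ) (i j v : ℕ) (hi : i < l.length) :
    (l.set i v).getD j 0 = if j = i then v else l.getD j 0 := by
  simp only [List.getD_eq_getElem?_getD, List.getElem?_set]
  split_ifs with h1 h2 h2
  · rfl
  · exact absurd h1.symm h2
  · exact absurd h2.symm h1
  · rfl

theorem storeLoop_spec {o : ℕ} (hC : Consts n d T K s) (ho : s.reg rOff = o)
    (hlen : o + T ≤ (s.arr aBig).length) (hoT : o + T < 2 ^ (3 * (n * d) + 12))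
    (hQ : ∀ s', (s'.arr aBig).length = (s.arr aBig).length →
      (∀ i, (s'.arr aBig).getD i 0 = if o ≤ i ∧ i < o + T then (s.arr aX).getD (i - o) 0
        else (s.arr aBig).getD i 0) → storeLoop.Frame s s' → Q s') :
    storeLoop.wp e (lim n d T K) Q s := by
  refine wp_loop (fun j s' => (s'.arr aBig).length = (s.arr aBig).length ∧
      (∀ i, (s'.arr aBig).getD i 0 = if o ≤ i ∧ i < o + j then (s.arr aX).getD (i - o) 0
        else (s.arr aBig).getD i 0)) ?_ ?_ ?_ ?_
  · simp [hC.hT, bnd]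
  · refine ⟨rfl, fun i => ?_⟩
    rw [if_neg (by omega)]
  · rintro j s' hj ⟨h1, h2⟩ hF
    rw [Operand.get_reg, hC.hT] at hj
    have hO : s'.reg rOff = o := (hF.1 _ rfl).trans ho
    have hX : s'.arr aX = s.arr aX := hF.2 _ rfl
    simp only [wp_seq, wp_op, wp_load, wp_store, wp_push, wp_pop, wp_length, wp_input, wp_ite,
      wp_skip, mov, Operand.get_reg, Operand.get_const, Mem.setReg_reg, Mem.setReg_arr,
      Mem.setArr_reg, Mem.setArr_arr, Fin.reduceEq, if_true, if_false, BinOp.eval, BinOp.grows,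
      Bool.false_eq_true, false_imp_iff, true_and, true_imp_iff, hO, hX, lim_val]
    refine ⟨by omega, by rw [List.length_set, h1], fun i => ?_⟩
    rw [getD_set _ _ _ _ (by omega), h2]
    by_cases hij : i = o + j
    · subst hij
      simp
    · rw [if_neg hij]
      have : (o ≤ i ∧ i < o + (j + 1)) ↔ (o ≤ i ∧ i < o + j) := by omega
      simp only [this]
  · rintro s' ⟨h1, h2⟩ hF
    rw [Operand.get_reg, hC.hT] at h2
    exact hQ s' h1 h2 hF

/-- A list without zeros is recovered from the block it has been stored in. -/
theorem blockOf_eq_self {X l : List ℕ} {o : ℕ} (hX : X.length ≤ T) (h0 : 0 ∉ X)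
    (h : ∀ j < T, l.getD (o + j) 0 = X.getD j 0) : blockOf T l o = X := by
  have h1 : (List.range T).map (fun j => l.getD (o + j) 0) =
      X ++ List.replicate (T - X.length) 0 := by
    refine List.ext_getElem (by simp; omega) fun i hi hi' => ?_
    simp only [List.length_map, List.length_range] at hi
    rw [List.getElem_map, List.getElem_range, h i hi, List.getElem_append]
    split_ifs with hiX
    · rw [List.getD_eq_getElem _ _ hiX]
    · rw [List.getElem_replicate, List.getD_eq_default _ _ (by omega)]
  rw [blockOf, h1, List.filter_append,
    List.filter_eq_self.2 fun x hx => by simpa using fun hx0 : x = 0 => h0 (hx0 ▸ hx)]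
  simp

/-- The state of the memory between two items. Copy `c` of the sketch, with key `keys[c]`,
represents the set `Us c`. -/
structure Inv (n d T K : ℕ) (keys : List ℕ) (Us : ℕ → Finset ℕ) (s : M) : Prop where
  consts : Consts n d T K s
  hKeys : s.arr aH = keys
  keysLen : keys.length = K
  levLen : (s.arr aLev).length = K
  bigLen : (s.arr aBig).length = K * T
  hG : s.arr aG = []
  hX : s.arr aX = []
  hY : s.arr aY = []
  hE : s.arr aE = []
  sample : ∀ c < K, Sample (n * d) T (keys.getD c 0) (Us c) (Us c) ((s.arr aLev).getD c 0)
    (blockOf T (s.arr aBig) (c * T))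

/-- Dropping the stored points that lie in a range gives the sample of the points outside of it. -/
theorem survivors_filter_inBox {H l : ℕ} {it : ℕ → ℕ} {U : Finset ℕ}
    (hU : U ⊆ Finset.range (2 ^ (n * d))) :
    (survivors (n * d) H U l).filter (fun z => ¬InBox n d it z) =
      survivors (n * d) H (U.filter fun v => ¬InBox n d it v) l := by
  simp only [survivors, Finset.filter_val, Multiset.filter_map, Multiset.filter_filter]
  congr 1
  refine Multiset.filter_congr fun v hv => ?_
  have := inBox_entry (H := H) (it := it) (Finset.mem_range.1 (hU hv))
  simp only [Function.comp, this]
  tauto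

/-- Processing an item in copy `c` adds its points to the set represented by this copy. -/
theorem copyBody_spec {c : ℕ} {keys : List ℕ} {Us : ℕ → Finset ℕ} (hn : 1 ≤ n)
    (he : ∀ j, e.item j < 2 ^ n) (hT : T < 2 ^ (n * d + 10)) (hKT : K * T < 2 ^ (n * d + 10))
    (hkeys : ∀ h ∈ keys, h < 2 ^ (3 * (n * d))) (hI : Inv n d T K keys Us s)
    (hc : s.reg rC = c) (hcK : c < K) (hU : Us c ⊆ Finset.range (2 ^ (n * d)))
    (hQ : ∀ s', Inv n d T K keys (fun c' => if c' = c then Us c ∪ boxSet n d e.item else Us c') s' →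
      copyBody.Frame s s' → Q s') :
    copyBody.wp e (lim n d T K) Q s := by
  have hC := hI.consts
  have hcT : c * T + T ≤ K * T := by
    rw [← Nat.succ_mul]; exact Nat.mul_le_mul_right _ hcK
  have hKT' : K * T < 2 ^ (3 * (n * d) + 12) := pow_le_lim hKT (by omega)
  have hkey : keys.getD c 0 < 2 ^ (3 * (n * d)) := by
    have : c < keys.length := by rw [hI.keysLen]; exact hcK
    rw [List.getD_eq_getElem _ _ this]
    exact hkeys _ (List.getElem_mem _)
  have hS := hI.sample c hcK
  set H := keys.getD c 0 with hH
  set l₀ := (s.arr aLev).getD c 0 with hl₀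
  refine wp_frame ?_
  simp only [wp_seq, wp_op, wp_load, wp_store, wp_push, wp_pop, wp_length, wp_input, wp_ite,
    wp_skip, mov, Operand.get_reg, Operand.get_const, Mem.setReg_reg, Mem.setReg_arr,
    Mem.setArr_reg, Mem.setArr_arr, Fin.reduceEq, if_true, if_false, BinOp.eval, BinOp.grows,
    Bool.false_eq_true, false_imp_iff, true_and, true_imp_iff, copyBody, hc, hC.hT, hI.hKeys,
    lim_val, ← hH, ← hl₀]
  refine ⟨by omega, ?_⟩
  refine loadLoop_spec hn ?_ (by simp [hI.hX]) (by simp; omega) fun s₁ g1 hF₁ => ?_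
  · constructor <;> simp [hC.hN, hC.hD, hC.hM, hC.hPw, hC.hPn, hC.hK, hC.hT, hC.hTm, hC.hMs]
  have hC₁ : Consts n d T K s₁ := by
    refine Consts.of_frame ?_ hF₁ (by decide)
    constructor <;> simp [hC.hN, hC.hD, hC.hM, hC.hPw, hC.hPn, hC.hK, hC.hT, hC.hTm, hC.hMs]
  have hH₁ : s₁.reg rH = H := (hF₁.1 _ rfl).trans (by simp)
  have hL₁ : s₁.reg rLev = l₀ := (hF₁.1 _ rfl).trans (by simp)
  have hO₁ : s₁.reg rOff = c * T := (hF₁.1 _ rfl).trans (by simp)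
  have hc₁ : s₁.reg rC = c := (hF₁.1 _ rfl).trans (by simp [hc])
  simp only [wp_seq, wp_op, wp_load, wp_store, wp_push, wp_pop, wp_length, wp_input, wp_ite,
    wp_skip, mov, Operand.get_reg, Operand.get_const, Mem.setReg_reg, Mem.setReg_arr,
    Mem.setArr_reg, Mem.setArr_arr, Fin.reduceEq, if_true, if_false, BinOp.eval, BinOp.grows,
    Bool.false_eq_true, false_imp_iff, true_and, true_imp_iff] at g1
  refine termLoop_spec (H := H) (U := Us c) hn he hC₁ hT hH₁ hkey hU
    ((hF₁.2 _ rfl).trans (by simp [hI.hG])) ((hF₁.2 _ rfl).trans (by simp [hI.hY])) ?_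
    fun s₂ k1 k2 k3 hF₂ => ?_
  · rw [g1, hL₁]
    refine ⟨?_, hS.le, (List.length_filter_le _ _).trans hS.len, fun l' hl' =>
      (hS.least l' hl').trans_le (survivors_card_mono Finset.subset_union_left)⟩
    rw [← survivors_filter_inBox hU, ← hS.eq, Multiset.filter_coe]
  have hO₂ : s₂.reg rOff = c * T := (hF₂.1 _ rfl).trans hO₁
  have hc₂ : s₂.reg rC = c := (hF₂.1 _ rfl).trans hc₁
  have hB₂ : s₂.arr aBig = s.arr aBig := (hF₂.2 _ rfl).trans ((hF₁.2 _ rfl).trans (by simp))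
  have hLev₂ : s₂.arr aLev = s.arr aLev := (hF₂.2 _ rfl).trans ((hF₁.2 _ rfl).trans (by simp))
  have hC₂ := hC₁.of_frame hF₂ (by decide)
  simp only [wp_seq, wp_op, wp_load, wp_store, wp_push, wp_pop, wp_length, wp_input, wp_ite,
    wp_skip, mov, Operand.get_reg, Operand.get_const, Mem.setReg_reg, Mem.setReg_arr,
    Mem.setArr_reg, Mem.setArr_arr, Fin.reduceEq, if_true, if_false, BinOp.eval, BinOp.grows,
    Bool.false_eq_true, false_imp_iff, true_and, true_imp_iff]
  refine storeLoop_spec (o := c * T) ?_ (by simp [hO₂]) (by simp [hB₂, hI.bigLen, hcT]) (by omega)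
    fun s₃ j1 j2 hF₃ => ?_
  · constructor <;> simp [hC₂.hN, hC₂.hD, hC₂.hM, hC₂.hPw, hC₂.hPn, hC₂.hK, hC₂.hT, hC₂.hTm,
      hC₂.hMs]
  have hC₃ : Consts n d T K s₃ := by
    refine Consts.of_frame ?_ hF₃ (by decide)
    constructor <;> simp [hC₂.hN, hC₂.hD, hC₂.hM, hC₂.hPw, hC₂.hPn, hC₂.hK, hC₂.hT, hC₂.hTm,
      hC₂.hMs]
  simp only [wp_seq, wp_op, wp_load, wp_store, wp_push, wp_pop, wp_length, wp_input, wp_ite,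
    wp_skip, mov, Operand.get_reg, Operand.get_const, Mem.setReg_reg, Mem.setReg_arr,
    Mem.setArr_reg, Mem.setArr_arr, Fin.reduceEq, if_true, if_false, BinOp.eval, BinOp.grows,
    Bool.false_eq_true, false_imp_iff, true_and, true_imp_iff, hB₂] at j1 j2
  have hX₃ : s₃.arr aX = s₂.arr aX := (hF₃.2 _ rfl).trans (by simp)
  refine clearArr_spec (by simpa [hX₃, bnd] using k1.len) fun s₄ i1 hF₄ hF => ?_
  have hB₄ : s₄.arr aBig = s₃.arr aBig := hF₄.2 _ rfl
  have hLev₄ : s₄.arr aLev = (s.arr aLev).set c (s₂.reg rLev) := by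
    rw [hF₄.2 _ rfl, hF₃.2 _ rfl]
    simp [hLev₂, hc₂]
  refine hQ s₄ ⟨hC₃.of_frame hF₄ (by decide), (hF.2 _ rfl).trans hI.hKeys, hI.keysLen, ?_, ?_, ?_,
    i1, ?_, (hF.2 _ rfl).trans hI.hE, ?_⟩ hF
  · rw [hLev₄, List.length_set, hI.levLen]
  · rw [hB₄, j1, hI.bigLen]
  · rw [hF₄.2 _ rfl, hF₃.2 _ rfl]; simpa using k2
  · rw [hF₄.2 _ rfl, hF₃.2 _ rfl]; simpa using k3
  · intro c' hc'
    rw [hLev₄, hB₄, getD_set _ _ _ _ (by rw [hI.levLen]; exact hcK)]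
    by_cases hcc : c' = c
    · subst hcc
      simp only [if_true]
      rw [blockOf_eq_self (X := s₂.arr aX) k1.len ?_ ?_]
      · exact k1
      · intro h0
        have : (0 : ℕ) ∈ (s₂.arr aX : Multiset ℕ) := h0
        rw [k1.eq, survivors] at this
        obtain ⟨v, -, hv⟩ := Multiset.mem_map.1 (Multiset.mem_of_mem_filter this)
        exact entry_ne_zero hkey v hv
      · intro j hj
        rw [j2, if_pos (by omega), Nat.add_sub_cancel_left]
    · simp only [hcc, if_false]
      have : blockOf T (s₃.arr aBig) (c' * T) = blockOf T (s.arr aBig) (c' * T) := by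
        rw [blockOf, blockOf]
        congr 1
        refine List.map_congr_left fun j hj => ?_
        rw [j2, if_neg]
        rw [List.mem_range] at hj
        rintro ⟨h1, h2⟩
        rcases Nat.lt_or_gt_of_ne hcc with h | h
        · have : c' * T + T ≤ c * T := by
            rw [← Nat.succ_mul]; exact Nat.mul_le_mul_right _ h
          omega
        · have : c * T + T ≤ c' * T := by
            rw [← Nat.succ_mul]; exact Nat.mul_le_mul_right _ h
          omega
      rw [this]
      exact hI.sample c' hc'

theorem Inv.congr {keys : List ℕ} {Us Us' : ℕ → Finset ℕ} (h : Inv n d T K keys Us s)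
    (hU : ∀ c < K, Us c = Us' c) : Inv n d T K keys Us' s :=
  { h with sample := fun c hc => hU c hc ▸ h.sample c hc }

/-- Processing an item adds its points to the set represented by all copies. -/
theorem updateProg_spec {keys : List ℕ} {U : Finset ℕ} (hn : 1 ≤ n)
    (he : ∀ j, e.item j < 2 ^ n) (hT : T < 2 ^ (n * d + 10)) (hKT : K * T < 2 ^ (n * d + 10))
    (hkeys : ∀ h ∈ keys, h < 2 ^ (3 * (n * d))) (hI : Inv n d T K keys (fun _ => U) s)
    (hU : U ⊆ Finset.range (2 ^ (n * d)))
    (hQ : ∀ s', Inv n d T K keys (fun _ => U ∪ boxSet n d e.item) s' → Q s') :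
    updateProg.wp e (lim n d T K) Q s := by
  refine wp_loop (fun i s' => Inv n d T K keys
    (fun c => if c < i then U ∪ boxSet n d e.item else U) s') ?_ ?_ ?_ ?_
  · simp [hI.consts.hK, bnd]
  · simpa using hI
  · intro i s' hi h hF
    rw [Operand.get_reg, hI.consts.hK] at hi
    have h' : Inv n d T K keys (fun c => if c < i then U ∪ boxSet n d e.item else U)
        (s'.setReg rC i) := by
      have hC := h.consts
      refine { h with consts := ?_ }
      constructor <;> simp [hC.hN, hC.hD, hC.hM, hC.hPw, hC.hPn, hC.hK, hC.hT, hC.hTm, hC.hMs]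
    refine copyBody_spec (c := i) hn he hT hKT hkeys h' (by simp) hi (by simpa using hU)
      fun s'' g1 _ => g1.congr fun c hc => ?_
    by_cases hci : c = i
    · simp [hci]
    · have : c < i + 1 ↔ c < i := by omega
      simp [hci, this]
  · intro s' h hF
    rw [Operand.get_reg, hI.consts.hK] at h
    exact hQ s' (h.congr fun c hc => if_pos hc)

end RangeSketch

namespace RangeSketch

open Prog

variable {n d T K : ℕ}

/-! ### Cost and space of the update program -/

theorem coordLoop_ticks (hn : 1 ≤ n) (hd : 1 ≤ d) :
    coordLoop.ticks (bnd n d T K) ≤ 100 * (n * d) := by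
  simp only [bnd, Fin.reduceEq, if_true, if_false, or_false, mov, coordLoop, coordBody,
    selectPiece, bitsLoop, ticks]
  have hdm : d ≤ n * d := Nat.le_mul_of_pos_left _ hn
  nlinarith

theorem augAll_ticks : augAll.ticks (bnd n d T K) ≤ 40 * ((n * d + 1) * (n * d + 1)) := by
  simp only [bnd, Fin.reduceEq, if_true, if_false, or_false, mov, augAll, augLoop, augInner, ticks]
  generalize n * d = m
  ring_nf
  omega

theorem eliminate_ticks : eliminate.ticks (bnd n d T K) ≤ 40 * (n * d + 1) := by
  simp only [bnd, Fin.reduceEq, if_false, or_false, mov, eliminate, findPivot,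
    applyPivot, ticks]
  omega

theorem elimLoop_ticks :
    elimLoop.ticks (bnd n d T K) ≤ 50 * ((n * d + 1) * (n * d + 1)) := by
  have h := eliminate_ticks (n := n) (d := d) (T := T) (K := K)
  simp only [bnd, Fin.reduceEq, if_false, or_false, elimLoop, ticks]
  generalize eliminate.ticks _ = t at *
  generalize hm : n * d + 1 = m at *
  have h1 := Nat.mul_le_mul_left m h
  have hm1 : 1 ≤ m := by omega
  have h2 : m ≤ m * m := Nat.le_mul_of_pos_left _ hm1
  linarith

theorem raiseLoop_ticks :
    raiseLoop.ticks (bnd n d T K) ≤ 100 * ((n * d + 1) * (n * d + 1 + T)) := by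
  have h := eliminate_ticks (n := n) (d := d) (T := T) (K := K)
  simp only [bnd, Fin.reduceEq, if_true, if_false, or_false, or_true, raiseLoop, purge,
    moveLoop, computeSize, ticks]
  generalize eliminate.ticks _ = t at *
  generalize hm : n * d + 1 = m at *
  have h1 := Nat.mul_le_mul_left m h
  have hm1 : 1 ≤ m := by omega
  have h2 : m ≤ m * m := Nat.le_mul_of_pos_left _ hm1
  have h3 := Nat.zero_le (m * T)
  linarith

theorem enumerate_ticks :
    enumerate.ticks (bnd n d T K) ≤ 12 + 12 * ((n * d + 1) * (1 + T)) := by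
  simp only [bnd, Fin.reduceEq, if_true, if_false, or_false, or_true, enumerate, spanInner, ticks]
  have h1 := Nat.zero_le (n * d * T)
  have h2 := Nat.zero_le (n * d)
  linarith

theorem termBody_ticks (hn : 1 ≤ n) (hd : 1 ≤ d) (hT : 1 ≤ T) :
    termBody.ticks (bnd n d T K) ≤ 2000 * ((n * d) * (n * d) * T) := by
  have h1 := coordLoop_ticks (n := n) (d := d) (T := T) (K := K) hn hd
  have h2 := augAll_ticks (n := n) (d := d) (T := T) (K := K)
  have h3 := elimLoop_ticks (n := n) (d := d) (T := T) (K := K)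
  have h4 := raiseLoop_ticks (n := n) (d := d) (T := T) (K := K)
  have h5 := enumerate_ticks (n := n) (d := d) (T := T) (K := K)
  simp only [bnd, Fin.reduceEq, if_false, or_false, mov, termBody, insertTerm, clearArr, ticks]
  have hm : 1 ≤ n * d := Nat.mul_pos hn hd
  generalize coordLoop.ticks _ = t1 at *
  generalize augAll.ticks _ = t2 at *
  generalize elimLoop.ticks _ = t3 at *
  generalize raiseLoop.ticks _ = t4 at *
  generalize enumerate.ticks _ = t5 at *
  generalize n * d = m at *
  have g1 : m ≤ m * m := Nat.le_mul_of_pos_left _ hm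
  have g2 : m * m ≤ m * m * T := Nat.le_mul_of_pos_right _ hT
  have g3 : m * T ≤ m * m * T := Nat.mul_le_mul_right _ g1
  have g4 : T ≤ m * T := Nat.le_mul_of_pos_left _ hm
  have e1 : (m + 1) * (m + 1) = m * m + 2 * m + 1 := by ring
  have e2 : (m + 1) * (m + 1 + T) = m * m + m * T + 2 * m + T + 1 := by ring
  have e3 : (m + 1) * (1 + T) = m * T + T + m + 1 := by ring
  rw [e1] at h2 h3
  rw [e2] at h4
  rw [e3] at h5
  linarith

theorem updateProg_ticks (hn : 1 ≤ n) (hd : 1 ≤ d) (hT : 1 ≤ T) (hK : 1 ≤ K) :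
    updateProg.ticks (bnd n d T K) ≤ 2100 * (n ^ d * ((n * d) * (n * d)) * (K * T)) := by
  have ht := termBody_ticks (n := n) (d := d) (T := T) (K := K) hn hd hT
  have hdm : d ≤ n * d := Nat.le_mul_of_pos_left _ hn
  have hm : 1 ≤ n * d := hd.trans hdm
  have hD : 1 ≤ n ^ d := Nat.one_le_pow _ _ hn
  simp only [bnd, Fin.reduceEq, if_true, if_false, or_false, or_true, mov,
    updateProg, copyBody, loadLoop, membLoop, termLoop, storeLoop, clearArr, ticks]
  generalize termBody.ticks (bnd n d T K) = t at *
  generalize n * d = m at *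
  generalize n ^ d = D at *
  have h1 : m ≤ m * m := Nat.le_mul_of_pos_left _ hm
  have h3 : m * T ≤ m * m * T := Nat.mul_le_mul_right _ h1
  have h4 : T ≤ m * T := Nat.le_mul_of_pos_left _ hm
  have h5 : m * m * T ≤ D * (m * m * T) := Nat.le_mul_of_pos_left _ hD
  have h6 : D ≤ D * (m * m * T) := Nat.le_mul_of_pos_right _ (by omega)
  have h7 : D * t ≤ D * (2000 * (m * m * T)) := Nat.mul_le_mul_left _ ht
  have h8 : T * d ≤ m * T := by rw [Nat.mul_comm]; exact Nat.mul_le_mul_right _ hdm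
  set P := D * (m * m * T) with hP
  have hP1 : 1 ≤ P := by omega
  have key : ∀ b : ℕ, b ≤ 2099 * P → 1 + K * b ≤ 2100 * (D * (m * m) * (K * T)) := by
    intro b hb
    have h9 : K * b ≤ K * (2099 * P) := Nat.mul_le_mul_left _ hb
    have h10 : D * (m * m) * (K * T) = K * P := by rw [hP]; ring
    have h11 : 1 ≤ K * P := Nat.mul_pos hK hP1
    rw [h10]
    linarith
  refine key _ ?_
  linarith

/-- A memory with values below `2 ^ S`, as it is between two items, occupies few bits. -/
theorem space_le {S : ℕ} {keys : List ℕ} {Us : ℕ → Finset ℕ} {c : Config 42 7}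
    (hI : Inv n d T K keys Us c.mem) (hB : c.mem.Bdd S) :
    c.space ≤ (42 + 2 * K + K * T) * (1 + S) := by
  have h1 : ∑ r, (1 + (c.reg r).size) ≤ 42 * (1 + S) := by
    have : ∀ r ∈ (Finset.univ : Finset (Fin 42)), 1 + (c.reg r).size ≤ 1 + S := fun r _ =>
      Nat.add_le_add_left (Nat.size_le.2 (hB.1 r)) 1
    simpa using Finset.sum_le_card_nsmul _ _ _ this
  have h2 : ∀ a, ((c.arr a).map fun v => 1 + v.size).sum ≤ (c.arr a).length * (1 + S) := by
    intro a
    have : ∀ x ∈ (c.arr a).map fun v => 1 + v.size, x ≤ 1 + S := by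
      intro x hx
      obtain ⟨v, hv, rfl⟩ := List.mem_map.1 hx
      exact Nat.add_le_add_left (Nat.size_le.2 (hB.2.2 a v hv)) 1
    simpa using List.sum_le_card_nsmul _ _ this
  have e0 : (c.arr aH).length = K := by rw [← hI.keysLen, ← hI.hKeys]; rfl
  have e1 : (c.arr aLev).length = K := hI.levLen
  have e2 : (c.arr aBig).length = K * T := hI.bigLen
  have e3 : (c.arr aG).length = 0 := by rw [show c.arr aG = [] from hI.hG]; rfl
  have e4 : (c.arr aX).length = 0 := by rw [show c.arr aX = [] from hI.hX]; rfl
  have e5 : (c.arr aY).length = 0 := by rw [show c.arr aY = [] from hI.hY]; rfl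
  have e6 : (c.arr aE).length = 0 := by rw [show c.arr aE = [] from hI.hE]; rfl
  have h3 : ∑ a, ((c.arr a).map fun v => 1 + v.size).sum ≤ (K + K + K * T) * (1 + S) := by
    refine (Finset.sum_le_sum fun a _ => h2 a).trans ?_
    rw [Fin.sum_univ_seven, e0, e1, e2, e3, e4, e5, e6]
    exact le_of_eq (by ring)
  unfold Config.space
  refine (Nat.add_le_add h1 h3).trans (le_of_eq ?_)
  ring

end RangeSketch

namespace RangeSketch

open Prog

variable {n d T K : ℕ} {e : Env} {Q : M → Prop} {s : M}

/-! ### Initialization -/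

theorem wp_coin {e : Env} {lim : Lim 42} {r : Fin 42} :
    (coin r : P).wp e lim Q s ↔
      Q { s.setReg r (e.coins s.pos).toNat with pos := s.pos + 1 } := Iff.rfl

/-- The number whose binary digits, from the top one down, are `len` consecutive random bits. -/
def coinVal (ω : ℕ → Bool) (p : ℕ) : ℕ → ℕ
  | 0 => 0
  | k + 1 => 2 * coinVal ω p k + (ω (p + k)).toNat

theorem coinVal_lt (ω : ℕ → Bool) (p k : ℕ) : coinVal ω p k < 2 ^ k := by
  induction k with
  | zero => simp [coinVal]
  | succ k ih =>
    have := Bool.toNat_le (ω (p + k))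
    rw [coinVal, pow_succ]
    omega

/-- The keys of the hash functions, read off consecutive blocks of random bits. -/
def keysOf (ω : ℕ → Bool) (q K : ℕ) : List ℕ := (List.range K).map fun c => coinVal ω (q * c) q

/-- The number of independent copies: `L` copies, unless the universe is so small that the whole
set can be stored. -/
def copies (N L m : ℕ) : ℕ := if N * N * L < 2 ^ m then L else 1

/-- The capacity of each copy. -/
def capacity (N L m : ℕ) : ℕ := if N * N * L < 2 ^ m then N * N * 512 else 2 ^ m

theorem coinLoop_spec {B : ℕ} (hB : 2 ≤ B) (hH : s.reg rH = 0) (hI : s.reg rI < B)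
    (hU : s.reg rU < B) (hl : s.reg rLen < B)
    (hQ : ∀ s' : M, s'.reg rH = coinVal e.coins s.pos (s.reg rLen) →
      s'.pos = s.pos + s.reg rLen → s'.reg rI < B → s'.reg rU < B → coinLoop.Frame s s' → Q s') :
    coinLoop.wp e Lim.none Q s := by
  refine wp_loop (fun i s' => s'.reg rH = coinVal e.coins s.pos i ∧ s'.pos = s.pos + i ∧
    s'.reg rI < B ∧ s'.reg rU < B) trivial ?_ ?_ ?_
  · exact ⟨hH, rfl, hI, hU⟩
  · rintro i s' hi ⟨h1, h2, -, -⟩ hF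
    rw [Operand.get_reg] at hi
    have := Bool.toNat_le (e.coins (s.pos + i))
    simp only [wp_coin, wp_seq, wp_op, wp_load, wp_store, wp_push, wp_pop, wp_length, wp_input,
      wp_ite, wp_skip, mov, Operand.get_reg, Operand.get_const, Mem.setReg_reg, Mem.setReg_arr,
      Mem.setArr_reg, Mem.setArr_arr, Fin.reduceEq, if_true, if_false, BinOp.eval, BinOp.grows,
      Bool.false_eq_true, false_imp_iff, true_and, true_imp_iff, Mem.setReg_pos, h1, h2, coinVal]
    refine ⟨trivial, trivial, ?_, ?_, ?_, ?_⟩ <;> omega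
  · rintro s' ⟨h1, h2, h3, h4⟩ hF
    exact hQ s' h1 h2 h3 h4 hF

theorem zeroLoop_spec {B : ℕ} (hJ : s.reg rJ < B) (hT : s.reg rT ≤ B)
    (hQ : ∀ s' : M, s'.arr aBig = s.arr aBig ++ List.replicate (s.reg rT) 0 → s'.pos = s.pos →
      s'.reg rJ < B → zeroLoop.Frame s s' → Q s') :
    zeroLoop.wp e Lim.none Q s := by
  refine wp_loop (fun i s' => s'.arr aBig = s.arr aBig ++ List.replicate i 0 ∧ s'.pos = s.pos ∧
    s'.reg rJ < B) trivial ?_ ?_ ?_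
  · exact ⟨by simp, rfl, hJ⟩
  · rintro i s' hi ⟨h1, h2, -⟩ hF
    rw [Operand.get_reg] at hi
    simp only [wp_seq, wp_op, wp_load, wp_store, wp_push, wp_pop, wp_length, wp_input, wp_ite,
      wp_skip, mov, Operand.get_reg, Operand.get_const, Mem.setReg_reg, Mem.setReg_arr,
      Mem.setArr_reg, Mem.setArr_arr, Fin.reduceEq, if_true, if_false, BinOp.eval, BinOp.grows,
      Bool.false_eq_true, false_imp_iff, true_and, true_imp_iff, Mem.setReg_pos, Mem.setArr_pos, h1,
      h2]
    refine ⟨trivial, ?_, by omega⟩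
    rw [List.append_assoc, ← List.replicate_succ']
  · rintro s' ⟨h1, h2, h3⟩ hF
    exact hQ s' h1 h2 h3 hF

/-- The memory of a copy that represents the empty set. -/
theorem Sample.empty (m T H : ℕ) (V : Finset ℕ) : Sample m T H ∅ V 0 [] where
  eq := by simp [survivors]
  le := Nat.zero_le _
  len := Nat.zero_le _
  least l' h := absurd h (Nat.not_lt_zero _)

theorem blockOf_replicate_zero (T k off : ℕ) : blockOf T (List.replicate k 0) off = [] := by
  rw [blockOf, List.filter_eq_nil_iff]
  intro a ha
  obtain ⟨j, -, rfl⟩ := List.mem_map.1 ha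
  simp [List.getD_replicate]

/-- The constants chosen during initialization, besides `K` and `T`. -/
theorem sizes_spec (hs : ∀ r, s.reg r = 0)
    (hQ : ∀ s' : M, s'.reg rN = e.param .bits → s'.reg rDim = e.param .dim →
      s'.reg rM = e.param .bits * e.param .dim →
      s'.reg rPw = 2 ^ (e.param .bits * e.param .dim) → s'.reg rPn = 2 ^ e.param .bits →
      s'.reg rMs = e.param .bits * e.param .dim + 1 →
      s'.reg rK = copies (e.param .invEps) (e.param .logInvDelta)
        (e.param .bits * e.param .dim) →
      s'.reg rT = capacity (e.param .invEps) (e.param .logInvDelta)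
        (e.param .bits * e.param .dim) →
      s'.reg rU ≤ 1 → s'.pos = s.pos → sizes.Frame s s' → Q s') :
    sizes.wp e Lim.none Q s := by
  refine wp_frame ?_
  simp only [sizes, wp_seq, wp_op, wp_load, wp_store, wp_push, wp_pop, wp_length, wp_input, wp_ite,
    wp_skip, mov, Operand.get_reg, Operand.get_const, Mem.setReg_reg, Mem.setReg_arr,
    Mem.setArr_reg, Mem.setArr_arr, Fin.reduceEq, if_true, if_false, BinOp.eval, BinOp.grows,
    Bool.false_eq_true, false_imp_iff, true_and, true_imp_iff, Operand.get_param, Nat.one_shiftLeft,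
    Nat.or_zero, Lim.none, implies_true]
  split_ifs with h
  · refine ⟨fun _ => ?_, fun h => absurd h (by simp)⟩
    exact hQ _ (by simp) (by simp) (by simp) (by simp) (by simp) (by simp)
      (by simp [copies, h]) (by simp [capacity, h]) (by simp) rfl
  · refine ⟨fun h => absurd rfl h, fun _ => ?_⟩
    exact hQ _ (by simp) (by simp) (by simp) (by simp) (by simp) (by simp)
      (by simp [copies, h]) (by simp [capacity, h]) (by simp) rfl

theorem powerLoop_spec {B : ℕ} (hI : s.reg rI < B) (hD : s.reg rDim ≤ B)
    (hQ : ∀ s' : M, s'.reg rTm = s.reg rN ^ s.reg rDim → s'.reg rI < B → s'.pos = s.pos →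
      powerLoop.Frame s s' → Q s') :
    powerLoop.wp e Lim.none Q s := by
  refine wp_frame ?_
  simp only [powerLoop, wp_seq, wp_op, wp_load, wp_store, wp_push, wp_pop, wp_length, wp_input,
    wp_ite, wp_skip, mov, Operand.get_reg, Operand.get_const, Mem.setReg_reg, Mem.setReg_arr,
    Mem.setArr_reg, Mem.setArr_arr, Fin.reduceEq, if_true, if_false, BinOp.eval, BinOp.grows,
    Bool.false_eq_true, false_imp_iff, true_and, true_imp_iff, Nat.or_zero]
  refine wp_loop (fun i s' => s'.reg rTm = s.reg rN ^ i ∧ s'.reg rI < B ∧ s'.pos = s.pos)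
    trivial ?_ ?_ ?_
  · simpa using hI
  · rintro i s' hi ⟨h1, -, h3⟩ hF
    have hN : s'.reg rN = s.reg rN := (hF.1 rN (by decide)).trans (by simp)
    simp only [wp_seq, wp_op, wp_load, wp_store, wp_push, wp_pop, wp_length, wp_input, wp_ite,
      wp_skip, mov, Operand.get_reg, Operand.get_const, Mem.setReg_reg, Mem.setReg_arr,
      Mem.setArr_reg, Mem.setArr_arr, Fin.reduceEq, if_true, if_false, BinOp.eval, BinOp.grows,
      Bool.false_eq_true, false_imp_iff, true_and, true_imp_iff] at hi
    simp only [wp_seq, wp_op, wp_load, wp_store, wp_push, wp_pop, wp_length, wp_input, wp_ite,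
      wp_skip, mov, Operand.get_reg, Operand.get_const, Mem.setReg_reg, Mem.setReg_arr,
      Mem.setArr_reg, Mem.setArr_arr, Fin.reduceEq, if_true, if_false, BinOp.eval, BinOp.grows,
      Bool.false_eq_true, false_imp_iff, true_and, true_imp_iff, Mem.setReg_pos, h1, h3, hN]
    exact ⟨trivial, (pow_succ _ _).symm, by omega, trivial⟩
  · rintro s' ⟨h1, h2, h3⟩ _
    exact hQ s' (by simpa using h1) h2 h3

/-- After `c` of the copies have been set up. -/
structure Fresh (ω : ℕ → Bool) (q T B c : ℕ) (s : M) : Prop where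
  keys : s.arr aH = keysOf ω q c
  lev : s.arr aLev = List.replicate c 0
  big : s.arr aBig = List.replicate (c * T) 0
  pos : s.pos = q * c
  hH : s.reg rH < 2 ^ q
  hI : s.reg rI < B
  hU : s.reg rU < B
  hJ : s.reg rJ < B
  hC : s.reg rC < B

theorem newCopy_spec {q B c : ℕ} (hB : 2 ≤ B) (hT : s.reg rT ≤ B) (hl : s.reg rLen = q)
    (hq : q < B) (hc : c < B) (h : Fresh e.coins q (s.reg rT) B c s)
    (hQ : ∀ s', Fresh e.coins q (s.reg rT) B (c + 1) s' → Q s') :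
    newCopy.wp e Lim.none Q (s.setReg rC c) := by
  simp only [newCopy, wp_seq, wp_op, wp_load, wp_store, wp_push, wp_pop, wp_length, wp_input,
    wp_ite, wp_skip, mov, Operand.get_reg, Operand.get_const, Mem.setReg_reg, Mem.setReg_arr,
    Mem.setArr_reg, Mem.setArr_arr, Fin.reduceEq, if_true, if_false, BinOp.eval, BinOp.grows,
    Bool.false_eq_true, false_imp_iff, true_and, true_imp_iff, Nat.or_zero]
  refine coinLoop_spec hB (by simp) (by simpa using h.hI) (by simpa using h.hU)
    (by simpa [hl] using hq) fun s₁ g1 g2 g3 g4 hF => ?_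
  simp only [wp_seq, wp_op, wp_load, wp_store, wp_push, wp_pop, wp_length, wp_input, wp_ite,
    wp_skip, mov, Operand.get_reg, Operand.get_const, Mem.setReg_reg, Mem.setReg_arr,
    Mem.setArr_reg, Mem.setArr_arr, Fin.reduceEq, if_true, if_false, BinOp.eval, BinOp.grows,
    Bool.false_eq_true, false_imp_iff, true_and, true_imp_iff, Mem.setReg_pos] at g1 g2
  simp only [wp_seq, wp_op, wp_load, wp_store, wp_push, wp_pop, wp_length, wp_input, wp_ite,
    wp_skip, mov, Operand.get_reg, Operand.get_const, Mem.setReg_reg, Mem.setReg_arr,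
    Mem.setArr_reg, Mem.setArr_arr, Fin.reduceEq, if_true, if_false, BinOp.eval, BinOp.grows,
    Bool.false_eq_true, false_imp_iff, true_and, true_imp_iff]
  have hJ : s₁.reg rJ = s.reg rJ := (hF.1 rJ (by decide)).trans (by simp)
  have hC : s₁.reg rC = c := (hF.1 rC (by decide)).trans (by simp)
  have hT1 : s₁.reg rT = s.reg rT := (hF.1 rT (by decide)).trans (by simp)
  have hA : ∀ a, s₁.arr a = s.arr a := fun a => hF.2 a rfl
  refine ⟨trivial, trivial, zeroLoop_spec (B := B) (by simpa [hJ] using h.hJ)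
    (by simpa [hT1] using hT) fun s₂ k1 k2 k3 hF2 => hQ s₂ ?_⟩
  simp only [wp_seq, wp_op, wp_load, wp_store, wp_push, wp_pop, wp_length, wp_input, wp_ite,
    wp_skip, mov, Operand.get_reg, Operand.get_const, Mem.setReg_reg, Mem.setReg_arr,
    Mem.setArr_reg, Mem.setArr_arr, Fin.reduceEq, if_true, if_false, BinOp.eval, BinOp.grows,
    Bool.false_eq_true, false_imp_iff, true_and, true_imp_iff, Mem.setReg_pos,
    Mem.setArr_pos] at k1 k2
  have r : ∀ r, r ≠ rJ → s₂.reg r = s₁.reg r := fun r hr =>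
    (hF2.1 r (by simp [zeroLoop, modR, hr])).trans (by simp)
  have a1 : s₂.arr aH = s₁.arr aH ++ [s₁.reg rH] := (hF2.2 aH (by decide)).trans (by simp)
  have a2 : s₂.arr aLev = s₁.arr aLev ++ [0] := (hF2.2 aLev (by decide)).trans (by simp)
  refine ⟨?_, ?_, ?_, ?_, ?_, ?_, ?_, k3, ?_⟩
  · rw [a1, hA, h.keys, g1, hl, h.pos, keysOf, keysOf, List.range_succ, List.map_append]
    rfl
  · rw [a2, hA, h.lev, ← List.replicate_succ']
  · rw [k1, hA, h.big, hT1, ← List.replicate_add, Nat.succ_mul]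
  · rw [k2, g2, hl, h.pos, Nat.mul_succ]
  · rw [r _ (by decide), g1, hl]; exact coinVal_lt _ _ _
  · rw [r _ (by decide)]; exact g3
  · rw [r _ (by decide)]; exact g4
  · rw [r _ (by decide), hC]; exact hc

/-- The capacity and the total number of cells stay close to the size of the universe. -/
theorem capacity_lt {N L m : ℕ} (hL : 1 ≤ L) :
    1 ≤ copies N L m ∧ capacity N L m < 2 ^ (m + 10) ∧
      copies N L m * capacity N L m < 2 ^ (m + 10) := by
  have hp := Nat.one_le_two_pow (n := m)
  have e : 2 ^ (m + 10) = 1024 * 2 ^ m := by rw [pow_add, Nat.mul_comm]; norm_num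
  unfold copies capacity
  split_ifs with h
  · have h1 : N * N ≤ N * N * L := Nat.le_mul_of_pos_right _ hL
    have h2 : L * (N * N * 512) = N * N * L * 512 := by ring
    omega
  · omega

theorem capacity_pos {N L m : ℕ} (hN : 1 ≤ N) : 1 ≤ capacity N L m := by
  have hp := Nat.one_le_two_pow (n := m)
  have := Nat.mul_pos hN hN
  unfold capacity
  split_ifs <;> omega

/-- Initialization sets up the representation of the empty set, with random keys. -/
theorem initProg_spec {N L : ℕ} (hN : 1 ≤ N) (hL : 1 ≤ L) (hn : 1 ≤ n) (hd : 1 ≤ d)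
    (e1 : e.param .bits = n) (e2 : e.param .dim = d) (e3 : e.param .invEps = N)
    (e4 : e.param .logInvDelta = L) (hr : ∀ r, s.reg r = 0) (ha : ∀ a, s.arr a = [])
    (hp : s.pos = 0)
    (hQ : ∀ s' : M, Inv n d (capacity N L (n * d)) (copies N L (n * d))
      (keysOf e.coins (3 * (n * d)) (copies N L (n * d))) (fun _ => ∅) s' →
      s'.Bdd (3 * (n * d) + 12) → Q s') :
    initProg.wp e Lim.none Q s := by
  obtain ⟨hK1, hT, hKT⟩ := capacity_lt (N := N) (L := L) (m := n * d) hL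
  have hT1 := capacity_pos (N := N) (L := L) (m := n * d) hN
  have hK := (Nat.le_mul_of_pos_right (copies N L (n * d)) hT1).trans_lt hKT
  have hB : ∀ k ≤ 3 * (n * d) + 12, 2 ^ k ≤ 2 ^ (3 * (n * d) + 12) := fun k hk =>
    Nat.pow_le_pow_right (by norm_num) hk
  have hB1 := hB 1 (by omega)
  have hB2 := hB (n * d + 10) (by omega)
  have hB3 := hB (3 * (n * d)) (by omega)
  have hB4 : 3 * (n * d) + 12 < 2 ^ (3 * (n * d) + 12) := Nat.lt_two_pow_self
  have hnd : n ^ d ≤ 2 ^ (n * d) := by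
    rw [pow_mul]; exact Nat.pow_le_pow_left Nat.lt_two_pow_self.le d
  have hB5 := hB (n * d + 1) (by omega)
  have hB6 : 2 ^ n ≤ 2 ^ (n * d) :=
    Nat.pow_le_pow_right (by norm_num) (Nat.le_mul_of_pos_right _ hd)
  have hB7 : 2 ^ (n * d + 1) = 2 * 2 ^ (n * d) := by rw [pow_succ, Nat.mul_comm]
  have hB8 := Nat.one_le_two_pow (n := n * d)
  have hd1 : d ≤ n * d := Nat.le_mul_of_pos_left _ hn
  have hn1 : n ≤ n * d := Nat.le_mul_of_pos_right _ hd
  refine wp_frame ?_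
  simp only [initProg, wp_seq]
  refine sizes_spec hr fun s₁ a1 a2 a3 a4 a5 a6 a7 a8 a9 a10 F1 => ?_
  rw [e1, e2] at a3 a4 a6
  rw [e1, e2, e3, e4] at a7 a8
  rw [e1] at a1 a5
  rw [e2] at a2
  generalize copies N L (n * d) = K at *
  generalize capacity N L (n * d) = T at *
  generalize hBB : 2 ^ (3 * (n * d) + 12) = B at *
  have z1 : ∀ r, sizes.modR r = false → s₁.reg r = 0 := fun r h => (F1.1 r h).trans (hr r)
  refine powerLoop_spec (B := B) (by rw [z1 _ (by decide)]; omega) (by rw [a2]; omega)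
    fun s₂ b1 b2 b3 F2 => ?_
  rw [a1, a2] at b1
  have z2 : ∀ r, r ≠ rTm → r ≠ rI → s₂.reg r = s₁.reg r := fun r h h' =>
    F2.1 r (by simp [powerLoop, modR, h, h'])
  have y2 : ∀ a, s₂.arr a = [] := fun a => (F2.2 a rfl).trans ((F1.2 a rfl).trans (ha a))
  simp only [wp_seq, wp_op, Operand.get_reg, Operand.get_const, BinOp.eval]
  refine ⟨fun _ => trivial, ?_⟩
  rw [z2 rM (by decide) (by decide), a3]
  generalize hs3 : s₂.setReg rLen (n * d * 3) = s₃
  have z3 : ∀ r, r ≠ rLen → s₃.reg r = s₂.reg r := fun r h => by simp [← hs3, h]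
  have hT3 : s₃.reg rT = T := by
    rw [z3 _ (by decide), z2 _ (by decide) (by decide), a8]
  have hK3 : s₃.reg rK = K := by
    rw [z3 _ (by decide), z2 _ (by decide) (by decide), a7]
  have hL3 : s₃.reg rLen = 3 * (n * d) := by rw [← hs3]; simp [Nat.mul_comm]
  refine wp_loop (fun c s' => Fresh e.coins (3 * (n * d)) T B c s') trivial ?_ ?_ ?_
  · refine ⟨?_, ?_, ?_, ?_, ?_, ?_, ?_, ?_, ?_⟩
    · rw [← hs3]; exact y2 _
    · rw [← hs3]; exact y2 _
    · rw [← hs3, Nat.zero_mul]; exact y2 _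
    · rw [← hs3]; exact b3.trans (a10.trans hp)
    · rw [z3 _ (by decide), z2 _ (by decide) (by decide), z1 _ (by decide)]; positivity
    · rw [z3 _ (by decide)]; exact b2
    · rw [z3 _ (by decide), z2 _ (by decide) (by decide)]; omega
    · rw [z3 _ (by decide), z2 _ (by decide) (by decide), z1 _ (by decide)]; omega
    · rw [z3 _ (by decide), z2 _ (by decide) (by decide), z1 _ (by decide)]; omega
  · intro c s' hc h F
    rw [Operand.get_reg, hK3] at hc
    have t1 : s'.reg rT = T := (F.1 rT (by decide)).trans hT3
    have t2 : s'.reg rLen = 3 * (n * d) := (F.1 rLen (by decide)).trans hL3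
    refine newCopy_spec (q := 3 * (n * d)) (B := B) (by omega) (by rw [t1]; omega) t2 (by omega)
      (by omega) (by rw [t1]; exact h) fun s'' h'' => ?_
    rwa [t1] at h''
  · intro s₄ h F4
    rw [Operand.get_reg, hK3] at h
    simp only [mov, wp_op, Operand.get_const, BinOp.eval, Nat.or_zero]
    refine ⟨fun _ => trivial, fun F => ?_⟩
    have z : ∀ r, (loop rC rK newCopy).modR r = false → r ≠ rLen → r ≠ rTm → r ≠ rI →
        (s₄.setReg rLen 0).reg r = s₁.reg r := fun r h1 h2 h3 h4 => by
      rw [Mem.setReg_reg, if_neg h2, F4.1 r h1, z3 r h2, z2 r h3 h4]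
    have zTm : (s₄.setReg rLen 0).reg rTm = n ^ d := by
      rw [Mem.setReg_reg, if_neg (by decide), F4.1 _ (by decide), z3 _ (by decide), b1]
    have hC : Consts n d T K (s₄.setReg rLen 0) := by
      refine ⟨?_, ?_, ?_, ?_, ?_, ?_, ?_, zTm, ?_⟩ <;>
        rw [z _ (by decide) (by decide) (by decide) (by decide)] <;> assumption
    have y : ∀ a, (loop rC rK newCopy).modA a = false → s₄.arr a = [] := fun a h => by
      rw [F4.2 a h, ← hs3]; exact y2 a
    have hU : ∀ r, s₄.reg r < B → (s₄.setReg rLen 0).reg r < B := fun r h => by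
      rw [Mem.setReg_reg]
      split_ifs
      · omega
      · exact h
    refine hQ _ ⟨hC, h.keys, by simp [keysOf], ?_, ?_, y _ (by decide), y _ (by decide),
      y _ (by decide), y _ (by decide), ?_⟩ ⟨?_, ?_, ?_⟩
    · rw [Mem.setReg_arr, h.lev, List.length_replicate]
    · rw [Mem.setReg_arr, h.big, List.length_replicate]
    · intro c hc
      rw [Mem.setReg_arr, h.lev, h.big, blockOf_replicate_zero, List.getD_replicate _ hc]
      exact Sample.empty _ _ _ _
    · intro r
      rw [hBB]
      by_cases hr0 : initProg.modR r = false
      · rw [F.1 r hr0, hr r]; omega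
      · have : ∀ r, initProg.modR r ≠ false → r = rN ∨ r = rDim ∨ r = rM ∨ r = rPw ∨ r = rPn ∨
            r = rMs ∨ r = rK ∨ r = rT ∨ r = rTm ∨ r = rU ∨ r = rI ∨ r = rC ∨ r = rJ ∨ r = rH ∨
            r = rLen := by decide
        rcases this r hr0 with
          h' | h' | h' | h' | h' | h' | h' | h' | h' | h' | h' | h' | h' | h' | h'
          <;> subst h'
        · rw [hC.hN]; omega
        · rw [hC.hD]; omega
        · rw [hC.hM]; omega
        · rw [hC.hPw]; omega
        · rw [hC.hPn]; omega
        · rw [hC.hMs]; omega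
        · rw [hC.hK]; omega
        · rw [hC.hT]; omega
        · rw [zTm]; omega
        · exact hU _ h.hU
        · exact hU _ h.hI
        · exact hU _ h.hC
        · exact hU _ h.hJ
        · exact hU _ (h.hH.trans_le hB3)
        · rw [Mem.setReg_reg, if_pos rfl]; omega
    · intro a
      rw [hBB, Mem.setReg_arr]
      by_cases ha0 : (loop rC rK newCopy).modA a = false
      · rw [y a ha0, List.length_nil]; omega
      · have : ∀ a, (loop rC rK newCopy).modA a ≠ false → a = aH ∨ a = aLev ∨ a = aBig := by decide
        rcases this a ha0 with h' | h' | h' <;> subst h'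
        · rw [h.keys, keysOf, List.length_map, List.length_range]; omega
        · rw [h.lev, List.length_replicate]; omega
        · rw [h.big, List.length_replicate]; omega
    · intro a v hv
      rw [hBB]
      rw [Mem.setReg_arr] at hv
      by_cases ha0 : (loop rC rK newCopy).modA a = false
      · rw [y a ha0] at hv; cases hv
      · have : ∀ a, (loop rC rK newCopy).modA a ≠ false → a = aH ∨ a = aLev ∨ a = aBig := by decide
        rcases this a ha0 with h' | h' | h' <;> subst h'
        · rw [h.keys, keysOf] at hv
          obtain ⟨c, -, rfl⟩ := List.mem_map.1 hv
          exact (coinVal_lt _ _ _).trans_le hB3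
        · rw [h.lev] at hv
          rw [List.eq_of_mem_replicate hv]; omega
        · rw [h.big] at hv
          rw [List.eq_of_mem_replicate hv]; omega

end RangeSketch

namespace RangeSketch

open Prog

variable {n d T K : ℕ}

/-! ### Processing a stream -/

/-- The codes of the points in the union of the ranges of a stream. -/
def codes {n d : ℕ} (s : List (DRange n d)) : Finset ℕ :=
  (Finset.range (2 ^ (n * d))).filter fun v => ∃ b ∈ s, InBox n d b.encode v

theorem codes_append (s : List (DRange n d)) (b : DRange n d) :
    codes (s ++ [b]) = codes s ∪ boxSet n d b.encode := by
  ext v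
  simp only [codes, boxSet, List.mem_append, List.mem_singleton, Finset.mem_union,
    Finset.mem_filter, or_and_right, exists_or, exists_eq_left, and_or_left]

theorem codes_subset (s : List (DRange n d)) : codes s ⊆ Finset.range (2 ^ (n * d)) :=
  Finset.filter_subset _ _

theorem encode_lt (b : DRange n d) (j : ℕ) : b.encode j < 2 ^ n := by
  unfold DRange.encode
  split_ifs
  · exact Fin.is_lt _
  · exact Fin.is_lt _
  · positivity

theorem encode_lo (b : DRange n d) {i : ℕ} (hi : i < d) : b.encode (2 * i) = b.lo ⟨i, hi⟩ := by
  have h : 2 * i / 2 = i := by omega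
  simp [DRange.encode, h, hi]

theorem encode_hi (b : DRange n d) {i : ℕ} (hi : i < d) :
    b.encode (2 * i + 1) = b.hi ⟨i, hi⟩ := by
  have h : (2 * i + 1) / 2 = i := by omega
  have h' : (2 * i + 1) % 2 = 1 := by omega
  simp [DRange.encode, h, h', hi]

/-- The code of a point: its coordinates are the digits in base `2 ^ n`. -/
def pointCode (x : Fin d → Fin (2 ^ n)) : ℕ := finFunctionFinEquiv x

theorem pointCode_injective : Function.Injective (pointCode (n := n) (d := d)) :=
  Fin.val_injective.comp finFunctionFinEquiv.injective

theorem pointCode_digit (x : Fin d → Fin (2 ^ n)) (i : Fin d) :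
    (pointCode x >>> (n * i)) % 2 ^ n = x i := by
  have h := congrArg (fun f => ((f i : Fin (2 ^ n)) : ℕ))
    (finFunctionFinEquiv.symm_apply_apply x)
  simp only [finFunctionFinEquiv_symm_apply_val] at h
  rw [Nat.shiftRight_eq_div_pow, pow_mul]
  exact h

theorem inBox_pointCode (b : DRange n d) (x : Fin d → Fin (2 ^ n)) :
    InBox n d b.encode (pointCode x) ↔ x ∈ b.points := by
  constructor
  · intro h i
    have := h i i.2
    rw [encode_lo b i.2, encode_hi b i.2, pointCode_digit x i] at this
    exact this
  · intro h i hi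
    rw [encode_lo b hi, encode_hi b hi, pointCode_digit x ⟨i, hi⟩]
    exact h ⟨i, hi⟩

theorem F0_eq_card (s : List (DRange n d)) : F0 s = (codes s).card := by
  rw [F0, ← Set.ncard_image_of_injective _ pointCode_injective, ← Set.ncard_coe_finset]
  congr 1
  ext v
  simp only [Set.mem_image, Set.mem_ofPred_eq, codes, Finset.coe_filter, Finset.mem_range]
  constructor
  · rintro ⟨x, ⟨b, hb, hx⟩, rfl⟩
    refine ⟨?_, b, hb, (inBox_pointCode b x).2 hx⟩
    rw [pow_mul]
    exact (finFunctionFinEquiv x).2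
  · rintro ⟨hv, b, hb, h⟩
    rw [pow_mul] at hv
    have e : pointCode (finFunctionFinEquiv.symm ⟨v, hv⟩) = v := by
      rw [pointCode, Equiv.apply_symm_apply]
    exact ⟨_, ⟨b, hb, (inBox_pointCode b _).1 (by rwa [e])⟩, e⟩

section

variable {ω : ℕ → Bool} {p : Param → ℕ}

/-- The effect and the cost of processing one item. -/
theorem step_spec {keys : List ℕ} {U : Finset ℕ} (hn : 1 ≤ n) (hT : T < 2 ^ (n * d + 10))
    (hKT : K * T < 2 ^ (n * d + 10)) (hkeys : ∀ h ∈ keys, h < 2 ^ (3 * (n * d)))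
    (hU : U ⊆ Finset.range (2 ^ (n * d))) {c : Config 42 7}
    (hI : Inv n d T K keys (fun _ => U) c.mem) (hB : c.mem.Bdd (3 * (n * d) + 12))
    (b : DRange n d) :
    Inv n d T K keys (fun _ => U ∪ boxSet n d b.encode) (rangeAlg.step p ω c b).mem ∧
      (rangeAlg.step p ω c b).mem.Bdd (3 * (n * d) + 12) ∧
      (rangeAlg.step p ω c b).time ≤
        updateProg.ticks (bnd n d T K) * (3 * (3 * (n * d) + 12 + 1) ^ 2) := by
  have he : ∀ j, b.encode j < 2 ^ n := encode_lt b
  have h := fun Q => updateProg_spec (e := ⟨p, b.encode, ω⟩) (Q := Q) hn he hT hKT hkeys hI hU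
  have h1 := h _ fun s' hs' => hs'
  have hnd : n ≤ 3 * (n * d) + 12 ∨ d = 0 := by
    rcases Nat.eq_zero_or_pos d with h | h
    · exact Or.inr h
    · left; have := Nat.le_mul_of_pos_right n h; omega
  have he' : ∀ j, b.encode j < 2 ^ (3 * (n * d) + 12) := by
    intro j
    rcases hnd with h | rfl
    · exact (he j).trans_le (Nat.pow_le_pow_right (by norm_num) h)
    · simp [DRange.encode]
  have h2 := wp_time (e := ⟨p, b.encode, ω⟩) (S := 3 * (n * d) + 12) (bnd := bnd n d T K)
    (c := { c with time := 0 }) (by omega) he' updateProg_plain hB h1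
  refine ⟨wp_sound (c := { c with time := 0 }) h1, h2.1, ?_⟩
  exact h2.2.trans (le_of_eq (Nat.zero_add _))

/-- What is known about the memory at any time: it represents the union of the items seen. -/
theorem state_spec {N L : ℕ} (hN : 1 ≤ N) (hL : 1 ≤ L) (hn : 1 ≤ n) (hd : 1 ≤ d)
    (e1 : p .bits = n) (e2 : p .dim = d) (e3 : p .invEps = N)
    (e4 : p .logInvDelta = L) (s : List (DRange n d)) :
    Inv n d (capacity N L (n * d)) (copies N L (n * d))
      (keysOf ω (3 * (n * d)) (copies N L (n * d))) (fun _ => codes s)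
      (rangeAlg.state p ω s).mem ∧ (rangeAlg.state p ω s).mem.Bdd (3 * (n * d) + 12) := by
  induction s using List.reverseRecOn with
  | nil =>
    have h := initProg_spec (n := n) (d := d) (N := N) (L := L) (e := ⟨p, fun _ => 0, ω⟩)
      (s := (Config.initial : Config 42 7).mem) hN hL hn hd e1 e2 e3 e4
      (fun _ => rfl) (fun _ => rfl) rfl fun s' h1 h2 => And.intro h1 h2
    have h' := wp_sound (c := Config.initial) h
    refine ⟨h'.1.congr fun c _ => ?_, h'.2⟩
    simp [codes]
  | append_singleton s b ih =>
    obtain ⟨-, hT, hKT⟩ := capacity_lt (N := N) (L := L) (m := n * d) hL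
    have := step_spec (p := p) (ω := ω) hn hT hKT ?_ (codes_subset s) ih.1 ih.2 b
    · rw [← codes_append] at this
      rw [StreamAlg.state, List.foldl_append]
      exact ⟨this.1, this.2.1⟩
    · intro h hh
      obtain ⟨c, -, rfl⟩ := List.mem_map.1 hh
      exact coinVal_lt _ _ _

theorem copies_mul_capacity_le {N L m : ℕ} :
    copies N L m * capacity N L m ≤ 512 * (N * N * L) := by
  unfold copies capacity
  split_ifs with h
  · exact le_of_eq (by ring)
  · omega

/-- Space between items and time per item, in terms of the rounded parameters. -/
theorem resources {N L : ℕ} (hN : 1 ≤ N) (hL : 1 ≤ L) (hn : 1 ≤ n) (hd : 1 ≤ d)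
    (e1 : p .bits = n) (e2 : p .dim = d) (e3 : p .invEps = N)
    (e4 : p .logInvDelta = L) (s : List (DRange n d)) :
    (rangeAlg.state p ω s).space ≤ 2 ^ 20 * ((n * d) * (N * N * L)) ∧
    ∀ b : DRange n d, (rangeAlg.step p ω (rangeAlg.state p ω s) b).time ≤
      2 ^ 30 * ((n * d) ^ 4 * n ^ d * (N * N * L)) := by
  obtain ⟨hI, hB⟩ := state_spec (ω := ω) hN hL hn hd e1 e2 e3 e4 s
  obtain ⟨hK, hT, hKT⟩ := capacity_lt (N := N) (L := L) (m := n * d) hL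
  have hT1 := capacity_pos (N := N) (L := L) (m := n * d) hN
  have hle := copies_mul_capacity_le (N := N) (L := L) (m := n * d)
  have hm : 1 ≤ n * d := Nat.mul_pos hn hd
  constructor
  · refine (space_le hI hB).trans ?_
    generalize copies N L (n * d) = K at *
    generalize capacity N L (n * d) = T at *
    have h1 : K ≤ K * T := Nat.le_mul_of_pos_right _ hT1
    calc (42 + 2 * K + K * T) * (1 + (3 * (n * d) + 12))
        ≤ (45 * (512 * (N * N * L))) * (16 * (n * d)) :=
          Nat.mul_le_mul (by omega) (by omega)
      _ = 368640 * ((n * d) * (N * N * L)) := by ring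
      _ ≤ _ := Nat.mul_le_mul_right _ (by norm_num)
  · intro b
    have hkeys : ∀ h ∈ keysOf ω (3 * (n * d)) (copies N L (n * d)), h < 2 ^ (3 * (n * d)) := by
      intro h hh
      obtain ⟨c, -, rfl⟩ := List.mem_map.1 hh
      exact coinVal_lt _ _ _
    have h1 := (step_spec (p := p) (ω := ω) hn hT hKT hkeys (codes_subset s) hI hB b).2.2
    have h2 := updateProg_ticks (n := n) (d := d) hn hd hT1 hK
    refine h1.trans ?_
    calc _ ≤ 2100 * (n ^ d * ((n * d) * (n * d)) * (512 * (N * N * L))) *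
          (3 * (16 * (n * d)) ^ 2) :=
          Nat.mul_le_mul (h2.trans (Nat.mul_le_mul_left _ (Nat.mul_le_mul_left _ hle)))
            (Nat.mul_le_mul_left _ (Nat.pow_le_pow_left (by omega) _))
      _ = 825753600 * ((n * d) ^ 4 * n ^ d * (N * N * L)) := by ring
      _ ≤ _ := Nat.mul_le_mul_right _ (by norm_num)

end

/-- The rounded parameters are bounded by constant multiples of the given ones. -/
theorem rounding_le {ε₀ δ₀ ε δ : ℝ} (hε : 0 < ε) (hε₀ : ε ≤ ε₀) (hδ : 0 < δ) (hδ₀ : δ ≤ δ₀)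
    (h1 : δ₀ < 1) :
    ((⌈1 / ε⌉₊ * ⌈1 / ε⌉₊ * ⌈Real.logb 2 (1 / δ)⌉₊ : ℕ) : ℝ) ≤
      (1 + ε₀) ^ 2 * (1 / Real.log 2 + 1 / Real.log (1 / δ₀)) *
        (1 / ε ^ 2 * Real.log (1 / δ)) := by
  have hδ₀' : 0 < δ₀ := hδ.trans_le hδ₀
  have l0 : 0 < Real.log (1 / δ₀) := Real.log_pos (by rw [lt_div_iff₀ hδ₀']; linarith)
  have l1 : Real.log (1 / δ₀) ≤ Real.log (1 / δ) :=
    Real.log_le_log (by positivity) (one_div_le_one_div_of_le hδ hδ₀)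
  have l2 : 0 < Real.log 2 := Real.log_pos one_lt_two
  have hN : (⌈1 / ε⌉₊ : ℝ) ≤ (1 + ε₀) / ε := by
    refine (Nat.ceil_lt_add_one (by positivity)).le.trans ?_
    rw [add_div]
    gcongr
    rwa [le_div_iff₀ hε, one_mul]
  have hL : (⌈Real.logb 2 (1 / δ)⌉₊ : ℝ) ≤
      (1 / Real.log 2 + 1 / Real.log (1 / δ₀)) * Real.log (1 / δ) := by
    have hlog : 0 ≤ Real.logb 2 (1 / δ) := div_nonneg (l0.le.trans l1) l2.le
    refine (Nat.ceil_lt_add_one hlog).le.trans ?_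
    rw [add_mul, one_div_mul_eq_div, one_div_mul_eq_div]
    refine add_le_add le_rfl ?_
    rwa [le_div_iff₀ l0, one_mul]
  push_cast
  calc (⌈1 / ε⌉₊ : ℝ) * ⌈1 / ε⌉₊ * ⌈Real.logb 2 (1 / δ)⌉₊
      ≤ (1 + ε₀) / ε * ((1 + ε₀) / ε) *
        ((1 / Real.log 2 + 1 / Real.log (1 / δ₀)) * Real.log (1 / δ)) := by
        have : 0 < (1 + ε₀) / ε := div_pos (by linarith) hε
        gcongr
    _ = _ := by ring

theorem one_le_ceil_logb {δ : ℝ} (hδ : 0 < δ) (h1 : δ < 1) : 1 ≤ ⌈Real.logb 2 (1 / δ)⌉₊ :=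
  Nat.one_le_ceil_iff.2 (Real.logb_pos one_lt_two (by rw [lt_div_iff₀ hδ]; linarith))

theorem one_le_ceil_inv {ε : ℝ} (hε : 0 < ε) : 1 ≤ ⌈1 / ε⌉₊ :=
  Nat.one_le_ceil_iff.2 (by positivity)

/-- The space and time bounds of the theorem. -/
theorem resource_bounds (ε₀ δ₀ : ℝ) (h0 : 0 < ε₀) (hδ₀ : 0 < δ₀) (h1 : δ₀ < 1) :
    ∃ C : ℝ, 0 < C ∧
      ∀ (n d : ℕ) (ε δ : ℝ), 1 ≤ n → 1 ≤ d → 0 < ε → ε ≤ ε₀ → 0 < δ → δ ≤ δ₀ →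
        ∀ (ω : ℕ → Bool) (s : List (DRange n d)),
          ((rangeAlg.state (params n d ε δ) ω s).space : ℝ)
              ≤ C * ((n * d : ℝ) / ε ^ 2 * Real.log (1 / δ)) ∧
          ∀ b : DRange n d,
            ((rangeAlg.step (params n d ε δ) ω (rangeAlg.state (params n d ε δ) ω s) b).time : ℝ)
              ≤ C * ((n * d : ℝ) ^ 4 * (n : ℝ) ^ d * (1 / ε ^ 2) * Real.log (1 / δ)) := by
  have l0 : 0 < Real.log (1 / δ₀) := Real.log_pos (by rw [lt_div_iff₀ hδ₀]; linarith)
  have l2 : 0 < Real.log 2 := Real.log_pos one_lt_two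
  refine ⟨2 ^ 30 * ((1 + ε₀) ^ 2 * (1 / Real.log 2 + 1 / Real.log (1 / δ₀))), by positivity, ?_⟩
  intro n d ε δ hn hd hε hεε hδ hδδ ω s
  have hN := rounding_le hε hεε hδ hδδ h1
  have l3 : 0 < Real.log (1 / δ) := Real.log_pos (by rw [lt_div_iff₀ hδ]; linarith)
  obtain ⟨r1, r2⟩ := resources (p := params n d ε δ) (ω := ω) (one_le_ceil_inv hε)
    (one_le_ceil_logb hδ (hδδ.trans_lt h1)) hn hd rfl rfl rfl rfl s
  generalize (1 + ε₀) ^ 2 * (1 / Real.log 2 + 1 / Real.log (1 / δ₀)) = C at *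
  generalize (⌈1 / ε⌉₊ * ⌈1 / ε⌉₊ * ⌈Real.logb 2 (1 / δ)⌉₊) = W at *
  have hW : (0 : ℝ) ≤ W := Nat.cast_nonneg _
  constructor
  · have h : ((rangeAlg.state (params n d ε δ) ω s).space : ℝ) ≤
        2 ^ 20 * ((n * d : ℝ) * W) := by exact_mod_cast r1
    calc _ ≤ 2 ^ 20 * ((n * d : ℝ) * W) := h
      _ ≤ 2 ^ 30 * ((n * d : ℝ) * (C * (1 / ε ^ 2 * Real.log (1 / δ)))) := by
        gcongr <;> norm_num
      _ = _ := by ring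
  · intro b
    have h : ((rangeAlg.step (params n d ε δ) ω (rangeAlg.state (params n d ε δ) ω s) b).time : ℝ)
        ≤ 2 ^ 30 * ((n * d : ℝ) ^ 4 * (n : ℝ) ^ d * W) := by exact_mod_cast r2 b
    calc _ ≤ 2 ^ 30 * ((n * d : ℝ) ^ 4 * (n : ℝ) ^ d * W) := h
      _ ≤ 2 ^ 30 * ((n * d : ℝ) ^ 4 * (n : ℝ) ^ d * (C * (1 / ε ^ 2 * Real.log (1 / δ)))) := by
        gcongr
      _ = _ := by ring

end RangeSketch

namespace RangeSketch

open Prog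

variable {n d T K : ℕ} {e : Env} {Q : M → Prop} {s : M}

/-! ### The query program: a median of estimates -/

theorem none_val {v : ℕ} : (Lim.none : Lim 42).val v ↔ True := Iff.rfl

/-- The number of copies among the first `k` whose estimate is at most `v`. -/
def countLe (E : ℕ → ℕ) (v k : ℕ) : ℕ := ((Finset.range k).filter fun c => E c ≤ v).card

theorem countLe_succ (E : ℕ → ℕ) (v k : ℕ) :
    countLe E v (k + 1) = countLe E v k + if E k ≤ v then 1 else 0 := by
  rw [countLe, Finset.range_add_one, Finset.filter_insert]
  split_ifs
  · rw [Finset.card_insert_of_notMem (by simp)]; rfl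
  · rfl

/-- The estimate of copy `c`. -/
def estimateOf (T : ℕ) (s : M) (c : ℕ) : ℕ :=
  (blockOf T (s.arr aBig) (c * T)).length <<< (s.arr aLev).getD c 0

theorem estimate_spec {c : ℕ} (hT : s.reg rT = T)
    (hQ : ∀ s', s'.arr aE = s.arr aE ++ [estimateOf T s c] → estimate.Frame (s.setReg rC c) s' →
      Q s') :
    estimate.wp e Lim.none Q (s.setReg rC c) := by
  refine wp_frame ?_
  simp only [estimate, wp_seq, wp_op, wp_load, wp_store, wp_push, wp_pop, wp_length, wp_input,
    wp_ite, wp_skip, mov, Operand.get_reg, Operand.get_const, Mem.setReg_reg, Mem.setReg_arr,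
    Mem.setArr_reg, Mem.setArr_arr, Fin.reduceEq, if_true, if_false, BinOp.eval, BinOp.grows,
    Bool.false_eq_true, false_imp_iff, true_and, true_imp_iff, none_val, implies_true, Nat.or_zero,
    hT]
  refine wp_loop (fun j s' => s'.reg rSz = (blockOf j (s.arr aBig) (c * T)).length) trivial ?_ ?_ ?_
  · simp [blockOf]
  · intro j s' hj h hF
    have hO : s'.reg rOff = c * T := (hF.1 rOff (by decide)).trans (by simp)
    have hA : s'.arr aBig = s.arr aBig := (hF.2 aBig (by decide)).trans (by simp)
    simp only [wp_seq, wp_op, wp_load, wp_store, wp_push, wp_pop, wp_length, wp_input, wp_ite,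
      wp_skip, mov, Operand.get_reg, Operand.get_const, Mem.setReg_reg, Mem.setReg_arr,
      Mem.setArr_reg, Mem.setArr_arr, Fin.reduceEq, if_true, if_false, BinOp.eval, BinOp.grows,
      Bool.false_eq_true, false_imp_iff, true_and, true_imp_iff, none_val, implies_true, hO, hA, h,
      blockOf_succ]
    refine ⟨fun hz => ?_, fun hz => ?_⟩
    · rw [if_neg hz]; simp
    · rw [if_pos hz]; simp
  · intro s' h hF
    simp only [wp_seq, wp_op, wp_load, wp_store, wp_push, wp_pop, wp_length, wp_input, wp_ite,
      wp_skip, mov, Operand.get_reg, Operand.get_const, Mem.setReg_reg, Mem.setReg_arr,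
      Mem.setArr_reg, Mem.setArr_arr, Fin.reduceEq, if_true, if_false, BinOp.eval, BinOp.grows,
      Bool.false_eq_true, false_imp_iff, true_and, true_imp_iff, none_val, implies_true, hT] at h
    have hC : s'.reg rC = c := (hF.1 rC (by decide)).trans (by simp)
    have hA : s'.arr aLev = s.arr aLev := (hF.2 aLev (by decide)).trans (by simp)
    have hE : s'.arr aE = s.arr aE := (hF.2 aE (by decide)).trans (by simp)
    simp only [wp_seq, wp_op, wp_load, wp_store, wp_push, wp_pop, wp_length, wp_input, wp_ite,
      wp_skip, mov, Operand.get_reg, Operand.get_const, Mem.setReg_reg, Mem.setReg_arr,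
      Mem.setArr_reg, Mem.setArr_arr, Fin.reduceEq, if_true, if_false, BinOp.eval, BinOp.grows,
      Bool.false_eq_true, false_imp_iff, true_and, true_imp_iff, none_val, implies_true]
    refine hQ _ ?_
    simp [hE, hA, hC, h, estimateOf]

theorem countLoop_spec {E : ℕ → ℕ} {v : ℕ} (hE : s.arr aE = (List.range K).map E)
    (hK : s.reg rK = K) (hZ : s.reg rZ = v)
    (hQ : ∀ s', s'.reg rSz = countLe E v K → countLoop.Frame s s' → Q s') :
    countLoop.wp e Lim.none Q s := by
  refine wp_frame ?_
  simp only [countLoop, wp_seq, wp_op, wp_load, wp_store, wp_push, wp_pop, wp_length, wp_input,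
    wp_ite, wp_skip, mov, Operand.get_reg, Operand.get_const, Mem.setReg_reg, Mem.setReg_arr,
    Mem.setArr_reg, Mem.setArr_arr, Fin.reduceEq, if_true, if_false, BinOp.eval, BinOp.grows,
    Bool.false_eq_true, false_imp_iff, true_and, true_imp_iff, none_val, implies_true, Nat.or_zero]
  refine wp_loop (fun j s' => s'.reg rSz = countLe E v j) trivial ?_ ?_ ?_
  · simp [countLe]
  · intro j s' hj h hF
    simp only [wp_seq, wp_op, wp_load, wp_store, wp_push, wp_pop, wp_length, wp_input, wp_ite,
      wp_skip, mov, Operand.get_reg, Operand.get_const, Mem.setReg_reg, Mem.setReg_arr,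
      Mem.setArr_reg, Mem.setArr_arr, Fin.reduceEq, if_true, if_false, BinOp.eval, BinOp.grows,
      Bool.false_eq_true, false_imp_iff, true_and, true_imp_iff, none_val, implies_true, hK] at hj
    have hA : s'.arr aE = (List.range K).map E := (hF.2 aE (by decide)).trans (by simp [hE])
    have hZ' : s'.reg rZ = v := (hF.1 rZ (by decide)).trans (by simp [hZ])
    have hg : ((List.range K).map E).getD j 0 = E j := by
      rw [List.getD_eq_getElem _ _ (by simpa using hj)]; simp
    simp only [wp_seq, wp_op, wp_load, wp_store, wp_push, wp_pop, wp_length, wp_input, wp_ite,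
      wp_skip, mov, Operand.get_reg, Operand.get_const, Mem.setReg_reg, Mem.setReg_arr,
      Mem.setArr_reg, Mem.setArr_arr, Fin.reduceEq, if_true, if_false, BinOp.eval, BinOp.grows,
      Bool.false_eq_true, false_imp_iff, true_and, true_imp_iff, none_val, implies_true, hA, hZ', h,
      hg, countLe_succ]
    by_cases hv : v < E j
    · simp [hv]
    · simp [hv, Nat.not_lt.1 hv, Lim.none]
  · intro s' h hF
    simp only [wp_seq, wp_op, wp_load, wp_store, wp_push, wp_pop, wp_length, wp_input, wp_ite,
      wp_skip, mov, Operand.get_reg, Operand.get_const, Mem.setReg_reg, Mem.setReg_arr,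
      Mem.setArr_reg, Mem.setArr_arr, Fin.reduceEq, if_true, if_false, BinOp.eval, BinOp.grows,
      Bool.false_eq_true, false_imp_iff, true_and, true_imp_iff, none_val, implies_true, hK] at h
    exact hQ s' h

/-- At least half of the estimates are at most `v`. -/
def Upper (E : ℕ → ℕ) (K v : ℕ) : Prop := K ≤ 2 * countLe E v K

/-- The least number that is at least half of the estimates is as good as more than half of the
estimates are. -/
theorem median_mem {E : ℕ → ℕ} {lo hi : ℕ → Prop} [DecidablePred lo] [DecidablePred hi]
    (hlo : ∀ a b, a ≤ b → lo a → lo b)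
    (hhi : ∀ a b, a ≤ b → hi b → hi a)
    (h : K < 2 * ((Finset.range K).filter fun c => lo (E c) ∧ hi (E c)).card) :
    (∃ c < K, Upper E K (E c)) ∧
      ∀ c < K, Upper E K (E c) → (∀ c' < K, Upper E K (E c') → E c ≤ E c') →
        lo (E c) ∧ hi (E c) := by
  have hne : ((Finset.range K).filter fun c => lo (E c) ∧ hi (E c)).Nonempty := by
    rw [← Finset.card_pos]; omega
  obtain ⟨c₀, hc₀, hmax⟩ := Finset.exists_max_image _ E hne
  simp only [Finset.mem_filter, Finset.mem_range] at hc₀ hmax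
  have hU : Upper E K (E c₀) := by
    refine h.le.trans (Nat.mul_le_mul_left _ (Finset.card_le_card fun c hc => ?_))
    simp only [Finset.mem_filter, Finset.mem_range] at hc ⊢
    exact ⟨hc.1, hmax c hc⟩
  refine ⟨⟨c₀, hc₀.1, hU⟩, fun c hc hcU hmin => ⟨?_, hhi _ _ (hmin c₀ hc₀.1 hU) hc₀.2.2⟩⟩
  have hint : (((Finset.range K).filter fun c => lo (E c) ∧ hi (E c)) ∩
      ((Finset.range K).filter fun c' => E c' ≤ E c)).Nonempty := by
    rw [← Finset.card_pos]
    have h1 := Finset.card_union_add_card_inter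
      ((Finset.range K).filter fun c => lo (E c) ∧ hi (E c))
      ((Finset.range K).filter fun c' => E c' ≤ E c)
    have h2 := Finset.card_le_card (Finset.union_subset
      (Finset.filter_subset (fun c => lo (E c) ∧ hi (E c)) (Finset.range K))
      (Finset.filter_subset (fun c' => E c' ≤ E c) (Finset.range K)))
    rw [Finset.card_range] at h2
    unfold Upper countLe at hcU
    omega
  obtain ⟨c', hc'⟩ := hint
  simp only [Finset.mem_inter, Finset.mem_filter, Finset.mem_range] at hc'
  exact hlo _ _ hc'.2.2 hc'.1.2.1

/-- The output is the least estimate `v` with the property `Upper`, if there is one. -/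
theorem queryProg_spec (hT : s.reg rT = T) (hK : s.reg rK = K) (hA : s.arr aE = [])
    (hQ : ∀ s', ((∀ c < K, ¬Upper (estimateOf T s) K (estimateOf T s c)) ∨
      s'.reg rDen = 1 ∧ ∃ c < K, Upper (estimateOf T s) K (estimateOf T s c) ∧
        s'.reg rNum = estimateOf T s c ∧ ∀ c' < K, Upper (estimateOf T s) K (estimateOf T s c') →
          estimateOf T s c ≤ estimateOf T s c') → Q s') :
    queryProg.wp e Lim.none Q s := by
  simp only [queryProg, wp_seq]
  refine wp_loop (fun i s' => s'.arr aE = (List.range i).map (estimateOf T s)) trivial ?_ ?_ ?_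
  · simpa using hA
  · intro i s' hi h hF
    have hT' : s'.reg rT = T := (hF.1 rT (by decide)).trans hT
    refine estimate_spec hT' fun s'' h' _ => ?_
    have : estimateOf T s' = estimateOf T s := by
      funext c
      rw [estimateOf, estimateOf, hF.2 aBig (by decide), hF.2 aLev (by decide)]
    rw [h', h, List.range_succ, List.map_append, this]
    rfl
  intro s₁ h₁ F₁
  rw [Operand.get_reg, hK] at h₁
  have hK1 : s₁.reg rK = K := (F₁.1 rK (by decide)).trans hK
  simp only [wp_seq, wp_op, wp_load, wp_store, wp_push, wp_pop, wp_length, wp_input, wp_ite,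
    wp_skip, mov, Operand.get_reg, Operand.get_const, Mem.setReg_reg, Mem.setReg_arr,
    Mem.setArr_reg, Mem.setArr_arr, Fin.reduceEq, if_true, if_false, BinOp.eval, BinOp.grows,
    Bool.false_eq_true, false_imp_iff, true_and, true_imp_iff, none_val, implies_true, Nat.or_zero]
  generalize estimateOf T s = E at *
  refine wp_loop (fun i s' => (s'.reg rDen = 0 ∧ ∀ c < i, ¬Upper E K (E c)) ∨
    s'.reg rDen = 1 ∧ ∃ c < i, Upper E K (E c) ∧ s'.reg rNum = E c ∧
      ∀ c' < i, Upper E K (E c') → E c ≤ E c') trivial ?_ ?_ ?_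
  · left; simp
  · intro i s' hi h hF
    simp only [wp_seq, wp_op, wp_load, wp_store, wp_push, wp_pop, wp_length, wp_input, wp_ite,
      wp_skip, mov, Operand.get_reg, Operand.get_const, Mem.setReg_reg, Mem.setReg_arr,
      Mem.setArr_reg, Mem.setArr_arr, Fin.reduceEq, if_true, if_false, BinOp.eval, BinOp.grows,
      Bool.false_eq_true, false_imp_iff, true_and, true_imp_iff, none_val, implies_true, hK1] at hi
    have hA' : s'.arr aE = (List.range K).map E := (hF.2 aE (by decide)).trans (by simp [h₁])
    have hK' : s'.reg rK = K := (hF.1 rK (by decide)).trans (by simp [hK1])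
    have hg : ((List.range K).map E).getD i 0 = E i := by
      rw [List.getD_eq_getElem _ _ (by simpa using hi)]; simp
    simp only [wp_seq, wp_op, wp_load, wp_store, wp_push, wp_pop, wp_length, wp_input, wp_ite,
      wp_skip, mov, Operand.get_reg, Operand.get_const, Mem.setReg_reg, Mem.setReg_arr,
      Mem.setArr_reg, Mem.setArr_arr, Fin.reduceEq, if_true, if_false, BinOp.eval, BinOp.grows,
      Bool.false_eq_true, false_imp_iff, true_and, true_imp_iff, none_val, implies_true]
    refine countLoop_spec (E := E) (K := K) (v := E i) (by simpa using hA') (by simpa using hK')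
      (by simp only [Mem.setReg_reg, if_true, hA', hg]) fun s'' h'' hF'' => ?_
    have r : ∀ r, countLoop.modR r = false → r ≠ rZ → r ≠ rC → s''.reg r = s'.reg r :=
      fun r h1 h2 h3 => (hF''.1 r h1).trans (by simp [h2, h3])
    have rz : s''.reg rZ = E i :=
      (hF''.1 rZ (by decide)).trans (by simp only [Mem.setReg_reg, if_true, hA', hg])
    have rd := r rDen (by decide) (by decide) (by decide)
    have rn := r rNum (by decide) (by decide) (by decide)
    have rk := (r rK (by decide) (by decide) (by decide)).trans hK'
    simp only [wp_seq, wp_op, wp_load, wp_store, wp_push, wp_pop, wp_length, wp_input, wp_ite,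
      wp_skip, mov, Operand.get_reg, Operand.get_const, Mem.setReg_reg, Mem.setReg_arr,
      Mem.setArr_reg, Mem.setArr_arr, Fin.reduceEq, if_true, if_false, BinOp.eval, BinOp.grows,
      Bool.false_eq_true, false_imp_iff, true_and, true_imp_iff, none_val, implies_true, h'', rk,
      rz, rd, rn, Nat.or_zero]
    refine ⟨fun hlt => ?_, fun hlt => ?_⟩
    · have hnu : ¬Upper E K (E i) := by
        unfold Upper
        by_contra hc
        exact hlt (if_neg (by omega))
      rcases h with ⟨h1, h2⟩ | ⟨h1, c, hc, h2, h3, h4⟩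
      · refine Or.inl ⟨h1, fun c hc => ?_⟩
        rcases Nat.lt_succ_iff_lt_or_eq.1 hc with hc | rfl
        · exact h2 c hc
        · exact hnu
      · refine Or.inr ⟨h1, c, hc.trans (Nat.lt_succ_self i), h2, h3, fun c' hc' hu => ?_⟩
        rcases Nat.lt_succ_iff_lt_or_eq.1 hc' with hc' | rfl
        · exact h4 c' hc' hu
        · exact absurd hu hnu
    · have hu : Upper E K (E i) := by
        unfold Upper
        by_contra hc
        rw [if_pos (by omega)] at hlt
        exact one_ne_zero hlt
      rcases h with ⟨h1, h2⟩ | ⟨h1, c, hc, h2, h3, h4⟩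
      · have hne : (if E i < s'.reg rNum then 1 else 0) |||
              (if s'.reg rDen = 0 then 1 else 0) ≠ 0 := by
          rw [if_pos h1]; split_ifs <;> decide
        refine ⟨fun _ => Or.inr ⟨i, Nat.lt_succ_self i, hu, rfl, fun c' hc' hu' => ?_⟩,
          fun h0 => absurd h0 hne⟩
        rcases Nat.lt_succ_iff_lt_or_eq.1 hc' with hc' | rfl
        · exact absurd hu' (h2 c' hc')
        · exact le_rfl
      · rw [if_neg (c := s'.reg rDen = 0) (by omega), Nat.or_zero]
        refine ⟨fun hlt' => Or.inr ⟨i, Nat.lt_succ_self i, hu, rfl,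
          fun c' hc' hu' => ?_⟩, fun hlt' => Or.inr ⟨h1, c, hc.trans (Nat.lt_succ_self i), h2, h3,
            fun c' hc' hu' => ?_⟩⟩
        · have hlt'' : E i < s'.reg rNum := by
            by_contra hcon; exact hlt' (if_neg hcon)
          rcases Nat.lt_succ_iff_lt_or_eq.1 hc' with hc' | rfl
          · exact (hlt''.le.trans h3.le).trans (h4 c' hc' hu')
          · exact le_rfl
        · have hlt'' : ¬E i < s'.reg rNum := by
            intro hcon; rw [if_pos hcon] at hlt'; exact one_ne_zero hlt'
          rcases Nat.lt_succ_iff_lt_or_eq.1 hc' with hc' | rfl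
          · exact h4 c' hc' hu'
          · omega
  · intro s' h _
    simp only [wp_seq, wp_op, wp_load, wp_store, wp_push, wp_pop, wp_length, wp_input, wp_ite,
      wp_skip, mov, Operand.get_reg, Operand.get_const, Mem.setReg_reg, Mem.setReg_arr,
      Mem.setArr_reg, Mem.setArr_arr, Fin.reduceEq, if_true, if_false, BinOp.eval, BinOp.grows,
      Bool.false_eq_true, false_imp_iff, true_and, true_imp_iff, none_val, implies_true, hK1] at h
    refine hQ s' ?_
    rcases h with h | h
    · exact Or.inl h.2
    · exact Or.inr h

/-- If more than half of the copies have a good estimate, then so has the algorithm. -/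
theorem final_spec {p : Param → ℕ} {ω : ℕ → Bool} {lo hi : ℕ → Prop}
    [DecidablePred lo] [DecidablePred hi] {str : List (DRange n d)}
    {keys : List ℕ} {Us : ℕ → Finset ℕ} (hlo : ∀ a b, a ≤ b → lo a → lo b)
    (hhi : ∀ a b, a ≤ b → hi b → hi a)
    (hI : Inv n d T K keys Us (rangeAlg.state p ω str).mem)
    (h : K < 2 * ((Finset.range K).filter fun c =>
      lo (estimateOf T (rangeAlg.state p ω str).mem c) ∧
        hi (estimateOf T (rangeAlg.state p ω str).mem c)).card) :
    (rangeAlg.final p ω str).reg rDen = 1 ∧ lo ((rangeAlg.final p ω str).reg rNum) ∧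
      hi ((rangeAlg.final p ω str).reg rNum) := by
  obtain ⟨⟨c₀, hc₀, hu₀⟩, hm⟩ := median_mem hlo hhi h
  have key := wp_sound (c := rangeAlg.state p ω str) (queryProg_spec (e := ⟨p, fun _ => 0, ω⟩)
    hI.consts.hT hI.consts.hK hI.hE fun s' h => h)
  rcases key with key | ⟨hd, c, hc, hu, hn, hmin⟩
  · exact absurd hu₀ (key c₀ hc₀)
  · have := hm c hc hu hmin
    rw [← hn] at this
    exact ⟨hd, this⟩

end RangeSketch

namespace RangeSketch

/-! ### Pairwise independence of the hash functions -/

/-- If flipping bit `j` switches `f` and does not affect `p`, then `f` is `false` on one half of the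
keys with `p`. -/
theorem two_mul_card_filter {w j : ℕ} (hj : j < w) (p : ℕ → Prop) [DecidablePred p] (f : ℕ → Bool)
    (hp : ∀ H, p (H ^^^ 2 ^ j) ↔ p H) (hf : ∀ H, f (H ^^^ 2 ^ j) = !f H) :
    2 * ((Finset.range (2 ^ w)).filter fun H => f H = false ∧ p H).card =
      ((Finset.range (2 ^ w)).filter p).card := by
  have hlt : ∀ H < 2 ^ w, H ^^^ 2 ^ j < 2 ^ w := fun H h =>
    Nat.xor_lt_two_pow h (Nat.pow_lt_pow_right (by norm_num) hj)
  have h1 : ((Finset.range (2 ^ w)).filter fun H => f H = false ∧ p H).card =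
      ((Finset.range (2 ^ w)).filter fun H => ¬f H = false ∧ p H).card := by
    refine Finset.card_nbij' (· ^^^ 2 ^ j) (· ^^^ 2 ^ j) ?_ ?_ ?_ ?_
    · intro H hH
      simp only [Finset.coe_filter, Finset.mem_range, Set.mem_ofPred_eq] at hH ⊢
      exact ⟨hlt H hH.1, by simp [hf, hH.2.1], (hp H).2 hH.2.2⟩
    · intro H hH
      simp only [Finset.coe_filter, Finset.mem_range, Set.mem_ofPred_eq] at hH ⊢
      exact ⟨hlt H hH.1, by simpa [hf] using hH.2.1, (hp H).2 hH.2.2⟩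
    · intro H _
      simp
    · intro H _
      simp
  have h2 := Finset.card_filter_add_card_filter_not (s := (Finset.range (2 ^ w)).filter p)
    (fun H => f H = false)
  rw [Finset.filter_filter, Finset.filter_filter] at h2
  simp only [and_comm (a := p _)] at h2
  omega

/-- Bit `j` of the key occurs in bit `i` of the linear part with the coefficient `v.testBit (j -
i)`. -/
theorem hashBit_flip (H i v k j : ℕ) :
    hashBit (H ^^^ 2 ^ j) i v k =
      (hashBit H i v k).xor (decide (i ≤ j ∧ j < k + i) && v.testBit (j - i)) := by
  induction k with
  | zero =>
    have : ¬(i ≤ j ∧ j < 0 + i) := by omega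
    simp [hashBit, this]
  | succ k ih =>
    simp only [hashBit, ih, Nat.testBit_xor, Nat.testBit_two_pow]
    by_cases h : j = k + i
    · subst h
      have h2 : ¬(i ≤ k + i ∧ k + i < k + i) := by omega
      have h3 : i ≤ k + i ∧ k + i < k + 1 + i := by omega
      have h4 : k + i - i = k := by omega
      simp only [h2, h3, h4, decide_true, decide_false, and_self, Bool.false_and, Bool.true_and,
        Bool.xor_false]
      cases v.testBit k <;> simp
    · have h2 : (i ≤ j ∧ j < k + 1 + i) ↔ (i ≤ j ∧ j < k + i) := by omega
      simp only [h, h2, decide_false, Bool.xor_false, Bool.xor_assoc, Bool.xor_left_inj,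
        Bool.xor_right_inj]
      rw [Bool.xor_comm]

/-- Bit `i` of the hash value of `v`. -/
def valueBit (m H v i : ℕ) : Bool := (hashBit H i v m).xor (H.testBit (2 * m + i))

theorem entry_testBit_high {m H v i : ℕ} (hi : i < m) :
    (entry m H v).testBit (m + i) = valueBit m H v i := by
  have h1 : i ≠ m := hi.ne
  have h2 : m ≠ i := hi.ne'
  rw [entry, Nat.testBit_xor, aug, augTo_testBit_high hi le_rfl, valueBit]
  simp [offset, Nat.testBit_two_pow, h2]

theorem lowZero_entry {m H v l : ℕ} (hl : l ≤ m) :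
    LowZero m l (entry m H v) ↔ ∀ i < l, valueBit m H v i = false :=
  forall₂_congr fun i hi => by rw [entry_testBit_high (by omega)]

theorem hashBit_xor (H i x y k : ℕ) :
    hashBit H i (x ^^^ y) k = (hashBit H i x k).xor (hashBit H i y k) := by
  induction k with
  | zero => rfl
  | succ k ih =>
    simp only [hashBit, ih, Nat.testBit_xor]
    cases x.testBit k <;> cases y.testBit k <;> cases H.testBit (k + i) <;>
      cases hashBit H i x k <;> cases hashBit H i y k <;> rfl

theorem valueBit_flip {m H v i l : ℕ} (hi : i < m) :
    valueBit m (H ^^^ 2 ^ (2 * m + l)) v i = (valueBit m H v i).xor (decide (i = l)) := by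
  have h1 : ¬(i ≤ 2 * m + l ∧ 2 * m + l < m + i) := by omega
  have h2 : l = i ↔ i = l := eq_comm
  simp [valueBit, hashBit_flip, h1, Nat.testBit_xor, Nat.testBit_two_pow, h2]

/-- The number of keys for which `a` bits of the linear part vanish at `z`, and `b` bits of the hash
value vanish at `x`. Every condition halves the number, since it is switched by flipping one bit
of the key that does not occur in the conditions before: with `q` the top bit of `z`, bit `q + i`
for the linear part, and bit `2 * m + i` for the hash value. -/
theorem card_joint {m z x a b : ℕ} (hz : 0 < a → z ≠ 0 ∧ z < 2 ^ m) (ha : a ≤ m) (hb : b ≤ m) :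
    2 ^ (a + b) * ((Finset.range (2 ^ (3 * m))).filter fun H =>
      (∀ i < b, valueBit m H x i = false) ∧ ∀ i < a, hashBit H i z m = false).card =
      2 ^ (3 * m) := by
  have split : ∀ (k : ℕ) (g : ℕ → Bool), (∀ i < k + 1, g i = false) ↔
      g k = false ∧ ∀ i < k, g i = false := by
    intro k g
    simp only [Nat.lt_succ_iff_lt_or_eq, or_imp, forall_and, forall_eq]
    tauto
  induction b with
  | zero =>
    simp only [Nat.not_lt_zero, false_imp_iff, implies_true, true_and, Nat.add_zero]
    induction a with
    | zero => simp
    | succ a ih =>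
      obtain ⟨hz0, hzm⟩ := hz (Nat.succ_pos a)
      have hq := Nat.testBit_log2 hz0
      have hqm : z.log2 < m := (Nat.log2_lt hz0).2 hzm
      have e : ((Finset.range (2 ^ (3 * m))).filter fun H => ∀ i < a + 1, hashBit H i z m = false) =
          (Finset.range (2 ^ (3 * m))).filter fun H => hashBit H a z m = false ∧
            ∀ i < a, hashBit H i z m = false := Finset.filter_congr fun H _ => split a _
      have key := two_mul_card_filter (w := 3 * m) (j := z.log2 + a) (by omega)
        (fun H => ∀ i < a, hashBit H i z m = false) (fun H => hashBit H a z m)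
        (fun H => ?_) fun H => ?_
      · rw [e, pow_succ, Nat.mul_assoc, key]
        exact ih (fun _ => ⟨hz0, hzm⟩) (by omega)
      · refine forall₂_congr fun i hi => ?_
        have h1 : z.testBit (z.log2 + a - i) = false :=
          Nat.testBit_lt_two_pow (Nat.lt_log2_self.trans_le
            (Nat.pow_le_pow_right (by norm_num) (by omega)))
        simp [hashBit_flip, h1]
      · have h1 : a ≤ z.log2 + a ∧ z.log2 + a < m + a := by omega
        have h2 : z.log2 + a - a = z.log2 := by omega
        simp [hashBit_flip, h1, h2, hq]
  | succ b ih =>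
    have e : ((Finset.range (2 ^ (3 * m))).filter fun H =>
        (∀ i < b + 1, valueBit m H x i = false) ∧ ∀ i < a, hashBit H i z m = false) =
        (Finset.range (2 ^ (3 * m))).filter fun H => valueBit m H x b = false ∧
          (∀ i < b, valueBit m H x i = false) ∧ ∀ i < a, hashBit H i z m = false :=
      Finset.filter_congr fun H _ => by rw [split, and_assoc]
    have key := two_mul_card_filter (w := 3 * m) (j := 2 * m + b) (by omega)
      (fun H => (∀ i < b, valueBit m H x i = false) ∧ ∀ i < a, hashBit H i z m = false)
      (fun H => valueBit m H x b) (fun H => ?_) fun H => ?_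
    · rw [e, ← Nat.add_assoc, pow_succ, Nat.mul_assoc, key]
      exact ih (by omega)
    · refine and_congr (forall₂_congr fun i hi => ?_) (forall₂_congr fun i hi => ?_)
      · have h1 : i ≠ b := hi.ne
        rw [valueBit_flip (by omega)]
        simp [h1]
      · have h1 : ¬(i ≤ 2 * m + b ∧ 2 * m + b < m + i) := by omega
        simp [hashBit_flip, h1]
    · rw [valueBit_flip (by omega)]
      simp

theorem card_alive {m x l : ℕ} (hl : l ≤ m) :
    2 ^ l * ((Finset.range (2 ^ (3 * m))).filter fun H => LowZero m l (entry m H x)).card =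
      2 ^ (3 * m) := by
  have := card_joint (m := m) (z := 0) (x := x) (a := 0) (b := l) (by simp) (by omega) hl
  simpa [lowZero_entry hl] using this

/-- Two distinct points survive independently: given that `x` survives, `y` does as well if and only
if the linear part vanishes at `x ^^^ y`. -/
theorem card_alive_pair {m x y l : ℕ} (hx : x < 2 ^ m) (hy : y < 2 ^ m) (hxy : x ≠ y)
    (hl : l ≤ m) :
    2 ^ (l + l) * ((Finset.range (2 ^ (3 * m))).filter fun H =>
      LowZero m l (entry m H x) ∧ LowZero m l (entry m H y)).card = 2 ^ (3 * m) := by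
  have hz : x ^^^ y ≠ 0 := fun h => hxy (Nat.xor_eq_zero_iff.1 h)
  have key := card_joint (m := m) (z := x ^^^ y) (x := x) (a := l) (b := l)
    (fun _ => ⟨hz, Nat.xor_lt_two_pow hx hy⟩) hl hl
  refine Eq.trans (congrArg (fun S => 2 ^ (l + l) * Finset.card S)
    (Finset.filter_congr fun H _ => ?_)) key
  rw [lowZero_entry hl, lowZero_entry hl]
  refine and_congr_right fun h => forall₂_congr fun i hi => ?_
  have := h i hi
  rw [hashBit_xor]
  unfold valueBit at this ⊢
  revert this
  cases hashBit H i x m <;> cases hashBit H i y m <;> cases H.testBit (2 * m + i) <;> simp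

/-! ### The second moment of the sample size -/

/-- The number of points of `U` that survive at level `l`. -/
def aliveCount (m H : ℕ) (U : Finset ℕ) (l : ℕ) : ℕ :=
  (U.filter fun v => LowZero m l (entry m H v)).card

theorem survivors_card (m H : ℕ) (U : Finset ℕ) (l : ℕ) :
    (survivors m H U l).card = aliveCount m H U l := by
  rw [survivors, Multiset.filter_map, Multiset.card_map]
  rfl

/-- The mean number of survivors. -/
theorem sum_aliveCount {m l : ℕ} (U : Finset ℕ) (hl : l ≤ m) :
    2 ^ l * ∑ H ∈ Finset.range (2 ^ (3 * m)), aliveCount m H U l = 2 ^ (3 * m) * U.card := by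
  simp only [aliveCount, Finset.card_filter]
  rw [Finset.sum_comm]
  simp only [← Finset.card_filter]
  rw [Finset.mul_sum, Finset.sum_congr rfl fun x _ => card_alive hl, Finset.sum_const, smul_eq_mul,
    Nat.mul_comm]

/-- The second moment of the number of survivors: the diagonal contributes the mean, and pairs of
distinct points the square of the mean. -/
theorem sum_aliveCount_sq {m l : ℕ} {U : Finset ℕ} (hU : U ⊆ Finset.range (2 ^ m)) (hl : l ≤ m) :
    2 ^ l * 2 ^ l * ∑ H ∈ Finset.range (2 ^ (3 * m)), aliveCount m H U l ^ 2 ≤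
      2 ^ (3 * m) * (2 ^ l * U.card + U.card ^ 2) := by
  have e : ∀ H, aliveCount m H U l ^ 2 = ∑ x ∈ U, ∑ y ∈ U,
      if LowZero m l (entry m H x) ∧ LowZero m l (entry m H y) then 1 else 0 := by
    intro H
    rw [sq, aliveCount, Finset.card_filter, Finset.sum_mul_sum]
    refine Finset.sum_congr rfl fun x _ => Finset.sum_congr rfl fun y _ => ?_
    split_ifs <;> simp_all
  simp only [e]
  rw [Finset.sum_comm]
  simp only [Finset.sum_comm (s := Finset.range (2 ^ (3 * m)))]
  simp only [← Finset.card_filter]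
  rw [Finset.mul_sum]
  have key : ∀ x ∈ U, 2 ^ l * 2 ^ l * ∑ y ∈ U, ((Finset.range (2 ^ (3 * m))).filter fun H =>
      LowZero m l (entry m H x) ∧ LowZero m l (entry m H y)).card ≤
        2 ^ (3 * m) * (2 ^ l + U.card) := by
    intro x hx
    rw [Finset.mul_sum, ← Finset.add_sum_erase _ _ hx, Nat.mul_add]
    refine Nat.add_le_add (le_of_eq ?_) ?_
    · simp only [and_self]
      rw [Nat.mul_assoc, card_alive hl, Nat.mul_comm]
    · have : ∀ y ∈ U.erase x, 2 ^ l * 2 ^ l * ((Finset.range (2 ^ (3 * m))).filter fun H =>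
          LowZero m l (entry m H x) ∧ LowZero m l (entry m H y)).card = 2 ^ (3 * m) := by
        intro y hy
        rw [← pow_add]
        exact card_alive_pair (Finset.mem_range.1 (hU hx))
          (Finset.mem_range.1 (hU (Finset.mem_of_mem_erase hy))) (Finset.ne_of_mem_erase hy).symm hl
      rw [Finset.sum_congr rfl this, Finset.sum_const, smul_eq_mul, Nat.mul_comm]
      exact Nat.mul_le_mul_left _ (Finset.card_le_card (Finset.erase_subset _ _))
  refine (Finset.sum_le_sum key).trans (le_of_eq ?_)
  rw [Finset.sum_const, smul_eq_mul]
  ring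

/-- The variance of the estimate at level `l`, multiplied by the number of keys. -/
theorem sum_sq_deviation {m l : ℕ} {U : Finset ℕ} (hU : U ⊆ Finset.range (2 ^ m)) (hl : l ≤ m) :
    ∑ H ∈ Finset.range (2 ^ (3 * m)), ((2 : ℝ) ^ l * aliveCount m H U l - U.card) ^ 2 ≤
      2 ^ (3 * m) * (2 ^ l * U.card) := by
  have h1 : (2 : ℝ) ^ l * ∑ H ∈ Finset.range (2 ^ (3 * m)), (aliveCount m H U l : ℝ) =
      2 ^ (3 * m) * U.card := by exact_mod_cast sum_aliveCount U hl
  have h2 : (2 : ℝ) ^ l * 2 ^ l * ∑ H ∈ Finset.range (2 ^ (3 * m)), (aliveCount m H U l : ℝ) ^ 2 ≤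
      2 ^ (3 * m) * (2 ^ l * U.card + (U.card : ℝ) ^ 2) := by
    exact_mod_cast sum_aliveCount_sq hU hl
  have e : ∀ H, ((2 : ℝ) ^ l * aliveCount m H U l - U.card) ^ 2 =
      2 ^ l * 2 ^ l * (aliveCount m H U l : ℝ) ^ 2 -
        2 * U.card * (2 ^ l * aliveCount m H U l) + (U.card : ℝ) ^ 2 := fun H => by ring
  simp only [e, Finset.sum_add_distrib, Finset.sum_sub_distrib, ← Finset.mul_sum,
    Finset.sum_const, Finset.card_range, nsmul_eq_mul]
  push_cast
  rw [h1]
  linarith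

/-- Chebyshev's inequality for the estimate at level `l`. -/
theorem card_deviation {m l : ℕ} {U : Finset ℕ} (hU : U ⊆ Finset.range (2 ^ m)) (hl : l ≤ m)
    {t : ℝ} (ht : 0 ≤ t) :
    (((Finset.range (2 ^ (3 * m))).filter fun H =>
      t < |(2 : ℝ) ^ l * aliveCount m H U l - U.card|).card : ℝ) * t ^ 2 ≤
      2 ^ (3 * m) * (2 ^ l * U.card) := by
  refine le_trans ?_ (sum_sq_deviation hU hl)
  rw [← nsmul_eq_mul]
  refine (Finset.card_nsmul_le_sum _ _ _ fun H hH => ?_).trans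
    (Finset.sum_le_sum_of_subset_of_nonneg (Finset.filter_subset _ _) fun _ _ _ => sq_nonneg _)
  rw [← sq_abs ((2 : ℝ) ^ l * _ - _)]
  exact pow_le_pow_left₀ ht (Finset.mem_filter.1 hH).2.le 2

end RangeSketch

namespace RangeSketch

open MeasureTheory

/-! ### A single copy is good with probability at least `15 / 16` -/

/-- The estimate `v` for the cardinality `F` is accurate up to a factor `1 + ε`. -/
def Accurate (ε : ℝ) (F v : ℕ) : Prop := (F : ℝ) / (1 + ε) ≤ v ∧ (v : ℝ) ≤ (1 + ε) * F

theorem Sample.length_eq {m T H l : ℕ} {U V : Finset ℕ} {X : List ℕ} (h : Sample m T H U V l X) :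
    X.length = aliveCount m H U l := by
  rw [← survivors_card, ← h.eq, Multiset.coe_card]

/-- A set that fits into the sample is stored completely. -/
theorem Sample.estimate_of_card_le {m T H l : ℕ} {U : Finset ℕ} {X : List ℕ}
    (h : Sample m T H U U l X) (hU : U.card ≤ T) : X.length <<< l = U.card := by
  have h0 : aliveCount m H U 0 = U.card := by simp [aliveCount, LowZero]
  have hl : l = 0 := by
    by_contra hl
    have := h.least 0 (by omega)
    rw [survivors_card, h0] at this
    omega
  rw [h.length_eq, hl, h0, Nat.shiftLeft_zero]

theorem accurate_self {ε : ℝ} (hε : 0 < ε) (F : ℕ) : Accurate ε F F := by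
  have hF : (0 : ℝ) ≤ F := Nat.cast_nonneg F
  constructor
  · rw [div_le_iff₀ (by linarith)]; nlinarith
  · nlinarith

/-- For all but one in sixteen keys, the estimate is accurate. With `q` the least level at which at
most half of the capacity is expected to be used, the estimates at all levels up to `q` are
accurate for such a key, and the level does not exceed `q`. -/
theorem exists_bad_keys {m N : ℕ} {U : Finset ℕ} (hU : U ⊆ Finset.range (2 ^ m)) {ε : ℝ}
    (hε : 0 < ε) (hN : 1 / ε ≤ N) (hN1 : 1 ≤ N) :
    ∃ B : Finset ℕ, 16 * B.card ≤ 2 ^ (3 * m) ∧ ∀ H < 2 ^ (3 * m), H ∉ B → ∀ l X,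
      Sample m (N * N * 512) H U U l X → Accurate ε U.card (X.length <<< l) := by
  classical
  by_cases hUT : U.card ≤ N * N * 512
  · refine ⟨∅, by simp, fun H _ _ l X h => ?_⟩
    rw [h.estimate_of_card_le hUT]
    exact accurate_self hε _
  have hT : 512 ≤ N * N * 512 := Nat.le_mul_of_pos_left _ (Nat.mul_pos hN1 hN1)
  have hNR : (1 : ℝ) ≤ N := by exact_mod_cast hN1
  set F := U.card with hF
  have hF0 : 0 < F := by omega
  have hFm : F ≤ 2 ^ m := by simpa using Finset.card_le_card hU
  have hex : ∃ q, 2 * F ≤ N * N * 512 * 2 ^ q :=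
    ⟨m, Nat.mul_le_mul (by omega) hFm⟩
  -- The least level at which at most half of the capacity is expected to be used. It exists, and is
  -- at most `m`, since at most one point is expected to survive at level `m`.
  obtain ⟨q, hq, hqmin⟩ : ∃ q, 2 * F ≤ N * N * 512 * 2 ^ q ∧
      ∀ q' < q, ¬2 * F ≤ N * N * 512 * 2 ^ q' :=
    ⟨Nat.find hex, Nat.find_spec hex, fun _ h => Nat.find_min hex h⟩
  have hqm : q ≤ m := by
    by_contra h
    exact hqmin m (by omega) (Nat.mul_le_mul (by omega) hFm)
  have hq4 : N * N * 512 * 2 ^ q ≤ 4 * F := by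
    rcases q with _ | q
    · omega
    · have := hqmin q (Nat.lt_succ_self q)
      rw [pow_succ]
      nlinarith
  -- The relative error `η` corresponds to the lower bound `F / (1 + ε) = (1 - η) * F`.
  set η : ℝ := ε / (1 + ε) with hη
  have hη0 : 0 < η := by positivity
  have hη1 : η ≤ 1 := by rw [hη, div_le_one (by positivity)]; linarith
  have hηN : 1 ≤ 2 * N * η := by
    rw [div_le_iff₀ hε] at hN
    rw [hη, ← mul_div_assoc, le_div_iff₀ (by positivity)]
    nlinarith
  have hηN2 : 1 ≤ 4 * (N * N) * (η * η) := by nlinarith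
  have hFR : (0 : ℝ) < F := by exact_mod_cast hF0
  have hq4R : (N : ℝ) * N * 512 * 2 ^ q ≤ 4 * F := by exact_mod_cast hq4
  -- This is where the factor `512 = 4 * 4 * 32` in the capacity is used: one factor `4` is the loss
  -- in `hq4`, the other one the loss in `hηN2`.
  have hkey : (32 : ℝ) * 2 ^ q ≤ η * η * F := by
    have h1 : (1 : ℝ) * (2 ^ q * 128) ≤ 4 * (N * N) * (η * η) * (2 ^ q * 128) := by gcongr
    have h2 : η * η * (N * N * 512 * 2 ^ q) ≤ η * η * (4 * F) := by gcongr
    nlinarith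
  -- The keys for which the estimate at level `l` is inaccurate. By Chebyshev's inequality their
  -- share is at most `2 ^ l / (η ^ 2 * F)`; the sum over `l ≤ q` is at most twice its last term.
  let D : ℕ → Finset ℕ := fun l => (Finset.range (2 ^ (3 * m))).filter fun H =>
    η * F < |(2 : ℝ) ^ l * aliveCount m H U l - U.card|
  refine ⟨(Finset.range (q + 1)).biUnion D, ?_, ?_⟩
  · have h1 : (((Finset.range (q + 1)).biUnion D).card : ℝ) * (η * F) ^ 2 ≤
        2 ^ (3 * m) * F * (2 * 2 ^ q) := by
      calc (((Finset.range (q + 1)).biUnion D).card : ℝ) * (η * F) ^ 2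
          ≤ (∑ l ∈ Finset.range (q + 1), ((D l).card : ℝ)) * (η * F) ^ 2 := by
            gcongr
            exact_mod_cast Finset.card_biUnion_le
        _ = ∑ l ∈ Finset.range (q + 1), ((D l).card : ℝ) * (η * F) ^ 2 := Finset.sum_mul _ _ _
        _ ≤ ∑ l ∈ Finset.range (q + 1), (2 : ℝ) ^ (3 * m) * (2 ^ l * F) :=
            Finset.sum_le_sum fun l hl => card_deviation hU
              ((Nat.lt_succ_iff.1 (Finset.mem_range.1 hl)).trans hqm) (by positivity)
        _ = 2 ^ (3 * m) * F * ∑ l ∈ Finset.range (q + 1), (2 : ℝ) ^ l := by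
            rw [Finset.mul_sum]
            exact Finset.sum_congr rfl fun l _ => by ring
        _ ≤ 2 ^ (3 * m) * F * (2 * 2 ^ q) := by
            gcongr
            rw [geom_sum_eq (by norm_num), pow_succ]
            linarith
    have h2 : (16 * ((Finset.range (q + 1)).biUnion D).card : ℝ) * (2 * 2 ^ q * F) ≤
        2 ^ (3 * m) * (2 * 2 ^ q * F) := by
      calc (16 * ((Finset.range (q + 1)).biUnion D).card : ℝ) * (2 * 2 ^ q * F)
          = ((Finset.range (q + 1)).biUnion D).card * (32 * 2 ^ q * F) := by ring
        _ ≤ ((Finset.range (q + 1)).biUnion D).card * (η * η * F * F) := by gcongr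
        _ = ((Finset.range (q + 1)).biUnion D).card * (η * F) ^ 2 := by ring
        _ ≤ _ := h1.trans (le_of_eq (by ring))
    exact_mod_cast le_of_mul_le_mul_right h2 (by positivity)
  · intro H hH hB l X hS
    have hgood : ∀ l ≤ q, |(2 : ℝ) ^ l * aliveCount m H U l - F| ≤ η * F := by
      intro l hl
      by_contra hcon
      exact hB (Finset.mem_biUnion.2 ⟨l, Finset.mem_range.2 (Nat.lt_succ_of_le hl),
        Finset.mem_filter.2 ⟨Finset.mem_range.2 hH, not_le.1 hcon⟩⟩)
    -- By accuracy at level `q`, the points that survive there fit into the sample.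
    have hlq : l ≤ q := by
      by_contra hcon
      have h1 := hS.least q (not_le.1 hcon)
      rw [survivors_card] at h1
      have h2 := (abs_le.1 (hgood q le_rfl)).2
      have h3 : (2 : ℝ) * F ≤ N * N * 512 * 2 ^ q := by exact_mod_cast hq
      have h4 : (N * N * 512 + 1 : ℝ) ≤ aliveCount m H U q := by exact_mod_cast h1
      have h5 : (0 : ℝ) < 2 ^ q := by positivity
      nlinarith
    have h := abs_le.1 (hgood l hlq)
    have hv : ((X.length <<< l : ℕ) : ℝ) = 2 ^ l * aliveCount m H U l := by
      rw [hS.length_eq, Nat.shiftLeft_eq]; push_cast; ring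
    have hdiv : (F : ℝ) / (1 + ε) = F - η * F := by rw [hη]; field_simp; ring
    have hηε : η * F ≤ ε * F := by
      gcongr
      rw [hη, div_le_iff₀ (by positivity)]
      nlinarith
    exact ⟨by rw [hv, hdiv]; linarith [h.1], by rw [hv]; linarith [h.2]⟩

/-! ### Amplification -/

/-- Among the vectors of `K` keys below `R`, at most one in `2 ^ K` has at least half of its entries
in a set `B` that contains at most one sixteenth of the keys. -/
theorem card_fail_le {K R : ℕ} {B : Finset ℕ} (hB : 16 * B.card ≤ R) :
    2 ^ K * ((Fintype.piFinset fun _ : Fin K => Finset.range R).filter fun k =>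
      K ≤ 2 * (Finset.univ.filter fun c => k c ∈ B).card).card ≤ R ^ K := by
  classical
  have hone : ∀ S : Finset (Fin K), K ≤ 2 * S.card →
      4 ^ K * (Fintype.piFinset fun c => if c ∈ S then B else Finset.range R).card ≤ R ^ K := by
    intro S hS
    have h16 : 4 ^ K ≤ ∏ c : Fin K, if c ∈ S then 16 else 1 := by
      rw [Finset.prod_ite_mem, Finset.univ_inter, Finset.prod_const,
        show (16 : ℕ) = 4 ^ 2 by norm_num, ← pow_mul]
      exact Nat.pow_le_pow_right (by norm_num) hS
    rw [Fintype.card_piFinset]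
    refine (Nat.mul_le_mul_right _ h16).trans ?_
    rw [← Finset.prod_mul_distrib]
    calc _ ≤ ∏ _c : Fin K, R := by
          refine Finset.prod_le_prod' fun c _ => ?_
          split_ifs
          · exact hB
          · simp
      _ = R ^ K := by simp
  have hsub : ((Fintype.piFinset fun _ : Fin K => Finset.range R).filter fun k =>
      K ≤ 2 * (Finset.univ.filter fun c => k c ∈ B).card) ⊆
      ((Finset.univ : Finset (Finset (Fin K))).filter fun S => K ≤ 2 * S.card).biUnion fun S =>
        Fintype.piFinset fun c => if c ∈ S then B else Finset.range R := by
    intro k hk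
    rw [Finset.mem_filter, Fintype.mem_piFinset] at hk
    refine Finset.mem_biUnion.2 ⟨Finset.univ.filter fun c => k c ∈ B, by simpa using hk.2, ?_⟩
    rw [Fintype.mem_piFinset]
    intro c
    split_ifs with hc
    · simpa using hc
    · exact hk.1 c
  have h1 : 4 ^ K * ((Fintype.piFinset fun _ : Fin K => Finset.range R).filter fun k =>
      K ≤ 2 * (Finset.univ.filter fun c => k c ∈ B).card).card ≤ 2 ^ K * R ^ K := by
    refine (Nat.mul_le_mul_left _
      ((Finset.card_le_card hsub).trans Finset.card_biUnion_le)).trans ?_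
    rw [Finset.mul_sum]
    refine (Finset.sum_le_card_nsmul _ _ (R ^ K) fun S hS =>
      hone S (Finset.mem_filter.1 hS).2).trans ?_
    rw [smul_eq_mul]
    refine Nat.mul_le_mul_right _ ((Finset.card_filter_le _ _).trans (le_of_eq ?_))
    simp
  rw [show (4 : ℕ) = 2 * 2 by norm_num, mul_pow, Nat.mul_assoc] at h1
  exact Nat.le_of_mul_le_mul_left h1 (by positivity)

/-! ### The distribution of the keys -/

instance : IsProbabilityMeasure coinMeasure := by
  unfold coinMeasure; infer_instance

theorem coinVal_testBit (ω : ℕ → Bool) (p : ℕ) {k j : ℕ} (hj : j < k) :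
    (coinVal ω p k).testBit j = ω (p + (k - 1 - j)) := by
  induction k generalizing j with
  | zero => omega
  | succ k ih =>
    have hb := Bool.toNat_lt (ω (p + k))
    rcases j with _ | j
    · rw [coinVal, Nat.testBit_zero]
      cases h : ω (p + k) <;> simp [Nat.add_mod, h]
    · have : (2 * coinVal ω p k + (ω (p + k)).toNat) / 2 = coinVal ω p k := by omega
      rw [coinVal, Nat.testBit_succ, this, ih (by omega)]
      congr 2
      omega

/-- Every vector of keys determines all random bits that it is read from. -/
theorem coinMeasure_keys_le {q K : ℕ} (hq : 0 < q) (k : Fin K → ℕ) :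
    coinMeasure.real {ω | ∀ c : Fin K, coinVal ω (q * c) q = k c} ≤ (1 / 2) ^ (q * K) := by
  let t : ℕ → Set Bool := fun i =>
    if h : i / q < K then {(k ⟨i / q, h⟩).testBit (q - 1 - i % q)} else Set.univ
  have hsub : {ω : ℕ → Bool | ∀ c : Fin K, coinVal ω (q * c) q = k c} ⊆
      Set.pi (Finset.range (q * K)) t := by
    intro ω hω i hi
    have hi' : i / q < K := by
      rw [Nat.div_lt_iff_lt_mul hq, Nat.mul_comm]; exact Finset.mem_range.1 hi
    have hm := Nat.mod_lt i hq
    have h1 := hω ⟨i / q, hi'⟩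
    simp only [t, dif_pos hi', Set.mem_singleton_iff]
    rw [← h1, coinVal_testBit _ _ (by omega)]
    have h2 := Nat.div_add_mod i q
    have h3 : q * (i / q) + (q - 1 - (q - 1 - i % q)) = i := by omega
    exact (congrArg ω h3).symm
  have hpi : coinMeasure (Set.pi (Finset.range (q * K)) t) =
      ∏ i ∈ Finset.range (q * K), (PMF.uniformOfFintype Bool).toMeasure (t i) :=
    Measure.infinitePi_pi _ fun i _ => MeasurableSet.of_discrete
  have hprod : ∀ i ∈ Finset.range (q * K), (PMF.uniformOfFintype Bool).toMeasure (t i) = 2⁻¹ := by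
    intro i hi
    have hi' : i / q < K := by
      rw [Nat.div_lt_iff_lt_mul hq, Nat.mul_comm]; exact Finset.mem_range.1 hi
    simp only [t, dif_pos hi']
    rw [PMF.toMeasure_apply_singleton _ _ (MeasurableSet.singleton _)]
    simp
  rw [Finset.prod_congr rfl hprod, Finset.prod_const, Finset.card_range] at hpi
  refine (measureReal_mono hsub).trans (le_of_eq ?_)
  rw [measureReal_def, hpi]
  simp

/-- At least half of the copies are bad with probability at most `2 ^ (-K)`. -/
theorem coinMeasure_fail_le {q K : ℕ} (hq : 0 < q) {B : Finset ℕ} (hB : 16 * B.card ≤ 2 ^ q) :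
    coinMeasure.real {ω | K ≤ 2 * ((Finset.range K).filter fun c => coinVal ω (q * c) q ∈ B).card} ≤
      (1 / 2) ^ K := by
  set A := (Fintype.piFinset fun _ : Fin K => Finset.range (2 ^ q)).filter fun k =>
      K ≤ 2 * (Finset.univ.filter fun c => k c ∈ B).card with hA
  have hsub : {ω | K ≤ 2 * ((Finset.range K).filter fun c => coinVal ω (q * c) q ∈ B).card} ⊆
      ⋃ k ∈ A, {ω | ∀ c : Fin K, coinVal ω (q * c) q = k c} := by
    intro ω hω
    refine Set.mem_iUnion₂.2 ⟨fun c => coinVal ω (q * c) q, ?_, fun _ => rfl⟩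
    rw [hA, Finset.mem_filter, Fintype.mem_piFinset]
    refine ⟨fun c => Finset.mem_range.2 (coinVal_lt _ _ _), ?_⟩
    have : ((Finset.range K).filter fun c => coinVal ω (q * c) q ∈ B).card =
        (Finset.univ.filter fun c : Fin K => coinVal ω (q * c) q ∈ B).card := by
      rw [Finset.card_filter, Finset.card_filter, Finset.sum_range]
    rw [← this]
    exact hω
  refine (measureReal_mono hsub (measure_ne_top _ _)).trans
    ((measureReal_biUnion_finset_le _ _).trans ?_)
  refine (Finset.sum_le_card_nsmul _ _ _ fun k _ => coinMeasure_keys_le hq k).trans ?_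
  have h := card_fail_le (K := K) hB
  rw [← hA, ← pow_mul] at h
  have h' : (2 : ℝ) ^ K * A.card ≤ 2 ^ (q * K) := by exact_mod_cast h
  rw [nsmul_eq_mul, one_div, inv_pow, inv_pow, ← div_eq_mul_inv, div_le_iff₀ (by positivity),
    ← div_eq_inv_mul, le_div_iff₀ (by positivity)]
  linarith

theorem half_pow_le {δ : ℝ} (hδ : 0 < δ) : (1 / 2 : ℝ) ^ ⌈Real.logb 2 (1 / δ)⌉₊ ≤ δ := by
  have h : 1 / δ ≤ (2 : ℝ) ^ ⌈Real.logb 2 (1 / δ)⌉₊ := by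
    rw [← Real.rpow_natCast, ← Real.logb_le_iff_le_rpow one_lt_two (by positivity)]
    exact Nat.le_ceil _
  rw [one_div, inv_pow]
  refine inv_le_of_inv_le₀ hδ ?_
  rwa [← one_div]

/-! ### Correctness of the algorithm -/

/-- All but an event of probability `δ` leaves more than half of the keys outside of a set `B`
that contains all keys with an inaccurate estimate. -/
theorem exists_bad_event {n d : ℕ} {ε δ : ℝ} (hn : 1 ≤ n) (hd : 1 ≤ d) (hε : 0 < ε) (hδ : 0 < δ)
    {N L : ℕ} (hNε : N = ⌈1 / ε⌉₊) (hLδ : L = ⌈Real.logb 2 (1 / δ)⌉₊) {U : Finset ℕ}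
    (hU : U ⊆ Finset.range (2 ^ (n * d))) :
    ∃ B : Finset ℕ, coinMeasure.real {ω | copies N L (n * d) ≤ 2 * ((Finset.range
        (copies N L (n * d))).filter fun c =>
          coinVal ω (3 * (n * d) * c) (3 * (n * d)) ∈ B).card} ≤ δ ∧
      ∀ H < 2 ^ (3 * (n * d)), H ∉ B → ∀ l X,
        Sample (n * d) (capacity N L (n * d)) H U U l X → Accurate ε U.card (X.length <<< l) := by
  have hq : 0 < 3 * (n * d) := by have := Nat.mul_pos hn hd; omega
  unfold copies capacity
  split_ifs with h
  · obtain ⟨B, h1, h2⟩ := exists_bad_keys hU hε (hNε ▸ Nat.le_ceil (1 / ε))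
      (hNε ▸ one_le_ceil_inv hε)
    exact ⟨B, (coinMeasure_fail_le hq h1).trans (hLδ ▸ half_pow_le hδ), h2⟩
  · refine ⟨∅, ?_, fun H _ _ l X hS => ?_⟩
    · simpa using hδ.le
    · rw [hS.estimate_of_card_le (by simpa using Finset.card_le_card hU)]
      exact accurate_self hε _

open Classical in
/-- If fewer than half of the keys lie in `B`, then the output is accurate. -/
theorem succeeds_of_good {n d : ℕ} {ε δ : ℝ} (hn : 1 ≤ n) (hd : 1 ≤ d) (hε : 0 < ε) (hδ : 0 < δ)
    (hδ1 : δ < 1) {N L : ℕ} (hNε : N = ⌈1 / ε⌉₊) (hLδ : L = ⌈Real.logb 2 (1 / δ)⌉₊)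
    {s : List (DRange n d)} {B : Finset ℕ}
    (hB : ∀ H < 2 ^ (3 * (n * d)), H ∉ B → ∀ l X,
      Sample (n * d) (capacity N L (n * d)) H (codes s) (codes s) l X →
        Accurate ε (codes s).card (X.length <<< l)) {ω : ℕ → Bool}
    (hω : 2 * ((Finset.range (copies N L (n * d))).filter fun c =>
      coinVal ω (3 * (n * d) * c) (3 * (n * d)) ∈ B).card < copies N L (n * d)) :
    rangeAlg.Succeeds (params n d ε δ) ω s ε := by
  have hN : 1 ≤ N := hNε ▸ one_le_ceil_inv hε
  have hL : 1 ≤ L := hLδ ▸ one_le_ceil_logb hδ hδ1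
  obtain ⟨hI, -⟩ := state_spec (p := params n d ε δ) (ω := ω) hN hL hn hd rfl rfl hNε.symm
    hLδ.symm s
  have key : ∀ c < copies N L (n * d), coinVal ω (3 * (n * d) * c) (3 * (n * d)) ∉ B →
      Accurate ε (codes s).card
        (estimateOf (capacity N L (n * d)) (rangeAlg.state (params n d ε δ) ω s).mem c) := by
    intro c hc hcB
    have hS := hI.sample c hc
    have hk : (keysOf ω (3 * (n * d)) (copies N L (n * d))).getD c 0 =
        coinVal ω (3 * (n * d) * c) (3 * (n * d)) := by
      rw [List.getD_eq_getElem _ _ (by simpa [keysOf] using hc)]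
      simp [keysOf]
    rw [hk] at hS
    exact hB _ (coinVal_lt _ _ _) hcB _ _ hS
  have hcard := Finset.card_filter_add_card_filter_not
    (s := Finset.range (copies N L (n * d)))
    (fun c => coinVal ω (3 * (n * d) * c) (3 * (n * d)) ∈ B)
  rw [Finset.card_range] at hcard
  have hfin := final_spec (p := params n d ε δ) (ω := ω)
    (lo := fun v : ℕ => ((codes s).card : ℝ) / (1 + ε) ≤ v)
    (hi := fun v : ℕ => (v : ℝ) ≤ (1 + ε) * (codes s).card)
    (fun a b hab h => h.trans (Nat.cast_le.2 hab)) (fun a b hab h => (Nat.cast_le.2 hab).trans h) hI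
    (by
      refine lt_of_lt_of_le ?_ (Nat.mul_le_mul_left 2 (Finset.card_le_card
        (s := (Finset.range (copies N L (n * d))).filter fun c =>
          ¬coinVal ω (3 * (n * d) * c) (3 * (n * d)) ∈ B) fun c hc => ?_))
      · omega
      · rw [Finset.mem_filter, Finset.mem_range] at hc ⊢
        exact ⟨hc.1, key c hc.1 hc.2⟩)
  obtain ⟨h1, h2, h3⟩ := hfin
  have hden : (rangeAlg.final (params n d ε δ) ω s).reg rangeAlg.outDen = 1 := h1
  refine ⟨by rw [hden]; exact one_pos, ?_, ?_⟩
  · rw [hden, F0_eq_card, Nat.cast_one, div_one]; exact h2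
  · rw [hden, F0_eq_card, Nat.cast_one, div_one]; exact h3

theorem success_probability (n d : ℕ) (ε δ : ℝ) (hn : 1 ≤ n) (hd : 1 ≤ d) (hε : 0 < ε) (hδ : 0 < δ)
    (hδ1 : δ ≤ 1) (s : List (DRange n d)) :
    1 - δ ≤ coinMeasure.real {ω | rangeAlg.Succeeds (params n d ε δ) ω s ε} := by
  rcases hδ1.eq_or_lt with rfl | hlt
  · rw [sub_self]; exact measureReal_nonneg
  obtain ⟨B, h1, h2⟩ := exists_bad_event hn hd hε hδ rfl rfl (codes_subset s)
  have hcover : (Set.univ : Set (ℕ → Bool)) ⊆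
      {ω | rangeAlg.Succeeds (params n d ε δ) ω s ε} ∪ _ := fun ω _ =>
    (lt_or_ge _ _).imp (succeeds_of_good hn hd hε hδ hlt rfl rfl h2) id
  have h3 := (measureReal_mono (μ := coinMeasure) hcover).trans (measureReal_union_le _ _)
  rw [probReal_univ] at h3
  linarith [h3.trans (add_le_add_right h1 _)]

end RangeSketch

/-- There is one streaming algorithm that, for all parameters, gives an `(ε, δ)`-approximation of
`F₀` over `d`-dimensional ranges, and whose space (number of bits stored between items) and
worst-case processing time per item obey the bounds below. The constant `C` is uniform for all
`n`, `d`, `ε`, `δ` with `ε` bounded and `δ` bounded away from `1`. -/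
theorem mainTheorem2 :
    ∃ alg : StreamAlg,
      (∀ (n d : ℕ) (ε δ : ℝ), 1 ≤ n → 1 ≤ d → 0 < ε → 0 < δ → δ ≤ 1 →
        ∀ s : List (DRange n d),
          1 - δ ≤ coinMeasure.real {ω | alg.Succeeds (params n d ε δ) ω s ε}) ∧
      (∀ (ε₀ δ₀ : ℝ), 0 < ε₀ → 0 < δ₀ → δ₀ < 1 →
        ∃ C : ℝ, 0 < C ∧
          ∀ (n d : ℕ) (ε δ : ℝ), 1 ≤ n → 1 ≤ d → 0 < ε → ε ≤ ε₀ → 0 < δ → δ ≤ δ₀ →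
            ∀ (ω : ℕ → Bool) (s : List (DRange n d)),
              ((alg.state (params n d ε δ) ω s).space : ℝ)
                  ≤ C * ((n * d : ℝ) / ε ^ 2 * Real.log (1 / δ)) ∧
              ∀ b : DRange n d,
                ((alg.step (params n d ε δ) ω (alg.state (params n d ε δ) ω s) b).time : ℝ)
                  ≤ C * ((n * d : ℝ) ^ 4 * (n : ℝ) ^ d * (1 / ε ^ 2) * Real.log (1 / δ))) :=
  ⟨RangeSketch.rangeAlg, RangeSketch.success_probability, RangeSketch.resource_bounds⟩
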